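/- For $\kappa>0$ let $\mathcal H_{\mathrm{toy}}(\kappa)=-\kappa^2\partial_z^2+W$ be the self-adjoint operator on $L^2(\mathbb R)$ with maximal domain (all $u\in L^2(\mathbb R)$ with $u,u'$ locally absolutely continuous and $-\kappa^2u''+Wu\in L^2(\mathbb R)$), where $W(z)=-z$ for $z\le 0$ and $W(z)=1$ for $z>0$. Let $\mathsf A(z)=\mathrm{Ai}(-z)$ be the reverse Airy function and let $z_{\mathsf A}(1)<z_{\mathsf A}(2)<\cdots$ be its real zeros (all positive). There exist real numbers $\alpha_{j,n}$ and smooth real profiles $\Psi_{j,n}$ on $(-\infty,0]$ and $\Phi_{j,n}$ on $[0,\infty)$ ($j\ge 0$, $n\ge 1$), all decaying exponentially at infinity, with $\alpha_{0,n}=z_{\mathsf A}(n)$, with $\Psi_{0,n}$ an $L^2(\mathbb R_-)$-normalized Dirichlet eigenfunction of $-\partial_s^2-s$ on $\mathbb R_-$ for the eigenvalue $z_{\mathsf A}(n)$, and with $\Phi_{0,n}=0$, such that the following holds. For $J\ge 0$ and a smooth compactly supported $\chi:\mathbb R\to\mathbb R$ equal to $1$ near $0$, set $$\psi^{[J]}_{n,\kappa}(z)=\begin{cases}\displaystyle\sum_{j=0}^{J+2}\Psi_{j,n}\Big(\frac{z}{\kappa^{2/3}}\Big)\kappa^{j/3},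 & z\le 0,\\[2ex] \displaystyle\sum_{j=0}^{J+2}\Phi_{j,n}\Big(\frac{z}{\kappa}\Big)\kappa^{j/3}+\Psi_{J+2,n}'(0)\,\kappa^{J/3}\,z\,\chi\Big(\frac z\kappa\Big), & z> 0.\end{cases}$$ 1. (Quasimodes.) For all $n\ge1$, $J\ge0$, $\chi$ as above and $\kappa_1>0$ there is $C$ such that for all $\kappa\in(0,\kappa_1]$ the function $\psi^{[J]}_{n,\kappa}$ belongs to the domain of $\mathcal H_{\mathrm{toy}}(\kappa)$ and $$\Big\|\Big(\mathcal H_{\mathrm{toy}}(\kappa)-\kappa^{2/3}\sum_{j=0}^{J+2}\alpha_{j,n}\kappa^{j/3}\Big)\psi^{[J]}_{n,\kappa}\Big\|_{L^2(\mathbb R)}\le C\,\kappa^{1+J/3}.$$ 2. (Eigenvalues.) For every $N_0\in\mathbb N$ there is $\kappa_0>0$ such that for all $\kappa\in(0,\kappa_0)$ the operator $\mathcal H_{\mathrm{toy}}(\kappa)$ has at least $N_0$ eigenvalues below $1$. For $1\le n\le N_0$ and $\kappa\in(0,\kappa_0)$ the $n$-th eigenvalue $\lambda_{\mathrm{toy},n}(\kappa)$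 in increasing order exists, is simple, and is the sum of the convergent series $$\lambda_{\mathrm{toy},n}(\kappa)=\kappa^{2/3}\sum_{j=0}^{\infty}\alpha_{j,n}\,\kappa^{j/3}.$$ 3. (Eigenvectors.) There are functions $\psi_{n,\kappa}\in L^2(\mathbb R)$ ($n\ge 1$, $\kappa>0$) such that, for every $N_0$, the number $\kappa_0$ in 2 can be chosen so that for $1\le n\le N_0$ and $\kappa\in(0,\kappa_0)$ the function $\psi_{n,\kappa}$ is an eigenvector of $\mathcal H_{\mathrm{toy}}(\kappa)$ for $\lambda_{\mathrm{toy},n}(\kappa)$, and so that for $1\le n\le N_0$, all $J\ge 0$ and all $\chi$ as above there is $C$ with $$\big\|\psi_{n,\kappa}-\psi^{[J]}_{n,\kappa}\big\|_{L^2(\mathbb R)}\le C\,\kappa^{(J+4)/3}\qquad\text{for all }\kappa\in(0,\kappa_0).$$ -/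

import Mathlib

open MeasureTheory Filter Topology
open scoped ContDiff

noncomputable section

namespace ToyModel

/-- The complex Hilbert space `L²(ℝ)`. -/
abbrev L2 : Type := Lp ℂ 2 (volume : Measure ℝ)

/-- The discontinuous triangular potential: `W z = -z` for `z ≤ 0` and `W z = 1` for `z > 0`. -/
def W (z : ℝ) : ℝ := if z ≤ 0 then -z else 1

/-- `u` has a representative `ψ` of class `C¹` whose derivative `v` is locally absolutely
continuous, and `-κ² u'' + W u = f` holds almost everywhere. The last two requirements are
written in the integrated form `κ² (v z - v 0) = ∫₀ᶻ (W u - f)`. -/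
def ToyRel (κ : ℝ) (u f : L2) : Prop :=
  ∃ ψ v : ℝ → ℂ, ψ =ᵐ[volume] u ∧ (∀ z, HasDerivAt ψ (v z) z) ∧
    ∀ z : ℝ, (κ : ℂ) ^ 2 * (v z - v 0) = ∫ t in (0 : ℝ)..z, ((W t : ℂ) * u t - f t)

lemma locallyIntegrable_coe (f : L2) : LocallyIntegrable (f : ℝ → ℂ) volume :=
  (Lp.memLp f).locallyIntegrable (by norm_num)

lemma locallyIntegrable_W_mul (u : L2) :
    LocallyIntegrable (fun t => (W t : ℂ) * u t) volume := by
  intro x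
  refine ⟨Metric.closedBall x 1, Metric.closedBall_mem_nhds x one_pos, ?_⟩
  have hu : IntegrableOn (u : ℝ → ℂ) (Metric.closedBall x 1) :=
    (locallyIntegrable_coe u).integrableOn_isCompact (isCompact_closedBall x 1)
  have hm : Measurable (fun t => (W t : ℂ)) := by
    unfold W
    exact Complex.measurable_ofReal.comp
      (Measurable.ite measurableSet_Iic measurable_neg measurable_const)
  refine Integrable.bdd_mul (c := |x| + 2) hu hm.aestronglyMeasurable ?_
  refine (ae_restrict_iff' Metric.isClosed_closedBall.measurableSet).2 (ae_of_all _ ?_)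
  intro t ht
  rw [Metric.mem_closedBall, Real.dist_eq] at ht
  have h1 : |t| ≤ |x| + 1 := by
    have := abs_add_le (t - x) x
    simp only [sub_add_cancel] at this
    linarith
  have h2 := abs_nonneg x
  rw [Complex.norm_real, Real.norm_eq_abs]
  unfold W
  split_ifs
  · rw [abs_neg]; linarith
  · rw [abs_one]; linarith

lemma intervalIntegrable_rhs (u f : L2) (a b : ℝ) :
    IntervalIntegrable (fun t => (W t : ℂ) * u t - f t) volume a b := by
  have h : LocallyIntegrable (fun t => (W t : ℂ) * u t - f t) volume :=
    (locallyIntegrable_W_mul u).sub (locallyIntegrable_coe f)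
  exact (h.integrableOn_isCompact isCompact_uIcc).intervalIntegrable

/-- The graph of the operator `-κ² ∂² + W` on its maximal domain in `L²(ℝ)`. -/
def toyGraph (κ : ℝ) : Submodule ℂ (L2 × L2) where
  carrier := {p | ToyRel κ p.1 p.2}
  zero_mem' := by
    refine ⟨0, 0, (Lp.coeFn_zero ℂ 2 volume).symm, fun z => hasDerivAt_const z 0, fun z => ?_⟩
    have h : ∀ᵐ t ∂(volume : Measure ℝ),
        (W t : ℂ) * ((0 : L2 × L2).1 : ℝ → ℂ) t - ((0 : L2 × L2).2 : ℝ → ℂ) t = 0 := by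
      filter_upwards [Lp.coeFn_zero ℂ 2 (volume : Measure ℝ)] with t ht
      simp only [Prod.fst_zero, Prod.snd_zero, ht, Pi.zero_apply, mul_zero, sub_zero]
    rw [intervalIntegral.integral_congr_ae (g := fun _ => 0) (h.mono fun t ht _ => ht)]
    simp
  add_mem' := by
    rintro ⟨u, f⟩ ⟨u', f'⟩ ⟨ψ, v, h1, h2, h3⟩ ⟨ψ', v', h1', h2', h3'⟩
    refine ⟨ψ + ψ', v + v', (h1.add h1').trans (Lp.coeFn_add u u').symm,
      fun z => (h2 z).add (h2' z), fun z => ?_⟩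
    have h : ∀ᵐ t ∂(volume : Measure ℝ),
        (W t : ℂ) * ((u + u' : L2) : ℝ → ℂ) t - ((f + f' : L2) : ℝ → ℂ) t
          = ((W t : ℂ) * u t - f t) + ((W t : ℂ) * u' t - f' t) := by
      filter_upwards [Lp.coeFn_add u u', Lp.coeFn_add f f'] with t ht ht'
      rw [ht, ht', Pi.add_apply, Pi.add_apply]
      ring
    simp only [Prod.mk_add_mk]
    rw [intervalIntegral.integral_congr_ae (h.mono fun t ht _ => ht),
      intervalIntegral.integral_add (intervalIntegrable_rhs u f 0 z)
        (intervalIntegrable_rhs u' f' 0 z)]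
    have e := h3 z
    have e' := h3' z
    simp only at e e'
    rw [← e, ← e', Pi.add_apply, Pi.add_apply]
    ring
  smul_mem' := by
    rintro c ⟨u, f⟩ ⟨ψ, v, h1, h2, h3⟩
    refine ⟨c • ψ, c • v, (h1.const_smul c).trans (Lp.coeFn_smul c u).symm,
      fun z => (h2 z).const_smul c, fun z => ?_⟩
    have h : ∀ᵐ t ∂(volume : Measure ℝ),
        (W t : ℂ) * ((c • u : L2) : ℝ → ℂ) t - ((c • f : L2) : ℝ → ℂ) t
          = c * ((W t : ℂ) * u t - f t) := by
      filter_upwards [Lp.coeFn_smul c u, Lp.coeFn_smul c f] with t ht ht'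
      rw [ht, ht', Pi.smul_apply, Pi.smul_apply, smul_eq_mul, smul_eq_mul]
      ring
    simp only [Prod.smul_mk]
    rw [intervalIntegral.integral_congr_ae (h.mono fun t ht _ => ht),
      intervalIntegral.integral_const_mul]
    have e := h3 z
    simp only at e
    rw [← e, Pi.smul_apply, Pi.smul_apply, smul_eq_mul, smul_eq_mul]
    ring

/-- The toy operator `-κ² ∂² + W`, as an unbounded operator on `L²(ℝ)`. Its domain is the maximal
one, the set of `u` in `L²` with `u` and `u'` locally absolutely continuous and `-κ² u'' + W u` in
`L²`; as `W` is bounded below, this is the self-adjoint realization when `κ ≠ 0`. -/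
def Htoy (κ : ℝ) : L2 →ₗ.[ℂ] L2 := (toyGraph κ).toLinearPMap

/-- The relation defining the operator is single-valued. -/
lemma toyGraph_snd_eq_zero (κ : ℝ) (p : L2 × L2) (hp : p ∈ toyGraph κ) (h0 : p.1 = 0) :
    p.2 = 0 := by
  obtain ⟨u, f⟩ := p
  obtain ⟨ψ, v, h1, h2, h3⟩ := hp
  simp only at h0 h1 h3 ⊢
  subst h0
  have hψ : ψ = fun _ => 0 := by
    refine Measure.eq_of_ae_eq (μ := (volume : Measure ℝ))
      (h1.trans (Lp.coeFn_zero ℂ 2 volume)) ?_ continuous_const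
    exact continuous_iff_continuousAt.2 fun z => (h2 z).continuousAt
  have hv : ∀ z, v z = 0 := fun z => by
    have h := h2 z
    rw [hψ] at h
    exact h.unique (hasDerivAt_const z 0)
  have hI : ∀ z : ℝ, ∫ t in (0 : ℝ)..z, ((W t : ℂ) * ((0 : L2) : ℝ → ℂ) t - f t) = 0 := fun z => by
    rw [← h3 z, hv, hv]; simp
  have hd := LocallyIntegrable.ae_hasDerivAt_integral
    ((locallyIntegrable_W_mul 0).sub (locallyIntegrable_coe f))
  have hf : (f : ℝ → ℂ) =ᵐ[volume] 0 := by
    filter_upwards [hd, Lp.coeFn_zero ℂ 2 (volume : Measure ℝ)] with t ht h0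
    have h := ht 0
    have hI' : (fun z : ℝ => ∫ t in (0 : ℝ)..z,
        ((fun t => (W t : ℂ) * ((0 : L2) : ℝ → ℂ) t) - (f : ℝ → ℂ)) t) = fun _ => 0 := by
      funext z
      exact hI z
    rw [hI'] at h
    have h4 := h.unique (hasDerivAt_const t 0)
    simp only [Pi.sub_apply, h0, Pi.zero_apply, mul_zero, zero_sub, neg_eq_zero] at h4
    exact h4
  exact (Lp.eq_zero_iff_ae_eq_zero).2 hf

lemma mem_graph_Htoy (κ : ℝ) (u f : L2) : (u, f) ∈ (Htoy κ).graph ↔ ToyRel κ u f := by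
  unfold Htoy
  rw [Submodule.toLinearPMap_graph_eq _ (toyGraph_snd_eq_zero κ)]
  exact Iff.rfl

/-- The space of all `u` in the domain of `Htoy κ` with `Htoy κ u = μ u`. -/
def eigenspace (κ μ : ℝ) : Submodule ℂ L2 where
  carrier := {u | ∃ x : (Htoy κ).domain, (x : L2) = u ∧ Htoy κ x = (μ : ℂ) • u}
  zero_mem' := ⟨0, rfl, by simp⟩
  add_mem' := by
    rintro _ _ ⟨x, rfl, hx⟩ ⟨y, rfl, hy⟩
    exact ⟨x + y, rfl, by rw [LinearPMap.map_add, hx, hy, smul_add]⟩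
  smul_mem' := by
    rintro c _ ⟨x, rfl, hx⟩
    exact ⟨c • x, rfl, by rw [LinearPMap.map_smul, hx, smul_comm]⟩

/-- The set of eigenvalues of `Htoy κ` below `1`. -/
def eigenvaluesBelowOne (κ : ℝ) : Set ℝ := {μ | μ < 1 ∧ eigenspace κ μ ≠ ⊥}

/-- `x` is the `n`-th element (counted from `n = 1`) of `S` in increasing order. -/
def IsNthSmallest (S : Set ℝ) (n : ℕ) (x : ℝ) : Prop :=
  x ∈ S ∧ (S ∩ Set.Iic x).encard = n

/-- The Airy function, through its absolutely convergent integral representation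
`Ai x = (1 / 2π) ∫ exp (i (ζ³ / 3 + x ζ)) dζ` over the line `ζ = t + i`, `t` real. (Shifting the
line down to the real axis gives `Ai x = (1 / π) ∫₀^∞ cos (t³ / 3 + x t) dt`.) The integral is real,
as the integrand at `-t` is the complex conjugate of the integrand at `t`. -/
def airyAi (x : ℝ) : ℝ :=
  (1 / (2 * Real.pi)) * (∫ t : ℝ, Complex.exp (Complex.I *
    (((t : ℂ) + Complex.I) ^ 3 / 3 + (x : ℂ) * ((t : ℂ) + Complex.I)))).re

/-- The reverse Airy function `A z = Ai (-z)`. -/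
def airyA (z : ℝ) : ℝ := airyAi (-z)

/-- The set of real zeros of the reverse Airy function. -/
def airyZeros : Set ℝ := {z | airyA z = 0}

/-- Exponential decay on the left half-line. -/
def ExpDecayLeft (f : ℝ → ℝ) : Prop :=
  ∃ C c : ℝ, 0 < c ∧ ∀ s ≤ 0, |f s| ≤ C * Real.exp (c * s)

/-- Exponential decay on the right half-line. -/
def ExpDecayRight (f : ℝ → ℝ) : Prop :=
  ∃ C c : ℝ, 0 < c ∧ ∀ s, 0 ≤ s → |f s| ≤ C * Real.exp (-(c * s))

/-- `g` is (on `s ≤ 0`) a normalized eigenfunction, with eigenvalue `a`, of the Dirichlet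
realization of `-∂² - s` on the left half-line. -/
structure IsNormalizedAiryEigenfunction (a : ℝ) (g : ℝ → ℝ) : Prop where
  equation : ∀ s < 0, -(deriv (deriv g) s) - s * g s = a * g s
  dirichlet : g 0 = 0
  normalized : ∫ s in Set.Iic (0 : ℝ), g s ^ 2 = 1

/-- Left profiles `Ψ j` and right profiles `Φ j`, of which only the restrictions to `s ≤ 0` and
`σ ≥ 0` respectively matter: they are smooth up to `0`, decay exponentially, `Ψ 0` is a normalized
Dirichlet eigenfunction of `-∂² - s` for the eigenvalue `a`, and `Φ 0` vanishes. -/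
structure IsProfilePair (a : ℝ) (Ψ Φ : ℕ → ℝ → ℝ) : Prop where
  smooth_left : ∀ j, ContDiff ℝ ∞ (Ψ j)
  smooth_right : ∀ j, ContDiff ℝ ∞ (Φ j)
  decay_left : ∀ j, ExpDecayLeft (Ψ j)
  decay_right : ∀ j, ExpDecayRight (Φ j)
  left_zero : IsNormalizedAiryEigenfunction a (Ψ 0)
  right_zero : ∀ σ, 0 ≤ σ → Φ 0 σ = 0

/-- A smooth compactly supported cutoff equal to `1` near `0`. -/
structure IsCutoff (χ : ℝ → ℝ) : Prop where
  smooth : ContDiff ℝ ∞ χ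
  compact : HasCompactSupport χ
  eq_one : ∀ᶠ z in 𝓝 (0 : ℝ), χ z = 1

/-- The two-scale sum of profiles truncated at order `J + 2`, at the scale `z / κ^(2/3)` on the left
and `z / κ` on the right; the term with the cutoff makes the derivative continuous at `0`. -/
def quasimode (Ψ Φ : ℕ → ℝ → ℝ) (χ : ℝ → ℝ) (J : ℕ) (κ z : ℝ) : ℝ :=
  if z ≤ 0 then
    ∑ j ∈ Finset.range (J + 3), Ψ j (z / κ ^ (2 / 3 : ℝ)) * κ ^ ((j : ℝ) / 3)
  else
    ∑ j ∈ Finset.range (J + 3), Φ j (z / κ) * κ ^ ((j : ℝ) / 3)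
      + deriv (Ψ (J + 2)) 0 * κ ^ ((J : ℝ) / 3) * z * χ (z / κ)

/-- The expansion of the eigenvalue truncated at order `J + 2`. -/
def quasiEigenvalue (α : ℕ → ℝ) (J : ℕ) (κ : ℝ) : ℝ :=
  κ ^ (2 / 3 : ℝ) * ∑ j ∈ Finset.range (J + 3), α j * κ ^ ((j : ℝ) / 3)

end ToyModel

end

/-!
With `h = κ ^ (1 / 3)` and `μ = h² l`, the eigenvalue equation on the left becomes Airy's equation
in `s = z / h²`, with square-integrable solution `A (s + l)`, and on the right it has the
square-integrable solution `exp (- √(1 - h² l) σ)`, `σ = z / h³`. Uniqueness of these solutions up to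
a factor (`exists_eq_mul_of_sq_integrable`) shows that `μ < 1` is an eigenvalue, then a simple one,
exactly when the two match to first order at `0`, which is the scalar equation `Matching h l`:
`h A'(l) + √(1 - h² l) A(l) = 0` (`eigenspace_form`, `mem_eigenvaluesBelowOne_iff`).

Near the `n`-th zero of `A` this equation reads `h = - q / √(1 + l q²)` with `q = A / A'`. The right
side has derivative `-1` at the zero, so it is inverted by an analytic function `l = ℓ h`, whose
Taylor coefficients are the numbers `α n j` (`exists_isBranch`). All matchings are positive, and the
Riccati equation for `A' / A` shows that there is at most one between two consecutive zeros
(`Matching.unique`), so the branches near the first zeros give the first eigenvalues in order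
(`isNthSmallest_eigenvalue`).

The profiles are the Taylor coefficients in `h` of the exact eigenfunctions
`c A (s + ℓ h)` and `c A (ℓ h) exp (- √(1 - h² ℓ h) σ)` at fixed `s` and `σ`. These extend
holomorphically to complex `h` in a disc, with an exponential bound uniform in `h`, so that Cauchy's
estimates give the decay of the profiles and of the Taylor remainders, hence the expansion of the
eigenvectors (`IsBranch.exists_eigenfunction_bound`). Comparing coefficients in the differential
equations and in the matching at `0` gives the hierarchy of equations for the profiles, hence the
quasimode estimate (`IsBranch.exists_quasimode_bound`).

The function `A` enters through its contour integral, which yields an entire solution of Airy's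
equation decaying exponentially to the left in horizontal strips. It does not vanish identically by
Fourier inversion (`exists_airyA_ne_zero`).
-/

noncomputable section

namespace ToyModel

/-! ### The Airy function as an entire function -/

/-- The integrand of the integral for `Ai (-z)`, for complex `z`. -/
def airyKernel (z : ℂ) (t : ℝ) : ℂ :=
  Complex.exp (Complex.I * (((t : ℂ) + Complex.I) ^ 3 / 3 + (-z) * ((t : ℂ) + Complex.I)))

/-- The moment of order `k` of the Airy integrand. -/
def airyMoment (k : ℕ) (z : ℂ) : ℂ := ∫ t : ℝ, ((t : ℂ) + Complex.I) ^ k * airyKernel z t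

/-- The entire extension of the reverse Airy function. -/
def airyC (z : ℂ) : ℂ := (1 / (2 * Real.pi) : ℝ) * airyMoment 0 z

lemma norm_airyKernel (z : ℂ) (t : ℝ) :
    ‖airyKernel z t‖ = Real.exp (1 / 3 - t ^ 2 + t * z.im + z.re) := by
  unfold airyKernel
  rw [Complex.norm_exp]
  congr 1
  have h : ((t : ℂ) + Complex.I) ^ 3 = ((t ^ 3 - 3 * t : ℝ) : ℂ) +
      ((3 * t ^ 2 - 1 : ℝ) : ℂ) * Complex.I := by
    have hI : Complex.I ^ 2 = -1 := Complex.I_sq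
    have hI3 : Complex.I ^ 3 = -Complex.I := Complex.I_pow_three
    push_cast
    linear_combination (3 * (t : ℂ)) * hI + hI3
  have h3 : Complex.I * (((t : ℂ) + Complex.I) ^ 3 / 3 + (-z) * ((t : ℂ) + Complex.I))
      = Complex.I * ((((t ^ 3 - 3 * t) / 3 : ℝ) : ℂ) +
      (((3 * t ^ 2 - 1) / 3 : ℝ) : ℂ) * Complex.I + (-z) * ((t : ℂ) + Complex.I)) := by
    rw [h]; push_cast; ring
  rw [h3]
  simp only [Complex.mul_re, Complex.add_re, Complex.add_im, Complex.mul_im, Complex.neg_re,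
    Complex.neg_im, Complex.ofReal_re, Complex.ofReal_im, Complex.I_re, Complex.I_im]
  ring

/-- Gaussian domination of the Airy integrand, uniform in horizontal strips. -/
lemma airyKernel_bound (k : ℕ) (B : ℝ) : ∃ C : ℝ, 0 ≤ C ∧ ∀ z : ℂ, |z.im| ≤ B → ∀ t : ℝ,
    ‖((t : ℂ) + Complex.I) ^ k * airyKernel z t‖
      ≤ C * Real.exp z.re * Real.exp (-(1 / 2) * t ^ 2) := by
  refine ⟨k.factorial * Real.exp (4 / 3 + (B + 1) ^ 2 / 2), by positivity, fun z hz t => ?_⟩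
  rw [norm_mul, norm_pow, norm_airyKernel]
  have h1 : ‖(t : ℂ) + Complex.I‖ ≤ |t| + 1 := by
    refine (norm_add_le _ _).trans ?_
    simp
  have h2 : (|t| + 1) ^ k ≤ k.factorial * Real.exp (|t| + 1) := by
    have := Real.pow_div_factorial_le_exp (|t| + 1) (by positivity) k
    rwa [div_le_iff₀ (by positivity), mul_comm] at this
  have h3 : t * z.im ≤ |t| * B := by
    refine (le_abs_self _).trans ?_
    rw [abs_mul]
    gcongr
  calc ‖(t : ℂ) + Complex.I‖ ^ k * Real.exp (1 / 3 - t ^ 2 + t * z.im + z.re)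
      ≤ (k.factorial * Real.exp (|t| + 1)) * Real.exp (1 / 3 - t ^ 2 + t * z.im + z.re) := by
        gcongr
        exact (pow_le_pow_left₀ (norm_nonneg _) h1 k).trans h2
    _ = k.factorial * Real.exp ((|t| + 1) + (1 / 3 - t ^ 2 + t * z.im + z.re)) := by
        rw [mul_assoc, ← Real.exp_add]
    _ ≤ k.factorial * Real.exp ((4 / 3 + (B + 1) ^ 2 / 2) + z.re + (-(1 / 2) * t ^ 2)) := by
        -- `(B + 1) |t| ≤ (B + 1)² / 2 + t² / 2`
        refine mul_le_mul_of_nonneg_left (Real.exp_le_exp.2 ?_) (by positivity)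
        nlinarith [sq_nonneg (|t| - (B + 1)), sq_abs t]
    _ = _ := by rw [Real.exp_add, Real.exp_add]; ring

lemma continuous_airyKernel (k : ℕ) (z : ℂ) :
    Continuous fun t : ℝ => ((t : ℂ) + Complex.I) ^ k * airyKernel z t := by
  unfold airyKernel
  fun_prop

lemma integrable_gauss : Integrable fun t : ℝ => Real.exp (-(1 / 2) * t ^ 2) :=
  integrable_exp_neg_mul_sq (by norm_num)

lemma integrable_airyKernel (k : ℕ) (z : ℂ) :
    Integrable fun t : ℝ => ((t : ℂ) + Complex.I) ^ k * airyKernel z t := by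
  obtain ⟨C, -, hC⟩ := airyKernel_bound k |z.im|
  exact (integrable_gauss.const_mul (C * Real.exp z.re)).mono'
    (continuous_airyKernel k z).aestronglyMeasurable (ae_of_all _ fun t => hC z le_rfl t)

lemma airyMoment_bound (k : ℕ) (B : ℝ) : ∃ C : ℝ, 0 ≤ C ∧ ∀ z : ℂ, |z.im| ≤ B →
    ‖airyMoment k z‖ ≤ C * Real.exp z.re := by
  obtain ⟨C, hC0, hC⟩ := airyKernel_bound k B
  refine ⟨C * ∫ t : ℝ, Real.exp (-(1 / 2) * t ^ 2),
    mul_nonneg hC0 (integral_nonneg fun t => (Real.exp_pos _).le), fun z hz => ?_⟩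
  have := norm_integral_le_of_norm_le (integrable_gauss.const_mul (C * Real.exp z.re))
    (ae_of_all _ fun t => hC z hz t)
  rw [integral_const_mul] at this
  exact this.trans_eq (by ring)

lemma hasDerivAt_airyMoment (k : ℕ) (z : ℂ) :
    HasDerivAt (airyMoment k) (-Complex.I * airyMoment (k + 1) z) z := by
  obtain ⟨C, hC0, hC⟩ := airyKernel_bound (k + 1) (|z.im| + 1)
  have key := hasDerivAt_integral_of_dominated_loc_of_deriv_le (μ := (volume : Measure ℝ))
    (F := fun (w : ℂ) (t : ℝ) => ((t : ℂ) + Complex.I) ^ k * airyKernel w t)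
    (F' := fun (w : ℂ) (t : ℝ) => -Complex.I * (((t : ℂ) + Complex.I) ^ (k + 1) * airyKernel w t))
    (bound := fun t => C * Real.exp (z.re + 1) * Real.exp (-(1 / 2) * t ^ 2))
    (Metric.ball_mem_nhds z one_pos)
    (Eventually.of_forall fun w => (continuous_airyKernel k w).aestronglyMeasurable)
    (integrable_airyKernel k z)
    ((continuous_airyKernel (k + 1) z).const_mul (-Complex.I)).aestronglyMeasurable
    (ae_of_all _ fun t w hw => ?_) (integrable_gauss.const_mul _)
    (ae_of_all _ fun t w _ => ?_)
  · have := key.2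
    rw [integral_const_mul] at this
    exact this
  · rw [Metric.mem_ball, Complex.dist_eq] at hw
    have him : |w.im| ≤ |z.im| + 1 := by
      have h1 := Complex.abs_im_le_norm (w - z)
      rw [Complex.sub_im] at h1
      have h2 := abs_add_le (w.im - z.im) z.im
      rw [sub_add_cancel] at h2
      linarith
    have hre : w.re ≤ z.re + 1 := by
      have h1 := (le_abs_self _).trans (Complex.abs_re_le_norm (w - z))
      rw [Complex.sub_re] at h1
      linarith
    rw [norm_mul, norm_neg, Complex.norm_I, one_mul]
    refine (hC w him t).trans ?_
    gcongr
  · unfold airyKernel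
    have h1 : HasDerivAt (fun w : ℂ => Complex.I * (((t : ℂ) + Complex.I) ^ 3 / 3
        + (-w) * ((t : ℂ) + Complex.I))) (Complex.I * ((-1) * ((t : ℂ) + Complex.I))) w :=
      (((hasDerivAt_id w).neg.mul_const _).const_add _).const_mul _
    exact (h1.cexp.const_mul (((t : ℂ) + Complex.I) ^ k)).congr_deriv (by ring)

lemma airyMoment_two (z : ℂ) : airyMoment 2 z = z * airyMoment 0 z := by
  have hd : ∀ t : ℝ, HasDerivAt (fun t : ℝ => airyKernel z t)
      (Complex.I * ((((t : ℂ) + Complex.I) ^ 2 * airyKernel z t)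
        - z * (((t : ℂ) + Complex.I) ^ 0 * airyKernel z t))) t := fun t => by
    unfold airyKernel
    have h0 : HasDerivAt (fun t : ℝ => (t : ℂ) + Complex.I) 1 t :=
      (HasDerivAt.ofReal_comp (hasDerivAt_id t)).add_const _ |>.congr_deriv (by simp)
    have h1 := ((((h0.pow 3).div_const 3).add (h0.const_mul (-z))).const_mul Complex.I).cexp
    refine h1.congr_deriv ?_
    simp only [Pi.add_apply, Pi.pow_apply]
    push_cast
    ring
  have hi := ((integrable_airyKernel 2 z).sub ((integrable_airyKernel 0 z).const_mul z)).const_mul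
    Complex.I
  have h := integral_eq_zero_of_hasDerivAt_of_integrable hd hi
    (by simpa using integrable_airyKernel 0 z)
  rw [integral_const_mul, integral_sub (integrable_airyKernel 2 z)
    ((integrable_airyKernel 0 z).const_mul z), integral_const_mul] at h
  have h' := (mul_eq_zero.1 h).resolve_left Complex.I_ne_zero
  exact sub_eq_zero.1 h'

lemma hasDerivAt_airyC (z : ℂ) :
    HasDerivAt airyC ((1 / (2 * Real.pi) : ℝ) * (-Complex.I * airyMoment 1 z)) z :=
  (hasDerivAt_airyMoment 0 z).const_mul _

lemma differentiable_airyC : Differentiable ℂ airyC := fun z =>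
  (hasDerivAt_airyC z).differentiableAt

/-- Airy's equation for the reverse function: `A'' = - z A`. -/
lemma hasDerivAt_deriv_airyC (z : ℂ) : HasDerivAt (deriv airyC) (-z * airyC z) z := by
  have h : deriv airyC = fun z => ((1 / (2 * Real.pi) : ℝ) : ℂ) * (-Complex.I * airyMoment 1 z) :=
    funext fun z => (hasDerivAt_airyC z).deriv
  rw [h]
  refine (((hasDerivAt_airyMoment 1 z).const_mul (-Complex.I)).const_mul
    (((1 / (2 * Real.pi) : ℝ) : ℂ))).congr_deriv ?_
  rw [airyMoment_two]
  unfold airyC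
  linear_combination (((1 / (2 * Real.pi) : ℝ) : ℂ) * z * airyMoment 0 z) * Complex.I_sq

/-- Exponential decay of the reverse Airy function to the left, in horizontal strips. -/
lemma airyC_bound (B : ℝ) : ∃ C : ℝ, 0 ≤ C ∧ ∀ z : ℂ, |z.im| ≤ B →
    ‖airyC z‖ ≤ C * Real.exp z.re := by
  obtain ⟨C, hC0, hC⟩ := airyMoment_bound 0 B
  refine ⟨‖((1 / (2 * Real.pi) : ℝ) : ℂ)‖ * C, by positivity, fun z hz => ?_⟩
  unfold airyC
  rw [norm_mul, mul_assoc]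
  gcongr
  exact hC z hz

lemma airyA_eq_re (x : ℝ) : airyA x = (airyC x).re := by
  unfold airyA airyAi airyC airyMoment airyKernel
  rw [Complex.re_ofReal_mul]
  simp

/-- The derivative of the reverse Airy function. -/
def airyA' (x : ℝ) : ℝ := (deriv airyC x).re

lemma hasDerivAt_airyA (x : ℝ) : HasDerivAt airyA (airyA' x) x := by
  have h : HasDerivAt airyC (deriv airyC x) (x : ℂ) := (differentiable_airyC _).hasDerivAt
  have h2 := h.real_of_complex
  exact h2.congr_of_eventuallyEq (Eventually.of_forall airyA_eq_re)

lemma hasDerivAt_airyA' (x : ℝ) : HasDerivAt airyA' (-x * airyA x) x := by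
  have h2 := (hasDerivAt_deriv_airyC x).real_of_complex
  refine h2.congr_deriv ?_
  rw [airyA_eq_re, ← Complex.ofReal_neg, Complex.re_ofReal_mul]

lemma analyticAt_re_ofReal {f : ℂ → ℂ} {x : ℝ} (hf : AnalyticAt ℂ f x) :
    AnalyticAt ℝ (fun x : ℝ => (f x).re) x := by
  have h1 : AnalyticAt ℝ (fun x : ℝ => (x : ℂ)) x := Complex.ofRealCLM.analyticAt x
  have h2 : AnalyticAt ℝ f (x : ℂ) := hf.restrictScalars
  have h3 : AnalyticAt ℝ (fun x : ℝ => f x) x := h2.comp h1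
  exact (Complex.reCLM.analyticAt _).comp h3

lemma analyticAt_airyA (x : ℝ) : AnalyticAt ℝ airyA x := by
  have h : airyA = fun x : ℝ => (airyC x).re := funext airyA_eq_re
  rw [h]
  exact analyticAt_re_ofReal (differentiable_airyC.analyticAt _)

lemma analyticAt_airyA' (x : ℝ) : AnalyticAt ℝ airyA' x :=
  analyticAt_re_ofReal (differentiable_airyC.analyticAt _).deriv

lemma continuous_airyA : Continuous airyA :=
  continuous_iff_continuousAt.2 fun x => (hasDerivAt_airyA x).continuousAt

lemma continuous_airyA' : Continuous airyA' :=
  continuous_iff_continuousAt.2 fun x => (hasDerivAt_airyA' x).continuousAt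

lemma airyA_bound : ∃ C : ℝ, 0 ≤ C ∧ ∀ x : ℝ, |airyA x| ≤ C * Real.exp x := by
  obtain ⟨C, hC0, hC⟩ := airyC_bound 0
  refine ⟨C, hC0, fun x => ?_⟩
  rw [airyA_eq_re]
  exact (Complex.abs_re_le_norm _).trans (by simpa using hC x (by simp))

lemma airyMoment_zero_im (x : ℝ) : (airyMoment 0 x).im = 0 := by
  have hc : ∀ t : ℝ, (starRingEnd ℂ) (airyKernel x t) = airyKernel x (-t) := fun t => by
    unfold airyKernel
    rw [← Complex.exp_conj]
    congr 1
    simp only [map_mul, map_add, map_div₀, map_pow, map_neg, Complex.conj_I, Complex.conj_ofReal,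
      Complex.ofReal_neg, map_ofNat]
    ring
  have h : (starRingEnd ℂ) (airyMoment 0 x) = airyMoment 0 x := by
    unfold airyMoment
    rw [← integral_conj, ← integral_neg_eq_self]
    congr 1
    ext t
    simp only [pow_zero, one_mul]
    rw [hc, neg_neg]
  exact Complex.conj_eq_iff_im.1 h

/-- The Airy integral is a Fourier transform, so Fourier inversion shows that it does not vanish
identically. -/
lemma exists_airyA_ne_zero : ∃ x, airyA x ≠ 0 := by
  by_contra! h
  have h0 : ∀ x : ℝ, airyMoment 0 x = 0 := fun x => by
    have h1 := h x
    rw [airyA_eq_re] at h1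
    unfold airyC at h1
    rw [Complex.re_ofReal_mul] at h1
    have h2 := (mul_eq_zero.1 h1).resolve_left (by positivity)
    exact Complex.ext h2 (airyMoment_zero_im x)
  have hF : FourierTransform.fourier (fun t : ℝ => airyKernel 0 t) = fun _ => 0 := by
    ext ξ
    rw [Real.fourier_real_eq_integral_exp_smul]
    have h1 : ∀ t : ℝ, Complex.exp (((-2 * Real.pi * t * ξ : ℝ) : ℂ) * Complex.I) • airyKernel 0 t
        = Complex.exp (-((2 * Real.pi * ξ : ℝ) : ℂ)) *
          (((t : ℂ) + Complex.I) ^ 0 * airyKernel ((2 * Real.pi * ξ : ℝ) : ℂ) t) := fun t => by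
      unfold airyKernel
      rw [smul_eq_mul, pow_zero, one_mul, ← Complex.exp_add, ← Complex.exp_add]
      congr 1
      push_cast
      linear_combination (2 * (Real.pi : ℂ) * ξ) * Complex.I_sq
    simp_rw [h1]
    rw [integral_const_mul]
    have := h0 (2 * Real.pi * ξ)
    unfold airyMoment at this
    rw [this, mul_zero]
  have hc : Continuous fun t : ℝ => airyKernel 0 t := by
    simpa using continuous_airyKernel 0 0
  have hi : Integrable fun t : ℝ => airyKernel 0 t := by
    simpa using integrable_airyKernel 0 0
  have h2 := hc.fourierInv_fourier_eq hi (by rw [hF]; exact integrable_zero _ _ _)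
  rw [hF] at h2
  have h3 := congrFun h2 0
  rw [Real.fourierInv_eq] at h3
  simp only [smul_zero, integral_zero] at h3
  exact Complex.exp_ne_zero _ h3.symm

/-! ### Second-order linear equations on the half-line -/

/-- A solution of `y'' = q y` with vanishing Cauchy data at the left end of an interval is zero:
for large `K` the function `exp (- K x) (y² + y'²)` is nonincreasing. -/
lemma linear_ode_zero_of_left {q y y' : ℝ → ℝ} {a b : ℝ} (hq : ContinuousOn q (Set.Icc a b))
    (hy : ContinuousOn y (Set.Icc a b)) (hy' : ContinuousOn y' (Set.Icc a b))
    (hd : ∀ x ∈ Set.Ioo a b, HasDerivAt y (y' x) x)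
    (hd' : ∀ x ∈ Set.Ioo a b, HasDerivAt y' (q x * y x) x) (h0 : y a = 0) (h0' : y' a = 0) :
    ∀ x ∈ Set.Icc a b, y x = 0 ∧ y' x = 0 := by
  intro x hx
  obtain ⟨K, hK⟩ := isCompact_Icc.exists_bound_of_continuousOn
    (continuousOn_const.add hq : ContinuousOn (fun t => 1 + q t) (Set.Icc a b))
  have hder : ∀ t ∈ Set.Ioo a b, HasDerivAt
      (fun t => Real.exp (-(K * t)) * (y t ^ 2 + y' t ^ 2))
      (Real.exp (-(K * t)) * (2 * (y t * y' t) * (1 + q t) - K * (y t ^ 2 + y' t ^ 2))) t := by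
    intro t ht
    have h1 := (((hasDerivAt_id t).const_mul K).neg.exp).mul
      (((hd t ht).pow 2).add ((hd' t ht).pow 2))
    refine h1.congr_deriv ?_
    simp only [id, Pi.add_apply, Pi.pow_apply, Pi.neg_apply]
    push_cast
    ring
  have hanti : AntitoneOn (fun t => Real.exp (-(K * t)) * (y t ^ 2 + y' t ^ 2))
      (Set.Icc a b) := by
    refine antitoneOn_of_deriv_nonpos (convex_Icc a b) ?_ ?_ ?_
    · exact ((by fun_prop : Continuous fun t : ℝ => Real.exp (-(K * t))).continuousOn).mul
        ((hy.pow 2).add (hy'.pow 2))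
    · rw [interior_Icc]
      exact fun t ht => (hder t ht).differentiableAt.differentiableWithinAt
    · rw [interior_Icc]
      intro t ht
      rw [(hder t ht).deriv]
      refine mul_nonpos_of_nonneg_of_nonpos (Real.exp_pos _).le ?_
      have h1 : |1 + q t| ≤ K := hK t (Set.Ioo_subset_Icc_self ht)
      have h2 : 2 * (y t * y' t) * (1 + q t) ≤ (y t ^ 2 + y' t ^ 2) * K := by
        refine (le_abs_self _).trans ?_
        rw [abs_mul]
        refine mul_le_mul ?_ h1 (abs_nonneg _) (by positivity)
        rw [abs_le]
        constructor <;> nlinarith [sq_nonneg (y t + y' t), sq_nonneg (y t - y' t)]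
      linarith
  have h := hanti (Set.left_mem_Icc.2 (hx.1.trans hx.2)) hx hx.1
  simp only [h0, h0'] at h
  have h2 : y x ^ 2 + y' x ^ 2 ≤ 0 := by
    have : Real.exp (-(K * x)) * (y x ^ 2 + y' x ^ 2) ≤ 0 := by simpa using h
    by_contra hc
    push Not at hc
    exact absurd this (not_le.2 (mul_pos (Real.exp_pos _) hc))
  constructor <;> nlinarith [sq_nonneg (y x), sq_nonneg (y' x)]

/-- A solution of `y'' = q y` with vanishing Cauchy data at the right end of an interval is
zero. -/
lemma linear_ode_zero_of_right {q y y' : ℝ → ℝ} {a b : ℝ} (hq : ContinuousOn q (Set.Icc a b))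
    (hy : ContinuousOn y (Set.Icc a b)) (hy' : ContinuousOn y' (Set.Icc a b))
    (hd : ∀ x ∈ Set.Ioo a b, HasDerivAt y (y' x) x)
    (hd' : ∀ x ∈ Set.Ioo a b, HasDerivAt y' (q x * y x) x) (h0 : y b = 0) (h0' : y' b = 0) :
    ∀ x ∈ Set.Icc a b, y x = 0 ∧ y' x = 0 := by
  have hm : Set.MapsTo (fun x : ℝ => -x) (Set.Icc (-b) (-a)) (Set.Icc a b) := fun x hx =>
    ⟨by linarith [hx.2], by linarith [hx.1]⟩
  have hm' : Set.MapsTo (fun x : ℝ => -x) (Set.Ioo (-b) (-a)) (Set.Ioo a b) := fun x hx =>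
    ⟨by linarith [hx.2], by linarith [hx.1]⟩
  have h := linear_ode_zero_of_left (q := fun x => q (-x)) (y := fun x => y (-x))
    (y' := fun x => -y' (-x)) (a := -b) (b := -a) (hq.comp continuousOn_neg hm)
    (hy.comp continuousOn_neg hm) (hy'.comp continuousOn_neg hm).neg
    (fun x hx => ((hd (-x) (hm' hx)).scomp x (hasDerivAt_neg x)).congr_deriv (by simp))
    (fun x hx => ((hd' (-x) (hm' hx)).scomp x (hasDerivAt_neg x)).neg.congr_deriv (by simp))
    (by simpa using h0) (by simpa using h0')
  intro x hx
  have := h (-x) ⟨by linarith [hx.2], by linarith [hx.1]⟩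
  simpa using this

/-- In the region where `q ≥ 0`, a square-integrable solution of `y'' = q y` with `y y' ≥ 0` at
some point vanishes beyond it: `y y'` is nondecreasing, so `y²` is nondecreasing. -/
lemma eq_zero_of_sq_integrable {q y y' : ℝ → ℝ} {a : ℝ} (hq : ∀ x, a < x → 0 ≤ q x)
    (hy : ContinuousOn y (Set.Ici a)) (hy' : ContinuousOn y' (Set.Ici a))
    (hd : ∀ x, a < x → HasDerivAt y (y' x) x)
    (hd' : ∀ x, a < x → HasDerivAt y' (q x * y x) x)
    (hi : IntegrableOn (fun x => y x ^ 2) (Set.Ioi a)) (h0 : 0 ≤ y a * y' a) :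
    ∀ x, a ≤ x → y x = 0 := by
  have hg : MonotoneOn (fun x => y x * y' x) (Set.Ici a) := by
    have hder : ∀ x, a < x → HasDerivAt (fun x => y x * y' x)
        (y' x * y' x + y x * (q x * y x)) x := fun x hx => (hd x hx).mul (hd' x hx)
    refine monotoneOn_of_deriv_nonneg (convex_Ici a) (hy.mul hy') ?_ ?_
    · rw [interior_Ici]
      exact fun x hx => (hder x hx).differentiableAt.differentiableWithinAt
    · rw [interior_Ici]
      intro x hx
      rw [(hder x hx).deriv]
      nlinarith [mul_self_nonneg (y' x), mul_nonneg (hq x hx) (mul_self_nonneg (y x))]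
  have hs : MonotoneOn (fun x => y x ^ 2) (Set.Ici a) := by
    have hder : ∀ x, a < x → HasDerivAt (fun x => y x ^ 2) (2 * (y x * y' x)) x := fun x hx =>
      ((hd x hx).pow 2).congr_deriv (by push_cast; ring)
    refine monotoneOn_of_deriv_nonneg (convex_Ici a) (hy.pow 2) ?_ ?_
    · rw [interior_Ici]
      exact fun x hx => (hder x hx).differentiableAt.differentiableWithinAt
    · rw [interior_Ici]
      intro x hx
      rw [(hder x hx).deriv]
      have h1 : y a * y' a ≤ y x * y' x :=
        hg Set.self_mem_Ici (Set.mem_Ici.2 (le_of_lt hx)) (le_of_lt hx)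
      linarith
  intro x hx
  by_contra hne
  have hpos : 0 < y x ^ 2 := by positivity
  have h1 : IntegrableOn (fun _ => y x ^ 2) (Set.Ioi x) := by
    refine (hi.mono_set (Set.Ioi_subset_Ioi hx)).mono' aestronglyMeasurable_const ?_
    refine (ae_restrict_iff' measurableSet_Ioi).2 (ae_of_all _ fun t ht => ?_)
    rw [Real.norm_eq_abs, abs_of_pos hpos]
    exact hs (Set.mem_Ici.2 hx) (Set.mem_Ici.2 (hx.trans (le_of_lt ht))) (le_of_lt ht)
  rw [integrableOn_const_iff] at h1
  simp [hne] at h1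

/-- Square-integrable solutions of `y'' = q y` on a half-line are multiples of one another, if `q`
is eventually nonnegative. -/
lemma exists_eq_mul_of_sq_integrable {q y y' φ φ' : ℝ → ℝ} {a b : ℝ} (hab : a ≤ b)
    (hqc : Continuous q) (hq : ∀ x, b < x → 0 ≤ q x)
    (hy : ContinuousOn y (Set.Ici a)) (hy' : ContinuousOn y' (Set.Ici a))
    (hd : ∀ x, a < x → HasDerivAt y (y' x) x)
    (hd' : ∀ x, a < x → HasDerivAt y' (q x * y x) x)
    (hi : IntegrableOn (fun x => y x ^ 2) (Set.Ioi a))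
    (hφ : ∀ x, HasDerivAt φ (φ' x) x) (hφ' : ∀ x, HasDerivAt φ' (q x * φ x) x)
    (hφi : IntegrableOn (fun x => φ x ^ 2) (Set.Ioi a)) (h0 : φ b ≠ 0) :
    ∃ c : ℝ, ∀ x, a ≤ x → y x = c * φ x ∧ y' x = c * φ' x := by
  set c := y b / φ b with hc
  have hφc : Continuous φ := continuous_iff_continuousAt.2 fun x => (hφ x).continuousAt
  have hφc' : Continuous φ' := continuous_iff_continuousAt.2 fun x => (hφ' x).continuousAt
  have hu : ContinuousOn (fun x => y x - c * φ x) (Set.Ici a) :=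
    hy.sub (hφc.const_mul c |>.continuousOn)
  have hu' : ContinuousOn (fun x => y' x - c * φ' x) (Set.Ici a) :=
    hy'.sub (hφc'.const_mul c |>.continuousOn)
  have hud : ∀ x, a < x → HasDerivAt (fun x => y x - c * φ x) (y' x - c * φ' x) x :=
    fun x hx => (hd x hx).sub ((hφ x).const_mul c)
  have hud' : ∀ x, a < x →
      HasDerivAt (fun x => y' x - c * φ' x) (q x * (y x - c * φ x)) x :=
    fun x hx => ((hd' x hx).sub ((hφ' x).const_mul c)).congr_deriv (by ring)
  have hui : IntegrableOn (fun x => (y x - c * φ x) ^ 2) (Set.Ioi a) := by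
    refine ((hi.const_mul 2).add (hφi.const_mul (2 * c ^ 2))).mono'
      (((hu.pow 2).mono Set.Ioi_subset_Ici_self).aestronglyMeasurable measurableSet_Ioi)
      (ae_of_all _ fun x => ?_)
    rw [Real.norm_eq_abs, abs_of_nonneg (sq_nonneg _)]
    simp only [Pi.add_apply]
    nlinarith [sq_nonneg (y x + c * φ x)]
  have hb : y b - c * φ b = 0 := by rw [hc, div_mul_cancel₀ _ h0, sub_self]
  have hz := eq_zero_of_sq_integrable hq (hu.mono (Set.Ici_subset_Ici.2 hab))
    (hu'.mono (Set.Ici_subset_Ici.2 hab)) (fun x hx => hud x (hab.trans_lt hx))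
    (fun x hx => hud' x (hab.trans_lt hx)) (hui.mono_set (Set.Ioi_subset_Ioi hab))
    (by rw [hb, zero_mul])
  have hz' : ∀ x, b < x → y' x - c * φ' x = 0 := fun x hx => by
    have h1 : (fun x => y x - c * φ x) =ᶠ[𝓝 x] fun _ => 0 := by
      filter_upwards [Ioi_mem_nhds hx] with t ht using hz t (le_of_lt ht)
    exact (hud x (hab.trans_lt hx)).unique ((hasDerivAt_const x 0).congr_of_eventuallyEq h1)
  have hz2 : ∀ x, a ≤ x → y x - c * φ x = 0 ∧ y' x - c * φ' x = 0 := by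
    intro x hx
    have hB : b < max b x + 1 := lt_of_le_of_lt (le_max_left b x) (lt_add_one _)
    refine linear_ode_zero_of_right (q := q) (a := a) (b := max b x + 1) hqc.continuousOn
      (hu.mono Set.Icc_subset_Ici_self) (hu'.mono Set.Icc_subset_Ici_self)
      (fun t ht => hud t ht.1) (fun t ht => hud' t ht.1) (hz _ hB.le) (hz' _ hB) x
      ⟨hx, (le_max_right b x).trans (lt_add_one _).le⟩
  exact ⟨c, fun x hx => ⟨sub_eq_zero.1 (hz2 x hx).1, sub_eq_zero.1 (hz2 x hx).2⟩⟩

/-! ### Zeros of the reverse Airy function -/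

lemma airyA_ne_zero_or (x : ℝ) : airyA x ≠ 0 ∨ airyA' x ≠ 0 := by
  by_contra! h
  obtain ⟨y, hy⟩ := exists_airyA_ne_zero
  have hc : ∀ s : Set ℝ, ContinuousOn (fun x : ℝ => -x) s := fun s => continuousOn_neg
  rcases le_total x y with hxy | hxy
  · exact hy (linear_ode_zero_of_left (hc _) continuous_airyA.continuousOn
      continuous_airyA'.continuousOn (fun t _ => hasDerivAt_airyA t)
      (fun t _ => hasDerivAt_airyA' t) h.1 h.2 y ⟨hxy, le_rfl⟩).1
  · exact hy (linear_ode_zero_of_right (hc _) continuous_airyA.continuousOn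
      continuous_airyA'.continuousOn (fun t _ => hasDerivAt_airyA t)
      (fun t _ => hasDerivAt_airyA' t) h.1 h.2 y ⟨le_rfl, hxy⟩).1

lemma hasDerivAt_airyA_affine (m b x : ℝ) :
    HasDerivAt (fun x => airyA (m * x + b)) (m * airyA' (m * x + b)) x := by
  have h : HasDerivAt (fun x : ℝ => m * x + b) m x :=
    (((hasDerivAt_id x).const_mul m).add_const b).congr_deriv (mul_one m)
  exact ((hasDerivAt_airyA _).comp x h).congr_deriv (mul_comm _ _)

lemma hasDerivAt_airyA'_affine (m b x : ℝ) :
    HasDerivAt (fun x => m * airyA' (m * x + b))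
      (-m ^ 2 * (m * x + b) * airyA (m * x + b)) x := by
  have h : HasDerivAt (fun x : ℝ => m * x + b) m x :=
    (((hasDerivAt_id x).const_mul m).add_const b).congr_deriv (mul_one m)
  exact (((hasDerivAt_airyA' _).comp x h).const_mul m).congr_deriv (by ring)

lemma sq_integrable_airyA_affine {m : ℝ} (hm : m < 0) (b a : ℝ) :
    IntegrableOn (fun x => airyA (m * x + b) ^ 2) (Set.Ioi a) := by
  obtain ⟨C, hC0, hC⟩ := airyA_bound
  have h1 : IntegrableOn (fun x : ℝ => (C * Real.exp b) ^ 2 * Real.exp ((2 * m) * x)) (Set.Ioi a) :=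
    (integrableOn_exp_mul_Ioi (by linarith) a).const_mul _
  refine h1.mono' ?_ (ae_of_all _ fun x => ?_)
  · exact ((continuous_airyA.comp (by fun_prop : Continuous fun x : ℝ => m * x + b)).pow
      2).aestronglyMeasurable
  · rw [Real.norm_eq_abs, abs_pow]
    refine (pow_le_pow_left₀ (abs_nonneg _) (hC (m * x + b)) 2).trans_eq ?_
    rw [Real.exp_add, show 2 * m * x = m * x + m * x by ring, Real.exp_add]
    ring

lemma airyA_mul_airyA'_pos {x : ℝ} (hx : x ≤ 0) : 0 < airyA x * airyA' x := by
  by_contra! h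
  have hz := eq_zero_of_sq_integrable (q := fun x => x) (y := fun x => airyA (-1 * x + 0))
    (y' := fun x => -1 * airyA' (-1 * x + 0)) (a := -x) (fun t ht => by linarith)
    (continuous_airyA.comp (by fun_prop)).continuousOn
    ((continuous_airyA'.comp (by fun_prop)).const_mul _).continuousOn
    (fun t _ => hasDerivAt_airyA_affine _ _ t)
    (fun t _ => (hasDerivAt_airyA'_affine (-1) 0 t).congr_deriv (by ring))
    (sq_integrable_airyA_affine (by norm_num) _ _)
    (by ring_nf; ring_nf at h; linarith)
  have hz' : ∀ t, t ≤ x → airyA t = 0 := fun t ht => by simpa using hz (-t) (by linarith)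
  have h1 : airyA' (x - 1) = 0 := by
    refine (hasDerivAt_airyA (x - 1)).unique ((hasDerivAt_const _ 0).congr_of_eventuallyEq ?_)
    filter_upwards [Iio_mem_nhds (show x - 1 < x by linarith)] with t ht using hz' t (le_of_lt ht)
  rcases airyA_ne_zero_or (x - 1) with h2 | h2
  · exact h2 (hz' _ (by linarith))
  · exact h2 h1

lemma pos_of_airyA_eq_zero {x : ℝ} (hx : airyA x = 0) : 0 < x := by
  by_contra! h
  have := airyA_mul_airyA'_pos h
  rw [hx, zero_mul] at this
  exact lt_irrefl _ this

/-- Riccati equation for the logarithmic derivative of the reverse Airy function. -/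
lemma hasDerivAt_airy_logDeriv {x : ℝ} (hx : airyA x ≠ 0) :
    HasDerivAt (fun x => airyA' x / airyA x) (-x - (airyA' x / airyA x) ^ 2) x := by
  refine ((hasDerivAt_airyA' x).div (hasDerivAt_airyA x) hx).congr_deriv ?_
  field_simp

/-- The zeros are unbounded: between two zeros the arctangent of the logarithmic derivative
decreases at speed at least one, by the Riccati equation, while it takes values in an interval of
length `π`. -/
lemma exists_airyA_zero_gt (x : ℝ) : ∃ y, x < y ∧ airyA y = 0 := by
  by_contra! h
  set M := max x 1 with hM
  have hder : ∀ t, M < t → HasDerivAt (fun t => Real.arctan (airyA' t / airyA t) + t)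
      (1 / (1 + (airyA' t / airyA t) ^ 2) * (-t - (airyA' t / airyA t) ^ 2) + 1) t := fun t ht =>
    ((hasDerivAt_airy_logDeriv (h t ((le_max_left _ _).trans_lt ht))).arctan).add (hasDerivAt_id t)
  have hanti : AntitoneOn (fun t => Real.arctan (airyA' t / airyA t) + t) (Set.Ioi M) := by
    refine antitoneOn_of_deriv_nonpos (convex_Ioi M)
      (fun t ht => (hder t ht).continuousAt.continuousWithinAt) ?_ ?_
    · rw [interior_Ioi]
      exact fun t ht => (hder t ht).differentiableAt.differentiableWithinAt
    · rw [interior_Ioi]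
      intro t ht
      rw [(hder t ht).deriv]
      have h1 : (1 : ℝ) < t := (le_max_right x 1).trans_lt ht
      have h2 : 0 < 1 + (airyA' t / airyA t) ^ 2 := by positivity
      have h3 : 1 / (1 + (airyA' t / airyA t) ^ 2) * (-t - (airyA' t / airyA t) ^ 2) + 1
          = (1 - t) / (1 + (airyA' t / airyA t) ^ 2) := by
        field_simp
        ring
      rw [h3]
      exact div_nonpos_of_nonpos_of_nonneg (by linarith) h2.le
  -- the length `4` of `[M + 1, M + 5]` is at least `π`
  have h1 := hanti (show M + 1 ∈ Set.Ioi M by simp) (show M + 5 ∈ Set.Ioi M by simp)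
    (by linarith)
  simp only at h1
  have h2 := Real.arctan_lt_pi_div_two (airyA' (M + 1) / airyA (M + 1))
  have h3 := Real.neg_pi_div_two_lt_arctan (airyA' (M + 5) / airyA (M + 5))
  have h4 := Real.pi_le_four
  linarith

/-- The first zero of the reverse Airy function to the right of `x`. -/
def nextAiryZero (x : ℝ) : ℝ := sInf {y | x < y ∧ airyA y = 0}

lemma nextAiryZero_mem (x : ℝ) : x < nextAiryZero x ∧ airyA (nextAiryZero x) = 0 := by
  set S := {y | x < y ∧ airyA y = 0} with hS
  have hne : S.Nonempty := exists_airyA_zero_gt x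
  have hbd : BddBelow S := ⟨x, fun y hy => hy.1.le⟩
  have hcl : nextAiryZero x ∈ closure S := csInf_mem_closure hne hbd
  have hA : airyA (nextAiryZero x) = 0 := by
    have : closure S ⊆ {y | airyA y = 0} :=
      closure_minimal (fun y hy => hy.2) (isClosed_eq continuous_airyA continuous_const)
    exact this hcl
  refine ⟨lt_of_le_of_ne (le_csInf hne fun y hy => hy.1.le) fun heq => ?_, hA⟩
  rw [← heq] at hA hcl
  have h1 : ∀ᶠ y in 𝓝[≠] x, airyA y ≠ 0 :=
    (hasDerivAt_airyA x).eventually_ne ((airyA_ne_zero_or x).resolve_left (not_not.2 hA))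
  rw [eventually_nhdsWithin_iff] at h1
  obtain ⟨y, h2, h3⟩ := ((mem_closure_iff_frequently.1 hcl).and_eventually h1).exists
  exact h3 h2.1.ne' h2.2

lemma airyA_ne_zero_of_lt_nextAiryZero {x y : ℝ} (hx : x < y) (hy : y < nextAiryZero x) :
    airyA y ≠ 0 := fun h =>
  absurd (csInf_le ⟨x, fun _ hz => hz.1.le⟩ (show y ∈ {y | x < y ∧ airyA y = 0} from ⟨hx, h⟩))
    (not_le.2 hy)

/-- The zeros of the reverse Airy function, in increasing order from the index `1` on. The value at
the index `0` is the convenient lower bound `0`. -/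
def airyZero : ℕ → ℝ
  | 0 => 0
  | n + 1 => nextAiryZero (airyZero n)

lemma airyZero_lt_succ (n : ℕ) : airyZero n < airyZero (n + 1) := (nextAiryZero_mem _).1

lemma airyZero_strictMono : StrictMono airyZero := strictMono_nat_of_lt_succ airyZero_lt_succ

lemma airyA_airyZero {n : ℕ} (hn : 1 ≤ n) : airyA (airyZero n) = 0 := by
  obtain ⟨m, rfl⟩ := Nat.exists_eq_add_of_le' hn
  exact (nextAiryZero_mem _).2

lemma airyA'_airyZero {n : ℕ} (hn : 1 ≤ n) : airyA' (airyZero n) ≠ 0 :=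
  (airyA_ne_zero_or _).resolve_left (not_not.2 (airyA_airyZero hn))

lemma airyZero_pos {n : ℕ} (hn : 1 ≤ n) : 0 < airyZero n := pos_of_airyA_eq_zero (airyA_airyZero hn)

/-- A point of `(0, z n]` lies in `(z k, z (k+1)]` for some `k < n`. -/
lemma exists_airyZero_interval {n : ℕ} {x : ℝ} (h0 : 0 < x) (hx : x ≤ airyZero n) :
    ∃ k, k < n ∧ airyZero k < x ∧ x ≤ airyZero (k + 1) := by
  induction n with
  | zero => exact absurd hx (not_le.2 h0)
  | succ n ih =>
    rcases le_or_gt x (airyZero n) with h | h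
    · obtain ⟨k, hk, h1⟩ := ih h
      exact ⟨k, hk.trans (Nat.lt_succ_self n), h1⟩
    · exact ⟨n, Nat.lt_succ_self n, h, hx⟩

lemma eq_airyZero_of_mem_interval {k : ℕ} {x : ℝ} (h1 : airyZero k < x)
    (h2 : x ≤ airyZero (k + 1)) (hx : airyA x = 0) : x = airyZero (k + 1) := by
  by_contra hne
  exact airyA_ne_zero_of_lt_nextAiryZero h1 (lt_of_le_of_ne h2 hne) hx

lemma isNthSmallest_of_enumeration {S : Set ℝ} {e : ℕ → ℝ} {n : ℕ} (hn : 1 ≤ n)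
    (he : StrictMonoOn e (Set.Icc 1 n)) (hS : S ∩ Set.Iic (e n) = e '' Set.Icc 1 n) :
    IsNthSmallest S n (e n) := by
  refine ⟨?_, ?_⟩
  · have : e n ∈ S ∩ Set.Iic (e n) := by
      rw [hS]
      exact ⟨n, ⟨hn, le_rfl⟩, rfl⟩
    exact this.1
  · rw [hS, he.injOn.encard_image]
    rw [← Finset.coe_Icc, Set.encard_coe_eq_coe_finsetCard, Nat.card_Icc]
    simp

lemma isNthSmallest_airyZero {n : ℕ} (hn : 1 ≤ n) : IsNthSmallest airyZeros n (airyZero n) := by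
  refine isNthSmallest_of_enumeration hn (airyZero_strictMono.strictMonoOn _) ?_
  ext x
  constructor
  · rintro ⟨hx, hxn⟩
    obtain ⟨k, hk, h1, h2⟩ := exists_airyZero_interval (pos_of_airyA_eq_zero hx) hxn
    exact ⟨k + 1, ⟨by omega, by omega⟩, (eq_airyZero_of_mem_interval h1 h2 hx).symm⟩
  · rintro ⟨k, hk, rfl⟩
    exact ⟨airyA_airyZero hk.1, airyZero_strictMono.monotone hk.2⟩

/-! ### The matching condition -/

/-- The condition that the Airy function on the left and the decaying exponential on the right
match to first order at `0`, for the eigenvalue `h² l` and `κ = h³`. -/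
def Matching (h l : ℝ) : Prop :=
  h ^ 2 * l < 1 ∧ h * airyA' l + Real.sqrt (1 - h ^ 2 * l) * airyA l = 0

lemma Matching.airyA_ne_zero {h l : ℝ} (hh : 0 < h) (hm : Matching h l) : airyA l ≠ 0 := fun h0 => by
  have h1 := hm.2
  rw [h0, mul_zero, add_zero] at h1
  exact (airyA_ne_zero_or l).elim (· h0) (· ((mul_eq_zero.1 h1).resolve_left hh.ne'))

lemma Matching.pos {h l : ℝ} (hh : 0 < h) (hm : Matching h l) : 0 < l := by
  by_contra! hl
  have h1 := airyA_mul_airyA'_pos hl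
  have h2 : h * (airyA l * airyA' l) + Real.sqrt (1 - h ^ 2 * l) * airyA l ^ 2 = 0 := by
    linear_combination airyA l * hm.2
  nlinarith [mul_pos hh h1, mul_nonneg (Real.sqrt_nonneg (1 - h ^ 2 * l)) (sq_nonneg (airyA l))]

/-- There is at most one matching between two consecutive zeros of the reverse Airy function `A`:
with `w = A' / A`, a matching means `w < 0` and `w² + l = h⁻²`, and `w² + l` is increasing in `l`
after the first matching. -/
lemma Matching.not_lt {h l₁ l₂ : ℝ} (hh : 0 < h) (h₁ : Matching h l₁) (h₂ : Matching h l₂)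
    (hne : ∀ x ∈ Set.Icc l₁ l₂, airyA x ≠ 0) : ¬ l₁ < l₂ := by
  intro hlt
  set w : ℝ → ℝ := fun x => airyA' x / airyA x with hw
  have hwval : ∀ l, Matching h l → h * w l = -Real.sqrt (1 - h ^ 2 * l) := fun l hm => by
    have := hm.airyA_ne_zero hh
    rw [hw]
    field_simp
    linear_combination hm.2
  have hp : ∀ l, Matching h l → h ^ 2 * (w l ^ 2 + l) = 1 := fun l hm => by
    have h1 := Real.sq_sqrt (show 0 ≤ 1 - h ^ 2 * l by linarith [hm.1])
    have h2 := hwval l hm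
    have h3 : (h * w l) ^ 2 = 1 - h ^ 2 * l := by rw [h2, neg_sq, h1]
    linear_combination h3
  have hl0 := h₁.pos hh
  have hder : ∀ x ∈ Set.Icc l₁ l₂, HasDerivAt w (-x - w x ^ 2) x := fun x hx =>
    hasDerivAt_airy_logDeriv (hne x hx)
  have hwc : ContinuousOn w (Set.Icc l₁ l₂) := fun x hx =>
    (hder x hx).continuousAt.continuousWithinAt
  have hanti : AntitoneOn w (Set.Icc l₁ l₂) := by
    refine antitoneOn_of_deriv_nonpos (convex_Icc _ _) hwc ?_ ?_
    · exact fun x hx => (hder x (interior_subset hx)).differentiableAt.differentiableWithinAt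
    · intro x hx
      rw [(hder x (interior_subset hx)).deriv]
      have := (interior_subset hx : x ∈ Set.Icc l₁ l₂).1
      nlinarith [sq_nonneg (w x)]
  have hw1 : w l₁ ≤ 0 := by
    have h1 := hwval l₁ h₁
    have h2 := Real.sqrt_nonneg (1 - h ^ 2 * l₁)
    by_contra! hc
    nlinarith [mul_pos hh hc]
  have hmono : StrictMonoOn (fun x => w x ^ 2 + x) (Set.Icc l₁ l₂) := by
    have hder2 : ∀ x ∈ Set.Icc l₁ l₂, HasDerivAt (fun x => w x ^ 2 + x)
        (2 * w x * (-x - w x ^ 2) + 1) x := fun x hx =>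
      (((hder x hx).pow 2).add (hasDerivAt_id x)).congr_deriv (by push_cast; ring)
    refine strictMonoOn_of_deriv_pos (convex_Icc _ _) ((hwc.pow 2).add continuousOn_id) ?_
    intro x hx
    have hx' : x ∈ Set.Icc l₁ l₂ := interior_subset hx
    rw [(hder2 x hx').deriv]
    have h1 : w x ≤ 0 := (hanti ⟨le_rfl, hlt.le⟩ hx' hx'.1).trans hw1
    have h2 : 0 ≤ x + w x ^ 2 := by nlinarith [hx'.1, sq_nonneg (w x)]
    nlinarith [mul_nonneg (neg_nonneg.2 h1) h2]
  have h3 := hmono ⟨le_rfl, hlt.le⟩ ⟨hlt.le, le_rfl⟩ hlt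
  simp only at h3
  have h4 : h ^ 2 * (w l₁ ^ 2 + l₁) < h ^ 2 * (w l₂ ^ 2 + l₂) :=
    mul_lt_mul_of_pos_left h3 (by positivity)
  rw [hp _ h₁, hp _ h₂] at h4
  exact lt_irrefl _ h4

lemma Matching.unique {h l₁ l₂ : ℝ} {k : ℕ} (hh : 0 < h) (h₁ : Matching h l₁) (h₂ : Matching h l₂)
    (hl₁ : l₁ ∈ Set.Ioo (airyZero k) (airyZero (k + 1)))
    (hl₂ : l₂ ∈ Set.Ioo (airyZero k) (airyZero (k + 1))) : l₁ = l₂ := by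
  have hne : ∀ x, airyZero k < x → x < airyZero (k + 1) → airyA x ≠ 0 := fun x h1 h2 =>
    airyA_ne_zero_of_lt_nextAiryZero h1 h2
  refine le_antisymm (le_of_not_gt ?_) (le_of_not_gt ?_)
  · exact h₂.not_lt hh h₁ fun x hx => hne x (hl₂.1.trans_le hx.1) (hx.2.trans_lt hl₁.2)
  · exact h₁.not_lt hh h₂ fun x hx => hne x (hl₁.1.trans_le hx.1) (hx.2.trans_lt hl₂.2)

/-! ### Real power series -/

lemma powerSeries_coeff_unique {a b : ℕ → ℝ} {f : ℝ → ℝ}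
    (ha : ∀ᶠ h : ℝ in 𝓝 0, HasSum (fun j => a j * h ^ j) (f h))
    (hb : ∀ᶠ h : ℝ in 𝓝 0, HasSum (fun j => b j * h ^ j) (f h)) : a = b := by
  have key : ∀ c : ℕ → ℝ, (∀ᶠ h : ℝ in 𝓝 0, HasSum (fun j => c j * h ^ j) (f h)) →
      HasFPowerSeriesAt f (FormalMultilinearSeries.ofScalars ℝ c) 0 := fun c hc => by
    rw [hasFPowerSeriesAt_iff]
    filter_upwards [hc] with h hh
    simpa [FormalMultilinearSeries.coeff_ofScalars, mul_comm] using hh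
  have h := (key a ha).eq_formalMultilinearSeries (key b hb)
  funext j
  have h1 := congrArg (fun p => FormalMultilinearSeries.coeff p j) h
  simpa [FormalMultilinearSeries.coeff_ofScalars] using h1

lemma hasSum_powerSeries_mul {a b : ℕ → ℝ} {h A B : ℝ} (ha : HasSum (fun j => a j * h ^ j) A)
    (hb : HasSum (fun j => b j * h ^ j) B) :
    HasSum (fun j => (∑ p ∈ Finset.HasAntidiagonal.antidiagonal j, a p.1 * b p.2) * h ^ j) (A * B) := by
  have h1 := tsum_mul_tsum_eq_tsum_sum_antidiagonal_of_summable_norm ha.summable.norm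
    hb.summable.norm
  have h2 := (summable_norm_sum_mul_antidiagonal_of_summable_norm ha.summable.norm
    hb.summable.norm).of_norm
  rw [ha.tsum_eq, hb.tsum_eq] at h1
  rw [h1]
  refine h2.hasSum.congr_fun ?_
  intro j
  rw [Finset.sum_mul]
  refine Finset.sum_congr rfl fun p hp => ?_
  rw [← Finset.HasAntidiagonal.mem_antidiagonal.1 hp, pow_add]
  ring

/-- The coefficients of `h ^ m` times a power series. -/
def shiftCoeff (m : ℕ) (a : ℕ → ℝ) (j : ℕ) : ℝ := if m ≤ j then a (j - m) else 0

lemma hasSum_powerSeries_shift (m : ℕ) {a : ℕ → ℝ} {h A : ℝ}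
    (ha : HasSum (fun j => a j * h ^ j) A) :
    HasSum (fun j => shiftCoeff m a j * h ^ j) (h ^ m * A) := by
  have h0 : ∑ j ∈ Finset.range m, shiftCoeff m a j * h ^ j = 0 :=
    Finset.sum_eq_zero fun j hj => by
      rw [shiftCoeff, if_neg (not_le.2 (Finset.mem_range.1 hj)), zero_mul]
  have h1 := (hasSum_nat_add_iff (f := fun j => shiftCoeff m a j * h ^ j) m
    (g := h ^ m * A)).1 ?_
  · rwa [h0, add_zero] at h1
  · refine (ha.mul_left (h ^ m)).congr_fun fun j => ?_
    simp only [shiftCoeff, Nat.le_add_left, if_true, Nat.add_sub_cancel]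
    ring

/-- A real power series with positive radius of convergence extends to the complex domain. -/
lemma eventually_complexify {a : ℕ → ℝ} (ha : ∀ᶠ h : ℝ in 𝓝 0, Summable fun j => a j * h ^ j) :
    ∀ᶠ w : ℂ in 𝓝 0, DifferentiableAt ℂ (fun w : ℂ => ∑' j, (a j : ℂ) * w ^ j) w := by
  have h1 : ∀ᶠ w : ℂ in 𝓝 0, Summable fun j => (a j : ℂ) * w ^ j := by
    have ht : Tendsto (fun w : ℂ => ‖w‖) (𝓝 0) (𝓝 0) := by
      simpa using (continuous_norm (E := ℂ)).tendsto 0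
    filter_upwards [ht.eventually ha] with w hw
    refine Summable.of_norm ?_
    refine hw.norm.congr fun j => ?_
    simp
  have h2 : HasFPowerSeriesAt (fun w : ℂ => ∑' j, (a j : ℂ) * w ^ j)
      (FormalMultilinearSeries.ofScalars ℂ fun j => (a j : ℂ)) 0 := by
    rw [hasFPowerSeriesAt_iff]
    filter_upwards [h1] with w hw
    simpa [FormalMultilinearSeries.coeff_ofScalars, mul_comm] using hw.hasSum
  exact h2.analyticAt.eventually_analyticAt.mono fun w hw => hw.differentiableAt

/-! ### The analytic branch of solutions of the matching condition -/

/-- The analytic data of the `n`-th eigenvalue: the expansion `α`, the holomorphic function `ℓ` it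
defines on a disc of radius `r`, and the holomorphic extension `b` of `√(1 - h² ℓ h)`. On `(0, r]`
the value of `ℓ` is the solution of the matching condition between the zeros number `n - 1` and
`n`. -/
structure IsBranch (n : ℕ) (α : ℕ → ℝ) (r : ℝ) (ℓ b : ℂ → ℂ) : Prop where
  r_pos : 0 < r
  coeff_zero : α 0 = airyZero n
  value_zero : ℓ 0 = airyZero n
  diff_ell : ∀ w ∈ Metric.closedBall (0 : ℂ) r, DifferentiableAt ℂ ℓ w
  diff_b : ∀ w ∈ Metric.closedBall (0 : ℂ) r, DifferentiableAt ℂ b w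
  b_re : ∀ w ∈ Metric.closedBall (0 : ℂ) r, 1 / 2 ≤ (b w).re
  ell_real : ∀ h : ℝ, |h| ≤ r → ℓ h = ((ℓ h).re : ℂ)
  hasSum : ∀ h : ℝ, |h| ≤ r → HasSum (fun j => α j * h ^ j) (ℓ h).re
  b_real : ∀ h : ℝ, |h| ≤ r → b h = (Real.sqrt (1 - h ^ 2 * (ℓ h).re) : ℂ)
  matching : ∀ h : ℝ, |h| ≤ r → h ^ 2 * (ℓ h).re < 1 ∧
    h * airyA' (ℓ h).re + Real.sqrt (1 - h ^ 2 * (ℓ h).re) * airyA (ℓ h).re = 0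
  mem_interval : ∀ h : ℝ, 0 < h → h ≤ r → (ℓ h).re ∈ Set.Ioo (airyZero (n - 1)) (airyZero n)

/-- With `q = A / A'`, the matching condition is equivalent to `h = - q / √(1 + l q²)` for `l`
near a zero of `A`, which can be inverted analytically. -/
lemma exists_analytic_inverse {n : ℕ} (hn : 1 ≤ n) : ∃ L : ℝ → ℝ, AnalyticAt ℝ L 0 ∧
    L 0 = airyZero n ∧ (∀ᶠ h : ℝ in 𝓝 0, h ^ 2 * L h < 1 ∧
      h * airyA' (L h) + Real.sqrt (1 - h ^ 2 * L h) * airyA (L h) = 0) ∧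
    ∀ᶠ h : ℝ in 𝓝 0, 0 < h → L h ∈ Set.Ioo (airyZero (n - 1)) (airyZero n) := by
  set z := airyZero n with hz
  have hA' : airyA' z ≠ 0 := airyA'_airyZero hn
  have hA : airyA z = 0 := airyA_airyZero hn
  have hzpos : 0 < z := airyZero_pos hn
  set q : ℝ → ℝ := fun l => airyA l / airyA' l with hq
  have hqz : q z = 0 := by simp [hq, hA]
  have hqan : AnalyticAt ℝ q z := (analyticAt_airyA z).div (analyticAt_airyA' z) hA'
  have hqd : HasDerivAt q 1 z := by
    refine ((hasDerivAt_airyA z).div (hasDerivAt_airyA' z) hA').congr_deriv ?_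
    rw [hA]
    field_simp
    ring
  set E : ℝ → ℝ := fun l => Real.exp (-(1 / 2) * Real.log (1 + l * q l ^ 2)) with hE
  have hEan : AnalyticAt ℝ E z := by
    have h1 : AnalyticAt ℝ (fun l => 1 + l * q l ^ 2) z :=
      analyticAt_const.add (analyticAt_id.mul (hqan.pow 2))
    exact (analyticAt_const.mul (h1.log (by rw [hqz]; norm_num))).rexp
  have hEz : E z = 1 := by simp [hE, hqz]
  set G : ℝ → ℝ := fun l => -(q l * E l) with hG
  have hGan : AnalyticAt ℝ G z := (hqan.mul hEan).neg
  have hGz : G z = 0 := by simp [hG, hqz]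
  have hGd : HasDerivAt G (-1) z := by
    refine (hqd.mul hEan.differentiableAt.hasDerivAt).neg.congr_deriv ?_
    rw [hqz, hEz]
    ring
  have hGd' : deriv G z ≠ 0 := by rw [hGd.deriv]; norm_num
  set L := hGan.hasStrictDerivAt.localInverse _ _ _ hGd' with hL
  have hLan : AnalyticAt ℝ L 0 := by
    have := hGan.analyticAt_localInverse hGd'
    rwa [hGz] at this
  have hL0 : L 0 = z := by
    have : L (G z) = z := HasStrictFDerivAt.localInverse_apply_image ..
    rwa [hGz] at this
  have hGL : ∀ᶠ h : ℝ in 𝓝 0, G (L h) = h := by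
    have := HasStrictDerivAt.eventually_right_inverse hGan.hasStrictDerivAt hGd'
    rwa [hGz] at this
  have hLc : Tendsto L (𝓝 0) (𝓝 z) := by
    have := hLan.continuousAt.tendsto
    rwa [hL0] at this
  have hLd : HasDerivAt L (-1) 0 := by
    have := (HasStrictDerivAt.to_localInverse hGan.hasStrictDerivAt hGd').hasDerivAt
    rw [hGz] at this
    exact this.congr_deriv (by rw [hGd.deriv]; norm_num)
  refine ⟨L, hLan, hL0, ?_, ?_⟩
  · filter_upwards [hGL, hLc.eventually (lt_mem_nhds hzpos),
      hLc.eventually (continuous_airyA'.continuousAt.eventually_ne hA')] with h hh hpos hne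
    set l := L h with hl
    have hD : 0 < 1 + l * q l ^ 2 := by positivity
    have hEpos : 0 < E l := Real.exp_pos _
    have hE2 : E l ^ 2 * (1 + l * q l ^ 2) = 1 := by
      rw [hE]
      simp only
      rw [← Real.exp_nat_mul]
      nth_rewrite 2 [← Real.exp_log hD]
      rw [← Real.exp_add]
      simp
    have hh' : h = -(q l * E l) := hh.symm
    have h1 : 1 - h ^ 2 * l = E l ^ 2 := by rw [hh']; linear_combination -hE2
    have h2 : 0 < E l ^ 2 := by positivity
    refine ⟨by linarith, ?_⟩
    rw [h1, Real.sqrt_sq hEpos.le, hh']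
    have h3 : q l * airyA' l = airyA l := div_mul_cancel₀ _ hne
    linear_combination -(E l) * h3
  · have h1 : airyZero (n - 1) < z := airyZero_strictMono (by omega)
    have h2 : ∀ᶠ h : ℝ in 𝓝[≠] 0, slope L 0 h < 0 :=
      (hasDerivAt_iff_tendsto_slope.1 hLd).eventually (gt_mem_nhds (by norm_num))
    rw [eventually_nhdsWithin_iff] at h2
    filter_upwards [hLc.eventually (lt_mem_nhds h1), h2] with h h3 h4 hpos
    refine ⟨h3, ?_⟩
    have h5 := h4 hpos.ne'
    rw [slope_def_field, sub_zero, hL0] at h5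
    by_contra! hc
    exact absurd h5 (not_lt.2 (div_nonneg (by linarith) hpos.le))

lemma exists_isBranch {n : ℕ} (hn : 1 ≤ n) : ∃ (α : ℕ → ℝ) (r : ℝ) (ℓ b : ℂ → ℂ),
    IsBranch n α r ℓ b := by
  obtain ⟨L, hLan, hL0, hm, hint⟩ := exists_analytic_inverse hn
  obtain ⟨p, hp⟩ := hLan
  set α : ℕ → ℝ := fun j => p.coeff j with hα
  have hsum : ∀ᶠ h : ℝ in 𝓝 0, HasSum (fun j => α j * h ^ j) (L h) := by
    filter_upwards [hasFPowerSeriesAt_iff.1 hp] with h hh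
    simpa [mul_comm] using hh
  set ℓ : ℂ → ℂ := fun w => ∑' j, (α j : ℂ) * w ^ j with hℓ
  have hℓL : ∀ᶠ h : ℝ in 𝓝 0, ℓ h = L h := by
    filter_upwards [hsum] with h hh
    have := (Complex.hasSum_ofReal.2 hh).tsum_eq
    rw [← this, hℓ]
    simp
  have hℓ0 : ℓ 0 = airyZero n := by
    have := hℓL.self_of_nhds
    rwa [hL0, Complex.ofReal_zero] at this
  have hα0 : α 0 = airyZero n := by
    rw [← hL0]
    exact hp.coeff_zero _
  set b : ℂ → ℂ := fun w => (1 - w ^ 2 * ℓ w) ^ ((2 : ℕ) : ℂ)⁻¹ with hb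
  have hdℓ : ∀ᶠ w : ℂ in 𝓝 0, DifferentiableAt ℂ ℓ w :=
    eventually_complexify (hsum.mono fun h hh => hh.summable)
  have hrad0 : ContinuousAt (fun w : ℂ => 1 - w ^ 2 * ℓ w) 0 :=
    continuousAt_const.sub ((continuousAt_id.pow 2).mul hdℓ.self_of_nhds.continuousAt)
  have hslit : ∀ᶠ w : ℂ in 𝓝 0, 1 - w ^ 2 * ℓ w ∈ Complex.slitPlane := by
    refine hrad0.eventually_mem (Complex.isOpen_slitPlane.mem_nhds ?_)
    simp
  have hdb : ∀ᶠ w : ℂ in 𝓝 0, DifferentiableAt ℂ b w := by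
    filter_upwards [hdℓ, hslit] with w h1 h2
    exact ((differentiableAt_const _).sub ((differentiableAt_id.pow 2).mul h1)).cpow
      (differentiableAt_const _) h2
  have hbre : ∀ᶠ w : ℂ in 𝓝 0, 1 / 2 < (b w).re := by
    have h1 : ContinuousAt (fun w => (b w).re) 0 :=
      Complex.continuous_re.continuousAt.comp hdb.self_of_nhds.continuousAt
    refine h1.eventually (lt_mem_nhds ?_)
    simp only [hb]
    norm_num
  obtain ⟨r₁, hr₁, H₁⟩ := Metric.nhds_basis_closedBall.eventually_iff.1
    (hdℓ.and (hdb.and hbre))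
  obtain ⟨r₂, hr₂, H₂⟩ := Metric.nhds_basis_closedBall.eventually_iff.1
    (hsum.and (hℓL.and (hm.and hint)))
  have hr : 0 < min r₁ r₂ := lt_min hr₁ hr₂
  have H₁' : ∀ w ∈ Metric.closedBall (0 : ℂ) (min r₁ r₂), _ := fun w hw =>
    H₁ (Metric.closedBall_subset_closedBall (min_le_left _ _) hw)
  have H₂' : ∀ h : ℝ, |h| ≤ min r₁ r₂ → _ := fun h hh =>
    H₂ (show h ∈ Metric.closedBall (0 : ℝ) r₂ by
      rw [mem_closedBall_zero_iff]; exact hh.trans (min_le_right _ _))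
  have hre : ∀ h : ℝ, |h| ≤ min r₁ r₂ → (ℓ h).re = L h := fun h hh => by
    rw [(H₂' h hh).2.1, Complex.ofReal_re]
  refine ⟨α, min r₁ r₂, ℓ, b, hr, hα0, hℓ0, fun w hw => (H₁' w hw).1, fun w hw => (H₁' w hw).2.1,
    fun w hw => (H₁' w hw).2.2.le,
    fun h hh => ?_, fun h hh => ?_, fun h hh => ?_, fun h hh => ?_, fun h h0 hh => ?_⟩
  · rw [hre h hh, (H₂' h hh).2.1]
  · rw [hre h hh]; exact (H₂' h hh).1
  · rw [hre h hh, hb]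
    simp only
    rw [(H₂' h hh).2.1, Real.sqrt_eq_rpow, Complex.ofReal_cpow (by linarith [(H₂' h hh).2.2.1.1])]
    norm_num
  · rw [hre h hh]; exact (H₂' h hh).2.2.1
  · have hh' : |h| ≤ min r₁ r₂ := by rwa [abs_of_pos h0]
    rw [hre h hh']; exact (H₂' h hh').2.2.2 h0

/-! ### Taylor coefficients of holomorphic families -/

/-- The real part of the `j`-th Taylor coefficient at `0` of a function holomorphic on the closed
disc of radius `r`, as a Cauchy integral. -/
def taylorRe (r : ℝ) (f : ℂ → ℂ) (j : ℕ) : ℝ := ((cauchyPowerSeries f 0 r).coeff j).re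

lemma cauchy_coeff_eq (r : ℝ) (f : ℂ → ℂ) (j : ℕ) : (cauchyPowerSeries f 0 r).coeff j =
    (2 * Real.pi * Complex.I)⁻¹ * ∫ θ in (0 : ℝ)..2 * Real.pi,
      (deriv (circleMap 0 r) θ * ((1 / circleMap 0 r θ) ^ j * (circleMap 0 r θ)⁻¹)) *
        f (circleMap 0 r θ) := by
  have h := cauchyPowerSeries_apply f 0 r j 1
  have h2 : (cauchyPowerSeries f 0 r).coeff j = cauchyPowerSeries f 0 r j fun _ => 1 := rfl
  rw [h2, h, smul_eq_mul, circleIntegral]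
  congr 1
  refine intervalIntegral.integral_congr fun θ _ => ?_
  simp only [smul_eq_mul, sub_zero]
  ring

lemma hasSum_taylorRe {r : ℝ} (hr : 0 < r) {f : ℂ → ℂ}
    (hf : DifferentiableOn ℂ f (Metric.closedBall 0 r)) {h : ℝ} (hh : |h| < r) :
    HasSum (fun j => taylorRe r f j * h ^ j) (f h).re := by
  lift r to NNReal using hr.le
  have h1 := hf.hasFPowerSeriesOnBall (by exact_mod_cast hr)
  have h2 := h1.hasSum (y := (h : ℂ)) (by
    rw [Metric.mem_eball, edist_zero_right, enorm_eq_nnnorm, ENNReal.coe_lt_coe,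
      ← NNReal.coe_lt_coe, coe_nnnorm, Complex.norm_real, Real.norm_eq_abs]
    exact hh)
  have h3 := Complex.hasSum_re h2
  rw [zero_add] at h3
  refine h3.congr_fun fun j => ?_
  rw [FormalMultilinearSeries.apply_eq_pow_smul_coeff, smul_eq_mul, ← Complex.ofReal_pow,
    Complex.re_ofReal_mul, mul_comm]
  rfl

lemma abs_taylorRe_le {r M : ℝ} (hr : 0 < r) {f : ℂ → ℂ}
    (hM : ∀ w ∈ Metric.sphere (0 : ℂ) r, ‖f w‖ ≤ M) (j : ℕ) :
    |taylorRe r f j| ≤ M * r⁻¹ ^ j := by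
  refine (Complex.abs_re_le_norm _).trans ?_
  rw [← FormalMultilinearSeries.norm_apply_eq_norm_coef]
  refine (norm_cauchyPowerSeries_le f 0 r j).trans ?_
  rw [abs_of_pos hr]
  gcongr
  have h1 : ‖∫ θ in (0 : ℝ)..2 * Real.pi, ‖f (circleMap 0 r θ)‖‖ ≤ M * |2 * Real.pi - 0| :=
    intervalIntegral.norm_integral_le_of_norm_le_const fun θ _ => by
      rw [norm_norm]
      exact hM _ (circleMap_mem_sphere 0 hr.le θ)
  have h2 := (le_abs_self _).trans h1
  rw [sub_zero, abs_of_pos Real.two_pi_pos] at h2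
  rw [inv_mul_le_iff₀ Real.two_pi_pos]
  linarith

lemma abs_sub_taylorRe_sum_le {r M : ℝ} (hr : 0 < r) {f : ℂ → ℂ}
    (hf : DifferentiableOn ℂ f (Metric.closedBall 0 r))
    (hM : ∀ w ∈ Metric.sphere (0 : ℂ) r, ‖f w‖ ≤ M) {h : ℝ} (hh : |h| ≤ r / 2) (N : ℕ) :
    |(f h).re - ∑ j ∈ Finset.range N, taylorRe r f j * h ^ j| ≤ 2 * M * (|h| / r) ^ N := by
  have hs := hasSum_taylorRe hr hf (h := h) (by linarith)
  have h1 := (hasSum_nat_add_iff' N).2 hs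
  rw [← h1.tsum_eq]
  have hq0 : 0 ≤ |h| / r := by positivity
  have hq : |h| / r ≤ 1 / 2 := by rw [div_le_iff₀ hr]; linarith
  have hg := (hasSum_geometric_of_lt_one hq0 (by linarith)).mul_left (M * (|h| / r) ^ N)
  have hM0 : 0 ≤ M := by
    have h2 := abs_taylorRe_le hr hM 0
    rw [pow_zero, mul_one] at h2
    exact (abs_nonneg _).trans h2
  have h3 := tsum_of_norm_bounded (f := fun j => taylorRe r f (j + N) * h ^ (j + N)) hg fun j => by
    rw [Real.norm_eq_abs, abs_mul, abs_pow]
    refine (mul_le_mul_of_nonneg_right (abs_taylorRe_le hr hM (j + N)) (by positivity)).trans_eq ?_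
    rw [div_eq_mul_inv, mul_pow, mul_pow, pow_add, pow_add]
    ring
  rw [Real.norm_eq_abs] at h3
  refine h3.trans ?_
  have h4 : (1 - |h| / r)⁻¹ ≤ 2 := by
    rw [inv_le_comm₀ (by linarith) two_pos]
    linarith
  calc M * (|h| / r) ^ N * (1 - |h| / r)⁻¹ ≤ M * (|h| / r) ^ N * 2 := by gcongr
    _ = _ := by ring

/-- A holomorphic family of smooth functions on the line: `F k w` is the `k`-th derivative of the
function `F 0 w`, which depends holomorphically on `w` in the closed disc of radius `r`. -/
structure HolomorphicFamily (r : ℝ) (F : ℕ → ℂ → ℝ → ℂ) : Prop where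
  r_pos : 0 < r
  diff : ∀ k s, DifferentiableOn ℂ (fun w => F k w s) (Metric.closedBall 0 r)
  cont : ∀ k, ContinuousOn (fun p : ℂ × ℝ => F k p.1 p.2) (Metric.sphere 0 r ×ˢ Set.univ)
  hasDeriv : ∀ k, ∀ w ∈ Metric.sphere (0 : ℂ) r, ∀ s, HasDerivAt (F k w) (F (k + 1) w s) s

namespace HolomorphicFamily

variable {r : ℝ} {F : ℕ → ℂ → ℝ → ℂ}

/-- Taylor coefficients in the parameter may be differentiated in the variable, under the Cauchy
integral. -/
lemma hasDerivAt_taylorRe (hF : HolomorphicFamily r F) (k j : ℕ) (s : ℝ) :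
    HasDerivAt (fun s => taylorRe r (fun w => F k w s) j)
      (taylorRe r (fun w => F (k + 1) w s) j) s := by
  have hr := hF.r_pos
  have hmem : ∀ θ, circleMap 0 r θ ∈ Metric.sphere (0 : ℂ) r := circleMap_mem_sphere 0 hr.le
  set c : ℝ → ℂ := fun θ =>
    deriv (circleMap 0 r) θ * ((1 / circleMap 0 r θ) ^ j * (circleMap 0 r θ)⁻¹) with hc
  have hcc : Continuous c := by
    have h1 : Continuous fun θ => (circleMap 0 r θ)⁻¹ :=
      (continuous_circleMap 0 r).inv₀ fun θ => circleMap_ne_center hr.ne'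
    have h2 : Continuous fun θ => deriv (circleMap 0 r) θ := by
      simp only [deriv_circleMap]
      exact (continuous_circleMap 0 r).mul continuous_const
    simp only [hc, one_div]
    exact h2.mul ((h1.pow j).mul h1)
  have hjoint : ∀ k, Continuous fun p : ℝ × ℝ => F k (circleMap 0 r p.1) p.2 := fun k =>
    (hF.cont k).comp_continuous
      (((continuous_circleMap 0 r).comp continuous_fst).prodMk continuous_snd)
      fun p => ⟨hmem p.1, Set.mem_univ _⟩
  have hslice : ∀ k s, Continuous fun θ => c θ * F k (circleMap 0 r θ) s := fun k s =>
    hcc.mul ((hjoint k).comp (continuous_id.prodMk continuous_const))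
  obtain ⟨M, hM⟩ := (isCompact_uIcc (a := (0 : ℝ)) (b := 2 * Real.pi)).prod
    (isCompact_closedBall s 1) |>.exists_bound_of_continuousOn
    (f := fun p : ℝ × ℝ => c p.1 * F (k + 1) (circleMap 0 r p.1) p.2)
    ((hcc.comp continuous_fst).mul (hjoint (k + 1))).continuousOn
  have key := (intervalIntegral.hasDerivAt_integral_of_dominated_loc_of_deriv_le
    (μ := (volume : Measure ℝ)) (a := 0) (b := 2 * Real.pi)
    (F := fun s θ => c θ * F k (circleMap 0 r θ) s)
    (F' := fun s θ => c θ * F (k + 1) (circleMap 0 r θ) s) (bound := fun _ => M)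
    (Metric.closedBall_mem_nhds s one_pos)
    (Eventually.of_forall fun s => (hslice k s).aestronglyMeasurable)
    ((hslice k s).intervalIntegrable _ _) (hslice (k + 1) s).aestronglyMeasurable
    (ae_of_all _ fun θ hθ t ht => hM (θ, t) ⟨Set.uIoc_subset_uIcc hθ, ht⟩)
    intervalIntegrable_const
    (ae_of_all _ fun θ _ t _ => (hF.hasDeriv k _ (hmem θ) t).const_mul _)).2
  have h2 := Complex.reCLM.hasFDerivAt.comp_hasDerivAt s
    (key.const_mul (2 * Real.pi * Complex.I)⁻¹)
  have h3 : ∀ k, (fun s => taylorRe r (fun w => F k w s) j) = fun s =>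
      ((2 * Real.pi * Complex.I)⁻¹ * ∫ θ in (0 : ℝ)..2 * Real.pi,
        c θ * F k (circleMap 0 r θ) s).re := fun k => by
    funext s
    unfold taylorRe
    rw [cauchy_coeff_eq]
  rw [h3, congrFun (h3 (k + 1)) s]
  exact h2

lemma contDiff_taylorRe (hF : HolomorphicFamily r F) (k j : ℕ) :
    ContDiff ℝ ∞ fun s => taylorRe r (fun w => F k w s) j := by
  rw [contDiff_infty]
  intro m
  induction m generalizing k with
  | zero =>
    exact contDiff_zero.2 (continuous_iff_continuousAt.2 fun s =>
      (hF.hasDerivAt_taylorRe k j s).continuousAt)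
  | succ m ih =>
    rw [Nat.cast_succ, contDiff_succ_iff_deriv]
    refine ⟨fun s => (hF.hasDerivAt_taylorRe k j s).differentiableAt, by simp, ?_⟩
    have : deriv (fun s => taylorRe r (fun w => F k w s) j)
        = fun s => taylorRe r (fun w => F (k + 1) w s) j :=
      funext fun s => (hF.hasDerivAt_taylorRe k j s).deriv
    rw [this]
    exact ih (k + 1)

lemma hasSum (hF : HolomorphicFamily r F) (k : ℕ) (s : ℝ) {h : ℝ} (hh : |h| < r) :
    HasSum (fun j => taylorRe r (fun w => F k w s) j * h ^ j) (F k h s).re :=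
  hasSum_taylorRe hF.r_pos (hF.diff k s) hh

end HolomorphicFamily

lemma eventually_abs_lt {r : ℝ} (hr : 0 < r) : ∀ᶠ h : ℝ in 𝓝 0, |h| < r := by
  filter_upwards [Metric.ball_mem_nhds (0 : ℝ) hr] with h hh
  simpa using hh

/-! ### The holomorphic families of eigenfunctions -/

lemma iteratedDeriv_airyC_differentiable (k : ℕ) : Differentiable ℂ (iteratedDeriv k airyC) :=
  (differentiable_airyC.contDiff (n := ((k + 1 : ℕ) : WithTop ℕ∞))).differentiable_iteratedDeriv k
    (by exact_mod_cast Nat.lt_succ_self k)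

/-- The eigenfunction on the left, `c A(s + ℓ w)`, and its derivatives in `s`. -/
def leftFamily (c : ℝ) (ℓ : ℂ → ℂ) (k : ℕ) (w : ℂ) (s : ℝ) : ℂ :=
  c * iteratedDeriv k airyC (s + ℓ w)

/-- The eigenfunction on the right, `c A(ℓ w) exp (- b w σ)`, and its derivatives in `σ`. -/
def rightFamily (c : ℝ) (ℓ b : ℂ → ℂ) (k : ℕ) (w : ℂ) (s : ℝ) : ℂ :=
  c * airyC (ℓ w) * ((-b w) ^ k * Complex.exp (-b w * s))

variable {n : ℕ} {α : ℕ → ℝ} {r : ℝ} {ℓ b : ℂ → ℂ}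

lemma IsBranch.holomorphic_left (hB : IsBranch n α r ℓ b) (c : ℝ) :
    HolomorphicFamily r (leftFamily c ℓ) where
  r_pos := hB.r_pos
  diff k s w hw := by
    have h1 : DifferentiableAt ℂ (fun w => (s : ℂ) + ℓ w) w := (hB.diff_ell w hw).const_add _
    exact ((((iteratedDeriv_airyC_differentiable k) _).comp w h1).const_mul
      (c : ℂ)).differentiableWithinAt
  cont k := by
    have h1 : ContinuousOn ℓ (Metric.sphere 0 r) := fun w hw =>
      (hB.diff_ell w (Metric.sphere_subset_closedBall hw)).continuousAt.continuousWithinAt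
    have h2 : ContinuousOn (fun p : ℂ × ℝ => (p.2 : ℂ) + ℓ p.1)
        (Metric.sphere 0 r ×ˢ Set.univ) :=
      (Complex.continuous_ofReal.comp continuous_snd).continuousOn.add
        (h1.comp continuousOn_fst fun p hp => hp.1)
    exact ((iteratedDeriv_airyC_differentiable k).continuous.comp_continuousOn h2).const_mul _
  hasDeriv k w _ s := by
    have h1 : HasDerivAt (fun s : ℝ => (s : ℂ) + ℓ w) 1 s :=
      ((HasDerivAt.ofReal_comp (hasDerivAt_id s)).add_const _).congr_deriv (by simp)
    have h2 := ((iteratedDeriv_airyC_differentiable k) ((s : ℂ) + ℓ w)).hasDerivAt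
    refine ((h2.comp s h1).const_mul (c : ℂ)).congr_deriv ?_
    rw [leftFamily, iteratedDeriv_succ, mul_one]

lemma IsBranch.holomorphic_right (hB : IsBranch n α r ℓ b) (c : ℝ) :
    HolomorphicFamily r (rightFamily c ℓ b) where
  r_pos := hB.r_pos
  diff k s w hw := by
    have h1 : DifferentiableAt ℂ (fun w => airyC (ℓ w)) w :=
      (differentiable_airyC _).comp w (hB.diff_ell w hw)
    have h2 := (hB.diff_b w hw).neg
    exact ((h1.const_mul (c : ℂ)).mul ((h2.pow k).mul
      (h2.mul_const (s : ℂ)).cexp)).differentiableWithinAt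
  cont k := by
    have hfst : Set.MapsTo (fun p : ℂ × ℝ => p.1) (Metric.sphere 0 r ×ˢ Set.univ)
      (Metric.sphere 0 r) := fun p hp => hp.1
    have h1 : ContinuousOn (fun p : ℂ × ℝ => ℓ p.1) (Metric.sphere 0 r ×ˢ Set.univ) :=
      ContinuousOn.comp (t := Metric.sphere 0 r) (fun w hw => (hB.diff_ell w
        (Metric.sphere_subset_closedBall hw)).continuousAt.continuousWithinAt)
        continuousOn_fst hfst
    have h2 : ContinuousOn (fun p : ℂ × ℝ => -b p.1) (Metric.sphere 0 r ×ˢ Set.univ) :=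
      (ContinuousOn.comp (t := Metric.sphere 0 r) (fun w hw => (hB.diff_b w
        (Metric.sphere_subset_closedBall hw)).continuousAt.continuousWithinAt)
        continuousOn_fst hfst).neg
    have h3 : ContinuousOn (fun p : ℂ × ℝ => (p.2 : ℂ)) (Metric.sphere 0 r ×ˢ Set.univ) :=
      (Complex.continuous_ofReal.comp continuous_snd).continuousOn
    exact ((differentiable_airyC.continuous.comp_continuousOn h1).const_mul _).mul
      ((h2.pow k).mul (h2.mul h3).cexp)
  hasDeriv k w _ s := by
    have h1 : HasDerivAt (fun s : ℝ => -b w * (s : ℂ)) (-b w) s :=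
      ((HasDerivAt.ofReal_comp (hasDerivAt_id s)).const_mul _).congr_deriv (by simp)
    refine ((h1.cexp.const_mul ((-b w) ^ k)).const_mul (c * airyC (ℓ w))).congr_deriv ?_
    rw [rightFamily]
    ring

lemma IsBranch.exists_bound (hB : IsBranch n α r ℓ b) (c : ℝ) : ∃ M : ℝ, 0 ≤ M ∧
    (∀ w ∈ Metric.closedBall (0 : ℂ) r, ∀ s, ‖leftFamily c ℓ 0 w s‖ ≤ M * Real.exp s) ∧
    ∀ w ∈ Metric.closedBall (0 : ℂ) r, ∀ s, 0 ≤ s →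
      ‖rightFamily c ℓ b 0 w s‖ ≤ M * Real.exp (-(s / 2)) := by
  obtain ⟨B, hBd⟩ := (isCompact_closedBall (0 : ℂ) r).exists_bound_of_continuousOn
    (f := ℓ) fun w hw => (hB.diff_ell w hw).continuousAt.continuousWithinAt
  obtain ⟨C, hC0, hC⟩ := airyC_bound B
  refine ⟨|c| * (C * Real.exp B), by positivity, fun w hw s => ?_, fun w hw s hs => ?_⟩
  · unfold leftFamily
    rw [iteratedDeriv_zero, norm_mul, Complex.norm_real, Real.norm_eq_abs, mul_assoc, mul_assoc,
      ← Real.exp_add]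
    refine mul_le_mul_of_nonneg_left ((hC _ ?_).trans ?_) (abs_nonneg _)
    · simpa using (Complex.abs_im_le_norm (ℓ w)).trans (hBd w hw)
    · refine mul_le_mul_of_nonneg_left (Real.exp_le_exp.2 ?_) hC0
      have := (Complex.re_le_norm (ℓ w)).trans (hBd w hw)
      simp only [Complex.add_re, Complex.ofReal_re]
      linarith
  · unfold rightFamily
    rw [norm_mul, norm_mul, Complex.norm_real, Real.norm_eq_abs, pow_zero, one_mul,
      Complex.norm_exp]
    refine mul_le_mul (mul_le_mul_of_nonneg_left ((hC _ ?_).trans ?_) (abs_nonneg _))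
      (Real.exp_le_exp.2 ?_) (Real.exp_pos _).le (by positivity)
    · exact (Complex.abs_im_le_norm (ℓ w)).trans (hBd w hw)
    · exact mul_le_mul_of_nonneg_left (Real.exp_le_exp.2
        ((Complex.re_le_norm (ℓ w)).trans (hBd w hw))) hC0
    · rw [Complex.re_mul_ofReal, Complex.neg_re]
      nlinarith [hB.b_re w hw]

/-! ### Exponentially decaying functions in `L²` -/

lemma integral_exp_neg_mul_abs {c : ℝ} (hc : 0 < c) : ∫ x : ℝ, Real.exp (-(c * |x|)) = 2 / c := by
  rw [integral_comp_abs (f := fun x => Real.exp (-(c * x)))]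
  have h := integral_exp_mul_Ioi (a := -c) (by linarith) 0
  simp only [neg_mul] at h
  rw [h]
  simp
  ring

lemma integrable_exp_neg_mul_abs {c : ℝ} (hc : 0 < c) :
    Integrable fun x : ℝ => Real.exp (-(c * |x|)) := by
  refine Integrable.of_integral_ne_zero ?_
  rw [integral_exp_neg_mul_abs hc]
  positivity

lemma memLp_exp_neg_mul_abs {c E : ℝ} (hc : 0 < c) :
    MemLp (fun x : ℝ => E * Real.exp (-(c * |x|))) 2 volume := by
  rw [memLp_two_iff_integrable_sq (by fun_prop : Continuous _).aestronglyMeasurable]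
  refine ((integrable_exp_neg_mul_abs (mul_pos two_pos hc)).const_mul (E ^ 2)).congr
    (ae_of_all _ fun x => ?_)
  simp only
  rw [mul_pow, ← Real.exp_nat_mul]
  congr 2
  push_cast
  ring

lemma eLpNorm_le_of_exp_decay {f : ℝ → ℂ} {E c : ℝ} (hE : 0 ≤ E) (hc : 0 < c)
    (hf : ∀ x, ‖f x‖ ≤ E * Real.exp (-(c * |x|))) :
    eLpNorm f 2 volume ≤ ENNReal.ofReal (E / Real.sqrt c) := by
  refine (eLpNorm_mono_real hf).trans (le_of_eq ?_)
  rw [(memLp_exp_neg_mul_abs hc).eLpNorm_eq_integral_rpow_norm two_ne_zero ENNReal.ofNat_ne_top]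
  congr 1
  have h1 : ∀ x : ℝ, ‖E * Real.exp (-(c * |x|))‖ ^ (2 : ENNReal).toReal
      = E ^ 2 * Real.exp (-((2 * c) * |x|)) := fun x => by
    rw [Real.norm_eq_abs, ENNReal.toReal_ofNat, Real.rpow_two, sq_abs, mul_pow,
      ← Real.exp_nat_mul]
    congr 2
    push_cast
    ring
  simp_rw [h1]
  rw [integral_const_mul, integral_exp_neg_mul_abs (mul_pos two_pos hc), ENNReal.toReal_ofNat,
    ← one_div, ← Real.sqrt_eq_rpow, show E ^ 2 * (2 / (2 * c)) = E ^ 2 / c by field_simp,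
    Real.sqrt_div (sq_nonneg _), Real.sqrt_sq hE]

lemma memLp_of_exp_decay {f : ℝ → ℂ} (hfm : AEStronglyMeasurable f volume) {E c : ℝ} (hc : 0 < c)
    (hf : ∀ x, ‖f x‖ ≤ E * Real.exp (-(c * |x|))) : MemLp f 2 volume :=
  (memLp_exp_neg_mul_abs hc).of_le hfm (ae_of_all _ fun x => (hf x).trans (le_abs_self _))

/-- The function equal to `L` on `(-∞, 0]` and to `R` on `(0, ∞)`, with complex values. -/
def glue (L R : ℝ → ℝ) (z : ℝ) : ℂ := ((if z ≤ 0 then L z else R z : ℝ) : ℂ)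

lemma measurable_glue {L R : ℝ → ℝ} (hL : Continuous L) (hR : Continuous R) :
    Measurable (glue L R) :=
  Complex.measurable_ofReal.comp (Measurable.ite measurableSet_Iic hL.measurable hR.measurable)

lemma norm_glue_le {L R : ℝ → ℝ} {E c : ℝ} (hL : ∀ z ≤ 0, |L z| ≤ E * Real.exp (c * z))
    (hR : ∀ z, 0 < z → |R z| ≤ E * Real.exp (-(c * z))) (z : ℝ) :
    ‖glue L R z‖ ≤ E * Real.exp (-(c * |z|)) := by
  unfold glue
  rw [Complex.norm_real, Real.norm_eq_abs]
  split_ifs with h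
  · rw [abs_of_nonpos h, mul_neg, neg_neg]
    exact hL z h
  · push Not at h
    rw [abs_of_pos h]
    exact hR z h

/-! ### The domain of the operator -/

lemma toyRel_iff_mem_domain (κ : ℝ) (u f : L2) :
    ToyRel κ u f ↔ ∃ x : (Htoy κ).domain, (x : L2) = u ∧ Htoy κ x = f := by
  rw [← mem_graph_Htoy, LinearPMap.mem_graph_iff]

lemma mem_eigenspace_iff (κ μ : ℝ) (u : L2) : u ∈ eigenspace κ μ ↔ ToyRel κ u ((μ : ℂ) • u) :=
  (toyRel_iff_mem_domain κ u _).symm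

/-- Gluing two functions of class `C²` with the same value and derivative at `0` gives an element
of the domain. -/
lemma toyRel_glue {κ : ℝ} {L L' L'' R R' R'' : ℝ → ℝ} (hL : ∀ z, HasDerivAt L (L' z) z)
    (hL' : ∀ z, HasDerivAt L' (L'' z) z) (hLc : Continuous L'')
    (hR : ∀ z, HasDerivAt R (R' z) z) (hR' : ∀ z, HasDerivAt R' (R'' z) z) (hRc : Continuous R'')
    (h0 : L 0 = R 0) (h0' : L' 0 = R' 0) {u f : L2} (hu : u =ᵐ[volume] glue L R)
    (hf : f =ᵐ[volume] glue (fun z => -κ ^ 2 * L'' z - z * L z)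
      (fun z => -κ ^ 2 * R'' z + R z)) : ToyRel κ u f := by
  refine ⟨glue L R, glue L' R', hu.symm, fun z => ?_, fun z => ?_⟩
  · refine HasDerivAt.ofReal_comp (f := fun z => if z ≤ 0 then L z else R z) ?_
    rcases lt_trichotomy z 0 with hz | hz | hz
    · simp only [hz.le, if_true]
      refine (hL z).congr_of_eventuallyEq ?_
      filter_upwards [Iio_mem_nhds hz] with t ht
      rw [if_pos (le_of_lt ht)]
    · subst hz
      simp only [le_refl, if_true]
      have h1 : HasDerivWithinAt (fun z => if z ≤ 0 then L z else R z) (L' 0) (Set.Iic 0) 0 :=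
        (hL 0).hasDerivWithinAt.congr (fun t ht => if_pos ht) (if_pos le_rfl)
      have h2 : HasDerivWithinAt (fun z => if z ≤ 0 then L z else R z) (L' 0) (Set.Ici 0) 0 := by
        rw [h0']
        refine (hR 0).hasDerivWithinAt.congr (fun t ht => ?_) (by simp [h0])
        rcases (show (0 : ℝ) ≤ t from ht).eq_or_lt with h | h
        · rw [← h]; simp [h0]
        · rw [if_neg (not_le.2 h)]
      have h3 := h1.union h2
      rwa [Set.Iic_union_Ici, hasDerivWithinAt_univ] at h3
    · simp only [not_le.2 hz, if_false]
      refine (hR z).congr_of_eventuallyEq ?_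
      filter_upwards [Ioi_mem_nhds hz] with t ht
      rw [if_neg (not_le.2 ht)]
  · have h1 : ∀ᵐ t ∂(volume : Measure ℝ), t ∈ Set.uIoc 0 z → (W t : ℂ) * u t - f t
        = ((κ ^ 2 * (if t ≤ 0 then L'' t else R'' t) : ℝ) : ℂ) := by
      filter_upwards [hu, hf] with t h1 h2 _
      rw [h1, h2]
      unfold glue W
      split_ifs <;> push_cast <;> ring
    rw [intervalIntegral.integral_congr_ae h1, intervalIntegral.integral_ofReal,
      intervalIntegral.integral_const_mul]
    have h2 : ∫ t in (0 : ℝ)..z, (if t ≤ 0 then L'' t else R'' t)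
        = (if z ≤ 0 then L' z else R' z) - L' 0 := by
      split_ifs with hz
      · rw [← intervalIntegral.integral_eq_sub_of_hasDerivAt (fun t _ => hL' t)
          (hLc.intervalIntegrable _ _)]
        refine intervalIntegral.integral_congr fun t ht => ?_
        rw [Set.uIcc_of_ge hz] at ht
        exact if_pos ht.2
      · push Not at hz
        rw [h0', ← intervalIntegral.integral_eq_sub_of_hasDerivAt (fun t _ => hR' t)
          (hRc.intervalIntegrable _ _)]
        refine intervalIntegral.integral_congr_ae (ae_of_all _ fun t ht => ?_)
        rw [Set.uIoc_of_le hz.le] at ht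
        exact if_neg (not_le.2 ht.1)
    rw [h2]
    unfold glue
    rw [if_pos le_rfl]
    push_cast
    ring

/-! ### Eigenfunctions -/

/-- The candidate eigenfunction on the left. -/
def eigLeft (h l z : ℝ) : ℝ := airyA (z / h ^ 2 + l)

/-- The candidate eigenfunction on the right. -/
def eigRight (h l z : ℝ) : ℝ := airyA l * Real.exp (-(Real.sqrt (1 - h ^ 2 * l) * (z / h ^ 3)))

lemma continuous_eigLeft (h l : ℝ) : Continuous (eigLeft h l) :=
  continuous_airyA.comp (by fun_prop)

lemma continuous_eigRight (h l : ℝ) : Continuous (eigRight h l) := by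
  unfold eigRight
  fun_prop

lemma hasDerivAt_exp_neg_mul (β x : ℝ) :
    HasDerivAt (fun x => Real.exp (-(β * x))) (-β * Real.exp (-(β * x))) x := by
  have h1 : HasDerivAt (fun x : ℝ => -(β * x)) (-β) x :=
    ((hasDerivAt_id x).const_mul β).neg.congr_deriv (by simp)
  exact h1.exp.congr_deriv (by ring)

lemma exists_decay_eigenfunction {h l : ℝ} (hh : 0 < h) (hl : h ^ 2 * l < 1) :
    ∃ E c : ℝ, 0 < c ∧ ∀ z, ‖glue (eigLeft h l) (eigRight h l) z‖ ≤ E * Real.exp (-(c * |z|)) := by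
  obtain ⟨C, hC0, hC⟩ := airyA_bound
  have hs : 0 < Real.sqrt (1 - h ^ 2 * l) := Real.sqrt_pos.2 (by linarith)
  set c := min (1 / h ^ 2) (Real.sqrt (1 - h ^ 2 * l) / h ^ 3) with hc
  have hcpos : 0 < c := by positivity
  refine ⟨C * Real.exp l, c, hcpos, norm_glue_le (fun z hz => ?_) fun z hz => ?_⟩
  · refine (hC _).trans ?_
    rw [mul_assoc, ← Real.exp_add]
    refine mul_le_mul_of_nonneg_left (Real.exp_le_exp.2 ?_) hC0
    have : 1 / h ^ 2 * z ≤ c * z := mul_le_mul_of_nonpos_right (min_le_left _ _) hz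
    have h2 : z / h ^ 2 = 1 / h ^ 2 * z := by ring
    linarith
  · unfold eigRight
    rw [abs_mul, Real.abs_exp]
    refine mul_le_mul (hC l) (Real.exp_le_exp.2 ?_) (Real.exp_pos _).le (by positivity)
    have : c * z ≤ Real.sqrt (1 - h ^ 2 * l) / h ^ 3 * z :=
      mul_le_mul_of_nonneg_right (min_le_right _ _) hz.le
    have h2 : Real.sqrt (1 - h ^ 2 * l) * (z / h ^ 3) = Real.sqrt (1 - h ^ 2 * l) / h ^ 3 * z := by
      ring
    linarith

lemma memLp_eigenfunction {h l : ℝ} (hh : 0 < h) (hl : h ^ 2 * l < 1) :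
    MemLp (glue (eigLeft h l) (eigRight h l)) 2 volume := by
  obtain ⟨E, c, hc, hE⟩ := exists_decay_eigenfunction hh hl
  exact memLp_of_exp_decay
    (measurable_glue (continuous_eigLeft h l) (continuous_eigRight h l)).aestronglyMeasurable hc hE

/-- When the matching condition holds, the glued function is an eigenfunction. -/
lemma mem_eigenspace_of_matching {h l : ℝ} (hh : 0 < h) (hm : Matching h l) {c : ℝ} {u : L2}
    (hu : u =ᵐ[volume] fun z => (c : ℂ) * glue (eigLeft h l) (eigRight h l) z) :
    u ∈ eigenspace (h ^ 3) (h ^ 2 * l) := by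
  rw [mem_eigenspace_iff]
  set s := Real.sqrt (1 - h ^ 2 * l) with hs
  have hs2 : s ^ 2 = 1 - h ^ 2 * l := Real.sq_sqrt (by linarith [hm.1])
  set m := 1 / h ^ 2 with hmdef
  set β := s / h ^ 3 with hβ
  have hu' : u =ᵐ[volume] glue (fun z => c * airyA (m * z + l))
      (fun z => c * airyA l * Real.exp (-(β * z))) := by
    filter_upwards [hu] with z hz
    rw [hz]
    unfold glue eigLeft eigRight
    have h1 : z / h ^ 2 + l = m * z + l := by rw [hmdef]; ring
    have h2 : s * (z / h ^ 3) = β * z := by rw [hβ]; ring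
    rw [h1, ← hs, h2]
    split_ifs <;> push_cast <;> ring
  refine toyRel_glue (L := fun z => c * airyA (m * z + l))
    (L' := fun z => c * (m * airyA' (m * z + l)))
    (L'' := fun z => c * (-m ^ 2 * (m * z + l) * airyA (m * z + l)))
    (R := fun z => c * airyA l * Real.exp (-(β * z)))
    (R' := fun z => c * airyA l * (-β * Real.exp (-(β * z))))
    (R'' := fun z => c * airyA l * (-β * (-β * Real.exp (-(β * z)))))
    (fun z => (hasDerivAt_airyA_affine m l z).const_mul c)
    (fun z => (hasDerivAt_airyA'_affine m l z).const_mul c)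
    ?_ (fun z => (hasDerivAt_exp_neg_mul β z).const_mul _)
    (fun z => ((hasDerivAt_exp_neg_mul β z).const_mul (-β)).const_mul _) (by fun_prop) (by simp)
    ?_ hu' ?_
  · have : Continuous fun z => airyA (m * z + l) := continuous_airyA.comp (by fun_prop)
    fun_prop
  · have h1 := hm.2
    rw [← hs] at h1
    simp only [mul_zero, zero_add, neg_zero, Real.exp_zero, mul_one]
    rw [hmdef, hβ]
    field_simp
    linear_combination c * h1
  · filter_upwards [Lp.coeFn_smul ((h ^ 2 * l : ℝ) : ℂ) u, hu'] with z h1 h2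
    rw [h1, Pi.smul_apply, h2, smul_eq_mul]
    unfold glue
    rw [← Complex.ofReal_mul]
    congr 1
    split_ifs
    · rw [hmdef]
      field_simp
      ring
    · have h3 : (h ^ 3) ^ 2 * β ^ 2 = 1 - h ^ 2 * l := by
        rw [hβ, ← hs2]
        field_simp
      linear_combination (c * airyA l * Real.exp (-(β * z))) * h3

lemma measurable_W : Measurable W :=
  Measurable.ite measurableSet_Iic measurable_neg measurable_const

/-- A real-linear part of an eigenfunction below `1` is a multiple of the glued function, and the
matching condition holds unless it vanishes. -/
lemma eigenfunction_real_form {h l : ℝ} (hh : 0 < h) (hl : h ^ 2 * l < 1) {ψ v : ℝ → ℂ}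
    (hψ : ∀ z, HasDerivAt ψ (v z) z)
    (hint : ∀ a b, IntervalIntegrable (fun t => ((W t - h ^ 2 * l : ℝ) : ℂ) * ψ t) volume a b)
    (hv : ∀ z : ℝ, ((h ^ 3 : ℝ) : ℂ) ^ 2 * (v z - v 0)
      = ∫ t in (0 : ℝ)..z, ((W t - h ^ 2 * l : ℝ) : ℂ) * ψ t)
    (hL2 : MemLp ψ 2 volume) (p : ℂ →L[ℝ] ℝ) :
    ∃ a : ℝ, (∀ z, p (ψ z) = a * if z ≤ 0 then eigLeft h l z else eigRight h l z) ∧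
      (a ≠ 0 → h * airyA' l + Real.sqrt (1 - h ^ 2 * l) * airyA l = 0) := by
  set μ := h ^ 2 * l with hμ
  set s := Real.sqrt (1 - μ) with hs
  have hs2 : s ^ 2 = 1 - μ := Real.sq_sqrt (by linarith)
  have hspos : 0 < s := Real.sqrt_pos.2 (by linarith)
  set K : ℂ := (((h ^ 3 : ℝ) : ℂ) ^ 2)⁻¹ with hK
  have hK0 : ((h ^ 3 : ℝ) : ℂ) ^ 2 ≠ 0 := by
    rw [← Complex.ofReal_pow]
    exact Complex.ofReal_ne_zero.2 (by positivity)
  have hKr : K = (((h ^ 6)⁻¹ : ℝ) : ℂ) := by rw [hK]; push_cast; ring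
  have hψc : Continuous ψ := continuous_iff_continuousAt.2 fun z => (hψ z).continuousAt
  have hv' : v = fun z => v 0 + K * ∫ t in (0 : ℝ)..z, ((W t - μ : ℝ) : ℂ) * ψ t := by
    funext z
    rw [← hv z, hK, inv_mul_cancel_left₀ hK0]
    ring
  have hvc : Continuous v := by
    rw [hv']
    exact continuous_const.add ((intervalIntegral.continuous_primitive hint 0).const_mul K)
  set y : ℝ → ℝ := fun z => p (ψ z) with hy
  set y' : ℝ → ℝ := fun z => p (v z) with hy'
  have hyc : Continuous y := p.continuous.comp hψc
  have hyc' : Continuous y' := p.continuous.comp hvc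
  have hyd : ∀ z, HasDerivAt y (y' z) z := fun z => p.hasFDerivAt.comp_hasDerivAt z (hψ z)
  have hyd' : ∀ z (V : ℝ → ℝ), Continuous V → (∀ᶠ t in 𝓝 z, W t = V t) →
      HasDerivAt y' ((h ^ 6)⁻¹ * (V z - μ) * y z) z := by
    intro z V hV hWV
    have h1 : (fun t => ((W t - μ : ℝ) : ℂ) * ψ t) =ᶠ[𝓝 z]
        fun t => ((V t - μ : ℝ) : ℂ) * ψ t := hWV.mono fun t ht => by simp only [ht]
    have hVc : Continuous fun t => ((V t - μ : ℝ) : ℂ) * ψ t :=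
      (Complex.continuous_ofReal.comp (hV.sub continuous_const)).mul hψc
    have h2 := intervalIntegral.integral_hasDerivAt_right (hint 0 z)
      (((Complex.measurable_ofReal.comp (measurable_W.sub_const μ)).mul
        hψc.measurable).stronglyMeasurable.stronglyMeasurableAtFilter)
      (hVc.continuousAt.congr h1.symm)
    have h3 : HasDerivAt v (K * (((V z - μ : ℝ) : ℂ) * ψ z)) z := by
      rw [hv']
      refine ((h2.const_mul K).const_add (v 0)).congr_deriv ?_
      rw [hWV.self_of_nhds]
    refine (p.hasFDerivAt.comp_hasDerivAt z h3).congr_deriv ?_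
    rw [hKr, ← mul_assoc, ← Complex.ofReal_mul, ← Complex.real_smul, map_smul, smul_eq_mul]
  have hyL2 : Integrable fun z => y z ^ 2 := by
    have h1 : MemLp y 2 volume := p.comp_memLp' hL2
    exact h1.integrable_sq
  set m := -(1 / h ^ 2) with hm
  have hb : airyA (m * max 0 μ + l) ≠ 0 := by
    have h1 : m * max 0 μ + l ≤ 0 := by
      have h2 : l = (1 / h ^ 2) * μ := by rw [hμ]; field_simp
      have h3 : (1 / h ^ 2) * μ ≤ (1 / h ^ 2) * max 0 μ :=
        mul_le_mul_of_nonneg_left (le_max_right _ _) (by positivity)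
      have h4 : m * max 0 μ = -((1 / h ^ 2) * max 0 μ) := by rw [hm]; ring
      linarith
    exact left_ne_zero_of_mul (airyA_mul_airyA'_pos h1).ne'
  -- for `x > max 0 μ` the point `z = - x` is in the forbidden region `W z > μ`, and the
  -- solution `A (z / h² + l)` does not vanish at `z = - max 0 μ`
  obtain ⟨c₁, hc₁⟩ := exists_eq_mul_of_sq_integrable (q := fun x => (h ^ 6)⁻¹ * (x - μ))
    (y := fun x => y (-x)) (y' := fun x => -y' (-x)) (φ := fun x => airyA (m * x + l))
    (φ' := fun x => m * airyA' (m * x + l)) (a := 0) (b := max 0 μ) (le_max_left _ _)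
    (by fun_prop)
    (fun x hx => mul_nonneg (by positivity) (by linarith [le_max_right 0 μ]))
    (hyc.comp continuous_neg).continuousOn (hyc'.comp continuous_neg).neg.continuousOn
    (fun x _ => ((hyd (-x)).scomp x (hasDerivAt_neg x)).congr_deriv (by simp))
    (fun x hx => (((hyd' (-x) (fun t => -t) continuous_neg (by
        filter_upwards [Iio_mem_nhds (show -x < 0 by linarith)] with t ht
        exact if_pos (le_of_lt ht))).scomp x (hasDerivAt_neg x)).neg).congr_deriv (by simp))
    (by simpa using (hyL2.comp_neg).integrableOn)
    (hasDerivAt_airyA_affine m l) (fun x => (hasDerivAt_airyA'_affine m l x).congr_deriv (by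
      rw [hm, hμ]; field_simp; ring))
    (sq_integrable_airyA_affine (by rw [hm]; exact neg_neg_of_pos (by positivity)) l 0) hb
  set β := s / h ^ 3 with hβ
  have hβpos : 0 < β := by positivity
  have hβ2 : β ^ 2 = (h ^ 6)⁻¹ * (1 - μ) := by
    rw [hβ, ← hs2]
    field_simp
  obtain ⟨c₂, hc₂⟩ := exists_eq_mul_of_sq_integrable (q := fun _ => β ^ 2)
    (y := y) (y' := y') (φ := fun x => Real.exp (-(β * x)))
    (φ' := fun x => -β * Real.exp (-(β * x))) (a := 0) (b := 0) le_rfl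
    continuous_const (fun _ _ => sq_nonneg β) hyc.continuousOn hyc'.continuousOn
    (fun x _ => hyd x)
    (fun x hx => (hyd' x (fun _ => 1) continuous_const (by
        filter_upwards [Ioi_mem_nhds hx] with t ht
        exact if_neg (not_le.2 ht))).congr_deriv (by rw [hβ2]))
    hyL2.integrableOn (hasDerivAt_exp_neg_mul β)
    (fun x => ((hasDerivAt_exp_neg_mul β x).const_mul (-β)).congr_deriv (by ring))
    (by
      have h1 : IntegrableOn (fun x : ℝ => Real.exp (-(2 * β) * x)) (Set.Ioi 0) :=
        integrableOn_exp_mul_Ioi (by linarith) 0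
      refine h1.congr_fun (fun x _ => ?_) measurableSet_Ioi
      simp only
      rw [← Real.exp_nat_mul]
      congr 1
      push_cast
      ring) (Real.exp_pos _).ne'
  have h1 := hc₁ 0 le_rfl
  have h2 := hc₂ 0 le_rfl
  simp only [neg_zero, mul_zero, zero_add, Real.exp_zero, mul_one] at h1 h2
  have h3 : c₂ = c₁ * airyA l := by rw [← h2.1, h1.1]
  refine ⟨c₁, fun z => ?_, fun hne => ?_⟩
  · change y z = _
    split_ifs with hz
    · have := (hc₁ (-z) (by linarith)).1
      rw [neg_neg] at this
      rw [this, eigLeft, hm]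
      congr 2
      ring
    · rw [(hc₂ z (not_le.1 hz).le).1, h3, eigRight, hβ, mul_assoc]
      congr 4
      ring
  · have h4 : c₁ * (m * airyA' l) = β * (c₁ * airyA l) := by
      have h5 := h1.2
      have h6 := h2.2
      rw [h3] at h6
      linear_combination -h6 - h5
    rw [hm, hβ] at h4
    field_simp at h4
    linarith

/-- Eigenfunctions for eigenvalues below `1` are multiples of the glued function, and exist only
if the matching condition holds. -/
lemma eigenspace_form {h l : ℝ} (hh : 0 < h) (hl : h ^ 2 * l < 1) {u : L2}
    (hu : u ∈ eigenspace (h ^ 3) (h ^ 2 * l)) :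
    ∃ a : ℂ, (u =ᵐ[volume] fun z => a * glue (eigLeft h l) (eigRight h l) z) ∧
      (a ≠ 0 → Matching h l) := by
  rw [mem_eigenspace_iff] at hu
  obtain ⟨ψ, v, h1, h2, h3⟩ := hu
  have hae : ∀ᵐ t ∂(volume : Measure ℝ), (W t : ℂ) * u t - (((h ^ 2 * l : ℝ) : ℂ) • u : L2) t
      = ((W t - h ^ 2 * l : ℝ) : ℂ) * ψ t := by
    filter_upwards [h1, Lp.coeFn_smul ((h ^ 2 * l : ℝ) : ℂ) u] with t h4 h5
    rw [h5, Pi.smul_apply, h4, smul_eq_mul]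
    push_cast
    ring
  have hint : ∀ a b,
      IntervalIntegrable (fun t => ((W t - h ^ 2 * l : ℝ) : ℂ) * ψ t) volume a b := fun a b =>
    (intervalIntegrable_rhs u (((h ^ 2 * l : ℝ) : ℂ) • u) a b).congr_ae (ae_restrict_of_ae hae)
  have hv : ∀ z : ℝ, ((h ^ 3 : ℝ) : ℂ) ^ 2 * (v z - v 0)
      = ∫ t in (0 : ℝ)..z, ((W t - h ^ 2 * l : ℝ) : ℂ) * ψ t := fun z => by
    rw [h3 z]
    exact intervalIntegral.integral_congr_ae (hae.mono fun t ht _ => ht)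
  have hL2 : MemLp ψ 2 volume := (memLp_congr_ae h1).2 (Lp.memLp u)
  obtain ⟨a, ha, ha'⟩ := eigenfunction_real_form hh hl h2 hint hv hL2 Complex.reCLM
  obtain ⟨b, hb, hb'⟩ := eigenfunction_real_form hh hl h2 hint hv hL2 Complex.imCLM
  refine ⟨a + b * Complex.I, ?_, fun hne => ⟨hl, ?_⟩⟩
  · filter_upwards [h1] with z hz
    rw [← hz]
    have h4 := ha z
    have h5 := hb z
    simp only [Complex.reCLM_apply, Complex.imCLM_apply] at h4 h5
    rw [← Complex.re_add_im (ψ z), h4, h5]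
    unfold glue
    push_cast
    ring
  · by_contra hc
    refine hne ?_
    have h4 : a = 0 := by_contra fun h => hc (ha' h)
    have h5 : b = 0 := by_contra fun h => hc (hb' h)
    rw [h4, h5]
    simp

/-- The glued function does not vanish far on the left. -/
lemma eigenfunction_not_ae_zero {h : ℝ} (hh : 0 < h) (l : ℝ) {c : ℂ}
    (h0 : ∀ᵐ z ∂(volume : Measure ℝ), c * glue (eigLeft h l) (eigRight h l) z = 0) : c = 0 := by
  by_contra hc
  have h1 : volume (Set.Iio (min 0 (-(h ^ 2 * l)))) = 0 := by
    refine measure_mono_null (fun z hz => ?_) (ae_iff.1 h0)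
    have hz' : z < min 0 (-(h ^ 2 * l)) := hz
    have hz0 : z ≤ 0 := (hz'.trans_le (min_le_left _ _)).le
    have hz1 : z / h ^ 2 + l ≤ 0 := by
      have h2 : z < -(h ^ 2 * l) := hz'.trans_le (min_le_right _ _)
      have h3 : z / h ^ 2 ≤ -l := by
        rw [div_le_iff₀ (by positivity)]
        linarith
      linarith
    refine mul_ne_zero hc ?_
    unfold glue eigLeft
    rw [if_pos hz0]
    exact Complex.ofReal_ne_zero.2 (left_ne_zero_of_mul (airyA_mul_airyA'_pos hz1).ne')
  simp at h1

/-- The eigenvalues below `1` for `κ = h³` are the numbers `h² l` with `l` a matching. -/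
lemma mem_eigenvaluesBelowOne_iff {h l : ℝ} (hh : 0 < h) :
    h ^ 2 * l ∈ eigenvaluesBelowOne (h ^ 3) ↔ Matching h l := by
  constructor
  · rintro ⟨hl, hne⟩
    obtain ⟨u, hu, hu0⟩ := (Submodule.ne_bot_iff _).1 hne
    obtain ⟨a, ha, hm⟩ := eigenspace_form hh hl hu
    refine hm fun h0 => hu0 ((Lp.eq_zero_iff_ae_eq_zero).2 ?_)
    filter_upwards [ha] with z hz
    rw [hz, h0, zero_mul, Pi.zero_apply]
  · intro hm
    refine ⟨hm.1, (Submodule.ne_bot_iff _).2 ⟨(memLp_eigenfunction hh hm.1).toLp _,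
      mem_eigenspace_of_matching hh hm (c := 1) ?_, fun h0 => ?_⟩⟩
    · filter_upwards [(memLp_eigenfunction hh hm.1).coeFn_toLp] with z hz
      rw [hz]
      simp
    · refine one_ne_zero (eigenfunction_not_ae_zero hh l (c := 1) ?_)
      filter_upwards [(memLp_eigenfunction hh hm.1).coeFn_toLp,
        (Lp.eq_zero_iff_ae_eq_zero).1 h0] with z h1 h2
      rw [one_mul, ← h1, h2, Pi.zero_apply]

/-! ### Profiles and their hierarchy of equations -/

/-- The `k`-th derivative of the left profile of order `j`: the Taylor coefficient in `h` of the
exact eigenfunction on the left. -/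
def leftProfile (c r : ℝ) (ℓ : ℂ → ℂ) (k j : ℕ) (s : ℝ) : ℝ :=
  taylorRe r (fun w => leftFamily c ℓ k w s) j

/-- The `k`-th derivative of the right profile of order `j`: the Taylor coefficient in `h` of the
exact eigenfunction on the right. -/
def rightProfile (c r : ℝ) (ℓ b : ℂ → ℂ) (k j : ℕ) (s : ℝ) : ℝ :=
  taylorRe r (fun w => rightFamily c ℓ b k w s) j

lemma IsBranch.left_re (hB : IsBranch n α r ℓ b) (c : ℝ) {h : ℝ} (hh : |h| ≤ r) (s : ℝ) :
    (leftFamily c ℓ 0 h s).re = c * airyA (s + (ℓ h).re) := by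
  unfold leftFamily
  rw [hB.ell_real h hh, Complex.ofReal_re, Complex.re_ofReal_mul, iteratedDeriv_zero,
    ← Complex.ofReal_add, airyA_eq_re]

lemma IsBranch.left_re_one (hB : IsBranch n α r ℓ b) (c : ℝ) {h : ℝ} (hh : |h| ≤ r) (s : ℝ) :
    (leftFamily c ℓ 1 h s).re = c * airyA' (s + (ℓ h).re) := by
  unfold leftFamily
  rw [hB.ell_real h hh, Complex.ofReal_re, Complex.re_ofReal_mul, iteratedDeriv_one,
    ← Complex.ofReal_add, airyA']

lemma IsBranch.left_re_two (hB : IsBranch n α r ℓ b) (c : ℝ) {h : ℝ} (hh : |h| ≤ r) (s : ℝ) :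
    (leftFamily c ℓ 2 h s).re
      = -s * (leftFamily c ℓ 0 h s).re - (ℓ h).re * (leftFamily c ℓ 0 h s).re := by
  rw [hB.left_re c hh]
  unfold leftFamily
  rw [hB.ell_real h hh, Complex.ofReal_re, Complex.re_ofReal_mul, iteratedDeriv_succ,
    iteratedDeriv_one, ← Complex.ofReal_add, (hasDerivAt_deriv_airyC _).deriv,
    ← Complex.ofReal_neg, Complex.re_ofReal_mul, airyA_eq_re]
  ring

lemma IsBranch.right_re (hB : IsBranch n α r ℓ b) (c : ℝ) (k : ℕ) {h : ℝ} (hh : |h| ≤ r) (s : ℝ) :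
    (rightFamily c ℓ b k h s).re = c * airyA (ℓ h).re * ((-Real.sqrt (1 - h ^ 2 * (ℓ h).re)) ^ k *
      Real.exp (-(Real.sqrt (1 - h ^ 2 * (ℓ h).re) * s))) := by
  unfold rightFamily
  rw [hB.b_real h hh, hB.ell_real h hh, Complex.ofReal_re, ← neg_mul, airyA_eq_re]
  rw [← Complex.ofReal_neg, ← Complex.ofReal_mul, ← Complex.ofReal_exp, ← Complex.ofReal_pow,
    ← Complex.ofReal_mul, Complex.re_mul_ofReal, Complex.re_ofReal_mul]

lemma taylorRe_zero {r : ℝ} (hr : 0 < r) {f : ℂ → ℂ}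
    (hf : DifferentiableOn ℂ f (Metric.closedBall 0 r)) : taylorRe r f 0 = (f 0).re := by
  have h1 := hasSum_taylorRe hr hf (h := 0) (by simpa using hr)
  have h2 := hasSum_single (f := fun j => taylorRe r f j * (0 : ℝ) ^ j) 0
    (fun j hj => by simp [hj])
  simpa using h2.unique h1

lemma IsBranch.leftProfile_zero (hB : IsBranch n α r ℓ b) (c s : ℝ) :
    leftProfile c r ℓ 0 0 s = c * airyA (s + airyZero n) := by
  unfold leftProfile
  rw [taylorRe_zero hB.r_pos ((hB.holomorphic_left c).diff 0 s)]
  have h1 := hB.left_re c (h := 0) (by simpa using hB.r_pos.le) s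
  rw [Complex.ofReal_zero, hB.value_zero, Complex.ofReal_re] at h1
  exact h1

lemma IsBranch.rightProfile_zero (hB : IsBranch n α r ℓ b) (hn : 1 ≤ n) (c s : ℝ) :
    rightProfile c r ℓ b 0 0 s = 0 := by
  unfold rightProfile
  rw [taylorRe_zero hB.r_pos ((hB.holomorphic_right c).diff 0 s)]
  have h1 := hB.right_re c 0 (h := 0) (by simpa using hB.r_pos.le) s
  rw [Complex.ofReal_zero, hB.value_zero, Complex.ofReal_re, airyA_airyZero hn] at h1
  rw [h1]
  ring

/-- The equation of the left profiles. -/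
lemma IsBranch.leftProfile_two (hB : IsBranch n α r ℓ b) (c s : ℝ) (j : ℕ) :
    leftProfile c r ℓ 2 j s = -s * leftProfile c r ℓ 0 j s
      - ∑ p ∈ Finset.HasAntidiagonal.antidiagonal j, α p.1 * leftProfile c r ℓ 0 p.2 s := by
  have hF := hB.holomorphic_left c
  refine congrFun (powerSeries_coeff_unique (a := fun j => leftProfile c r ℓ 2 j s)
    (b := fun j => -s * leftProfile c r ℓ 0 j s
      - ∑ p ∈ Finset.HasAntidiagonal.antidiagonal j, α p.1 * leftProfile c r ℓ 0 p.2 s)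
    (f := fun h => (leftFamily c ℓ 2 h s).re) ?_ ?_) j
  · filter_upwards [eventually_abs_lt hB.r_pos] with h hh using hF.hasSum 2 s hh
  · filter_upwards [eventually_abs_lt hB.r_pos] with h hh
    rw [hB.left_re_two c hh.le]
    have h1 := hF.hasSum 0 s hh
    refine ((h1.mul_left (-s)).sub (hasSum_powerSeries_mul (hB.hasSum h hh.le) h1)).congr_fun
      fun j => ?_
    unfold leftProfile
    ring

/-- The equation of the right profiles. -/
lemma IsBranch.rightProfile_two (hB : IsBranch n α r ℓ b) (c s : ℝ) (j : ℕ) :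
    rightProfile c r ℓ b 2 j s = rightProfile c r ℓ b 0 j s
      - ∑ p ∈ Finset.HasAntidiagonal.antidiagonal j,
        shiftCoeff 2 α p.1 * rightProfile c r ℓ b 0 p.2 s := by
  have hF := hB.holomorphic_right c
  refine congrFun (powerSeries_coeff_unique (a := fun j => rightProfile c r ℓ b 2 j s)
    (b := fun j => rightProfile c r ℓ b 0 j s - ∑ p ∈ Finset.HasAntidiagonal.antidiagonal j,
      shiftCoeff 2 α p.1 * rightProfile c r ℓ b 0 p.2 s)
    (f := fun h => (rightFamily c ℓ b 2 h s).re) ?_ ?_) j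
  · filter_upwards [eventually_abs_lt hB.r_pos] with h hh using hF.hasSum 2 s hh
  · filter_upwards [eventually_abs_lt hB.r_pos] with h hh
    have h0 : (rightFamily c ℓ b 2 h s).re = (rightFamily c ℓ b 0 h s).re
        - h ^ 2 * (ℓ h).re * (rightFamily c ℓ b 0 h s).re := by
      rw [hB.right_re c 2 hh.le, hB.right_re c 0 hh.le, neg_sq,
        Real.sq_sqrt (by linarith [(hB.matching h hh.le).1])]
      ring
    rw [h0]
    have h1 := hF.hasSum 0 s hh
    refine (h1.sub (hasSum_powerSeries_mul (hasSum_powerSeries_shift 2 (hB.hasSum h hh.le))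
      h1)).congr_fun fun j => ?_
    unfold rightProfile
    ring

lemma IsBranch.leftProfile_at_zero (hB : IsBranch n α r ℓ b) (c : ℝ) (j : ℕ) :
    leftProfile c r ℓ 0 j 0 = rightProfile c r ℓ b 0 j 0 := by
  refine congrFun (powerSeries_coeff_unique (a := fun j => leftProfile c r ℓ 0 j 0)
    (f := fun h => (leftFamily c ℓ 0 h 0).re) ?_ ?_) j
  · filter_upwards [eventually_abs_lt hB.r_pos] with h hh
    using (hB.holomorphic_left c).hasSum 0 0 hh
  · filter_upwards [eventually_abs_lt hB.r_pos] with h hh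
    have h1 := (hB.holomorphic_right c).hasSum 0 0 hh
    have h2 : (leftFamily c ℓ 0 h 0).re = (rightFamily c ℓ b 0 h 0).re := by
      rw [hB.left_re c hh.le, hB.right_re c 0 hh.le]
      simp
    rw [h2]
    exact h1

/-- The derivatives at `0` match with a shift of the order, as the two scales differ by a
factor `h`. -/
lemma IsBranch.rightProfile_one_at_zero (hB : IsBranch n α r ℓ b) (c : ℝ) (j : ℕ) :
    rightProfile c r ℓ b 1 j 0 = shiftCoeff 1 (fun i => leftProfile c r ℓ 1 i 0) j := by
  refine congrFun (powerSeries_coeff_unique (a := fun j => rightProfile c r ℓ b 1 j 0)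
    (f := fun h => (rightFamily c ℓ b 1 h 0).re) ?_ ?_) j
  · filter_upwards [eventually_abs_lt hB.r_pos] with h hh
    using (hB.holomorphic_right c).hasSum 1 0 hh
  · filter_upwards [eventually_abs_lt hB.r_pos] with h hh
    have h1 := hasSum_powerSeries_shift 1 ((hB.holomorphic_left c).hasSum 1 0 hh)
    have h2 : (rightFamily c ℓ b 1 h 0).re = h ^ 1 * (leftFamily c ℓ 1 h 0).re := by
      rw [hB.left_re_one c hh.le, hB.right_re c 1 hh.le, zero_add]
      have := (hB.matching h hh.le).2
      simp only [mul_zero, neg_zero, Real.exp_zero, pow_one, mul_one]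
      linear_combination -c * this
    rw [h2]
    exact h1

lemma IsBranch.hasDerivAt_leftProfile (hB : IsBranch n α r ℓ b) (c : ℝ) (k j : ℕ) (s : ℝ) :
    HasDerivAt (leftProfile c r ℓ k j) (leftProfile c r ℓ (k + 1) j s) s :=
  (hB.holomorphic_left c).hasDerivAt_taylorRe k j s

lemma IsBranch.hasDerivAt_rightProfile (hB : IsBranch n α r ℓ b) (c : ℝ) (k j : ℕ) (s : ℝ) :
    HasDerivAt (rightProfile c r ℓ b k j) (rightProfile c r ℓ b (k + 1) j s) s :=
  (hB.holomorphic_right c).hasDerivAt_taylorRe k j s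

lemma IsBranch.exists_profile_bound (hB : IsBranch n α r ℓ b) (c : ℝ) : ∃ M : ℝ, 0 ≤ M ∧
    (∀ j s, |leftProfile c r ℓ 0 j s| ≤ M * Real.exp s * r⁻¹ ^ j) ∧
    ∀ j s, 0 ≤ s → |rightProfile c r ℓ b 0 j s| ≤ M * Real.exp (-(s / 2)) * r⁻¹ ^ j := by
  obtain ⟨M, hM0, h1, h2⟩ := hB.exists_bound c
  exact ⟨M, hM0, fun j s => abs_taylorRe_le hB.r_pos
    (fun w hw => h1 w (Metric.sphere_subset_closedBall hw) s) j, fun j s hs =>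
    abs_taylorRe_le hB.r_pos (fun w hw => h2 w (Metric.sphere_subset_closedBall hw) s hs) j⟩

lemma integrableOn_airyA_sq (z : ℝ) : IntegrableOn (fun s => airyA (s + z) ^ 2) (Set.Iic 0) := by
  obtain ⟨C, hC0, hC⟩ := airyA_bound
  have h1 : IntegrableOn (fun s : ℝ => (C * Real.exp z) ^ 2 * Real.exp (2 * s)) (Set.Iic 0) :=
    (integrableOn_exp_mul_Iic two_pos 0).const_mul _
  refine h1.mono' ((continuous_airyA.comp (continuous_add_const z)).pow 2).aestronglyMeasurable
    (ae_of_all _ fun s => ?_)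
  rw [Real.norm_eq_abs, abs_pow]
  refine (pow_le_pow_left₀ (abs_nonneg _) (hC (s + z)) 2).trans_eq ?_
  rw [Real.exp_add, two_mul s, Real.exp_add]
  ring

/-- The normalization constant of the profiles. -/
def normConst (z : ℝ) : ℝ := 1 / Real.sqrt (∫ s in Set.Iic (0 : ℝ), airyA (s + z) ^ 2)

lemma integral_airyA_sq_pos (z : ℝ) : 0 < ∫ s in Set.Iic (0 : ℝ), airyA (s + z) ^ 2 := by
  refine (setIntegral_pos_iff_support_of_nonneg_ae
    (ae_of_all _ fun s => sq_nonneg _) (integrableOn_airyA_sq z)).2 ?_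
  have h1 : Set.Iic (min 0 (-z)) ⊆
      Function.support (fun s => airyA (s + z) ^ 2) ∩ Set.Iic (0 : ℝ) := fun s hs => by
    have hs' : s ≤ min 0 (-z) := hs
    have h2 : s + z ≤ 0 := by linarith [hs'.trans (min_le_right _ _)]
    exact ⟨pow_ne_zero 2 (left_ne_zero_of_mul (airyA_mul_airyA'_pos h2).ne'),
      hs'.trans (min_le_left _ _)⟩
  exact (by simp : 0 < volume (Set.Iic (min 0 (-z)))).trans_le (measure_mono h1)

lemma normConst_pos (z : ℝ) : 0 < normConst z :=
  one_div_pos.2 (Real.sqrt_pos.2 (integral_airyA_sq_pos z))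

lemma normConst_normalized (z : ℝ) :
    ∫ s in Set.Iic (0 : ℝ), (normConst z * airyA (s + z)) ^ 2 = 1 := by
  simp_rw [mul_pow]
  rw [integral_const_mul, normConst, div_pow, one_pow, Real.sq_sqrt (integral_airyA_sq_pos z).le]
  exact one_div_mul_cancel (integral_airyA_sq_pos z).ne'

lemma IsBranch.isProfilePair (hB : IsBranch n α r ℓ b) (hn : 1 ≤ n) :
    IsProfilePair (α 0) (leftProfile (normConst (airyZero n)) r ℓ 0)
      (rightProfile (normConst (airyZero n)) r ℓ b 0) := by
  set c := normConst (airyZero n) with hc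
  obtain ⟨M, hM0, h1, h2⟩ := hB.exists_profile_bound c
  have h0 : leftProfile c r ℓ 0 0 = fun s => c * airyA (1 * s + airyZero n) := by
    funext s
    rw [hB.leftProfile_zero c s, one_mul]
  refine ⟨fun j => (hB.holomorphic_left c).contDiff_taylorRe 0 j,
    fun j => (hB.holomorphic_right c).contDiff_taylorRe 0 j,
    fun j => ⟨M * r⁻¹ ^ j, 1, one_pos, fun s _ => (h1 j s).trans_eq (by rw [one_mul]; ring)⟩,
    fun j => ⟨M * r⁻¹ ^ j, 1 / 2, by norm_num, fun s hs => (h2 j s hs).trans_eq (by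
      rw [show (1 / 2 : ℝ) * s = s / 2 by ring]; ring)⟩,
    ⟨fun s _ => ?_, ?_, ?_⟩, fun s _ => hB.rightProfile_zero hn c s⟩
  · have hd : deriv (leftProfile c r ℓ 0 0) = fun s => c * (1 * airyA' (1 * s + airyZero n)) := by
      rw [h0]
      exact funext fun s => ((hasDerivAt_airyA_affine 1 (airyZero n) s).const_mul c).deriv
    rw [hd, ((hasDerivAt_airyA'_affine 1 (airyZero n) s).const_mul c).deriv, h0, hB.coeff_zero]
    ring
  · rw [hB.leftProfile_zero, zero_add, airyA_airyZero hn, mul_zero]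
  · simp_rw [hB.leftProfile_zero]
    exact normConst_normalized _

/-! ### Truncated products of power series -/

/-- The product of two truncated power series differs from the truncated product by terms of
order at least `N`. -/
lemma abs_truncated_mul_sub_le {a c : ℕ → ℝ} {N M : ℕ} {B h H : ℝ} (hB : ∀ k < N, |c k| ≤ B)
    (hB0 : 0 ≤ B) (h0 : 0 ≤ h) (hH : h ≤ H) (hH1 : 1 ≤ H) (hNM : N ≤ M) :
    |∑ j ∈ Finset.range N, (∑ p ∈ Finset.HasAntidiagonal.antidiagonal j, a p.1 * c p.2) * h ^ j
      - (∑ i ∈ Finset.range M, a i * h ^ i) * ∑ k ∈ Finset.range N, c k * h ^ k|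
      ≤ (∑ i ∈ Finset.range M, |a i|) * N * B * H ^ M * h ^ N := by
  set S := Finset.range M ×ˢ Finset.range N with hS
  set t : ℕ × ℕ → ℝ := fun p => a p.1 * c p.2 * h ^ (p.1 + p.2) with ht
  have h1 : (∑ i ∈ Finset.range M, a i * h ^ i) * ∑ k ∈ Finset.range N, c k * h ^ k
      = ∑ p ∈ S, t p := by
    rw [Finset.sum_mul_sum, ← Finset.sum_product']
    refine Finset.sum_congr rfl fun p _ => ?_
    simp only [ht, pow_add]
    ring
  have h2 : ∑ j ∈ Finset.range N,
      (∑ p ∈ Finset.HasAntidiagonal.antidiagonal j, a p.1 * c p.2) * h ^ j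
      = ∑ p ∈ S with p.1 + p.2 < N, t p := by
    rw [← Finset.sum_fiberwise_of_maps_to (s := {p ∈ S | p.1 + p.2 < N}) (t := Finset.range N)
      (g := fun p => p.1 + p.2) (fun p hp => Finset.mem_range.2 (Finset.mem_filter.1 hp).2)]
    refine Finset.sum_congr rfl fun j hj => ?_
    rw [Finset.sum_mul]
    have h3 : Finset.HasAntidiagonal.antidiagonal j
        = {p ∈ ({p ∈ S | p.1 + p.2 < N} : Finset (ℕ × ℕ)) | p.1 + p.2 = j} := by
      ext p
      have := Finset.mem_range.1 hj
      simp only [Finset.HasAntidiagonal.mem_antidiagonal, Finset.mem_filter, hS,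
        Finset.mem_product, Finset.mem_range]
      omega
    rw [h3]
    refine Finset.sum_congr rfl fun p hp => ?_
    simp only [ht, (Finset.mem_filter.1 hp).2]
  rw [h1, h2, ← Finset.sum_filter_add_sum_filter_not S (fun p => p.1 + p.2 < N) t,
    sub_add_cancel_left, abs_neg]
  have h4 : ∀ p ∈ S, ¬ p.1 + p.2 < N → |t p| ≤ |a p.1| * (B * (H ^ M * h ^ N)) := by
    intro p hp hpN
    rw [hS, Finset.mem_product, Finset.mem_range, Finset.mem_range] at hp
    have h5 : p.1 + p.2 = (p.1 + p.2 - N) + N := by omega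
    have h6 : h ^ (p.1 + p.2) ≤ H ^ M * h ^ N := by
      rw [h5, pow_add]
      refine mul_le_mul_of_nonneg_right ?_ (by positivity)
      exact (pow_le_pow_left₀ h0 hH _).trans (pow_le_pow_right₀ hH1 (by omega))
    rw [ht]
    simp only
    rw [abs_mul, abs_mul, abs_of_nonneg (pow_nonneg h0 _), mul_assoc]
    exact mul_le_mul_of_nonneg_left (mul_le_mul (hB _ hp.2) h6 (by positivity) hB0) (abs_nonneg _)
  refine (Finset.abs_sum_le_sum_abs _ _).trans ?_
  refine (Finset.sum_le_sum fun p hp => h4 p (Finset.mem_filter.1 hp).1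
    (Finset.mem_filter.1 hp).2).trans ?_
  have hHpos : 0 ≤ H := by linarith
  refine (Finset.sum_le_sum_of_subset_of_nonneg (Finset.filter_subset _ _)
    fun p _ _ => by positivity).trans (le_of_eq ?_)
  rw [hS, Finset.sum_product]
  simp only [Finset.sum_const, Finset.card_range, nsmul_eq_mul]
  rw [← Finset.mul_sum, ← Finset.sum_mul]
  ring

/-! ### The cutoff term -/

lemma exists_exp_bound_of_compactSupport {X : ℝ → ℝ} (hX : Continuous X)
    (hs : HasCompactSupport X) : ∃ C : ℝ, 0 ≤ C ∧ ∀ s, |X s| ≤ C * Real.exp (-(s / 2)) := by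
  obtain ⟨C, hC⟩ := (hX.mul (by fun_prop : Continuous fun s : ℝ => Real.exp (s / 2))
    ).bounded_above_of_compact_support (hs.mul_right (f' := fun s : ℝ => Real.exp (s / 2)))
  refine ⟨C, (norm_nonneg _).trans (hC 0), fun s => ?_⟩
  have h1 := hC s
  rw [Pi.mul_apply, Real.norm_eq_abs, abs_mul, Real.abs_exp] at h1
  rw [Real.exp_neg, ← div_eq_mul_inv, le_div_iff₀ (Real.exp_pos _)]
  exact h1

lemma IsCutoff.exists_corrector {χ : ℝ → ℝ} (hχ : IsCutoff χ) : ∃ X₁ X₂ : ℝ → ℝ,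
    (∀ s, HasDerivAt (fun s => s * χ s) (X₁ s) s) ∧ (∀ s, HasDerivAt X₁ (X₂ s) s) ∧
    Continuous X₂ ∧ X₁ 0 = 1 ∧ ∃ C : ℝ, 0 ≤ C ∧
      (∀ s, |s * χ s| ≤ C * Real.exp (-(s / 2))) ∧ ∀ s, |X₂ s| ≤ C * Real.exp (-(s / 2)) := by
  set X : ℝ → ℝ := fun s => s * χ s with hX
  have hXs : ContDiff ℝ ∞ X := contDiff_id.mul hχ.smooth
  have hX1 : ContDiff ℝ ∞ (deriv X) := (contDiff_infty_iff_deriv.1 hXs).2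
  have hX2 : ContDiff ℝ ∞ (deriv (deriv X)) := (contDiff_infty_iff_deriv.1 hX1).2
  have hXc : HasCompactSupport X := hχ.compact.mul_left
  obtain ⟨C, hC0, hC⟩ := exists_exp_bound_of_compactSupport hXs.continuous hXc
  obtain ⟨D, hD0, hD⟩ := exists_exp_bound_of_compactSupport hX2.continuous hXc.deriv.deriv
  refine ⟨deriv X, deriv (deriv X), fun s => (hXs.differentiable (by simp) s).hasDerivAt,
    fun s => (hX1.differentiable (by simp) s).hasDerivAt, hX2.continuous, ?_, max C D,
    hC0.trans (le_max_left _ _), fun s => (hC s).trans ?_, fun s => (hD s).trans ?_⟩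
  · refine HasDerivAt.deriv ((hasDerivAt_id (0 : ℝ)).congr_of_eventuallyEq ?_)
    filter_upwards [hχ.eq_one] with s hs
    simp [hX, hs]
  · exact mul_le_mul_of_nonneg_right (le_max_left _ _) (Real.exp_pos _).le
  · exact mul_le_mul_of_nonneg_right (le_max_right _ _) (Real.exp_pos _).le

/-! ### Two-scale bounds -/

lemma norm_glue_two_scale_le {L R : ℝ → ℝ} {h H E : ℝ} (h0 : 0 < h) (hH : h ≤ H) (hH1 : 1 ≤ H)
    (hE : 0 ≤ E) (hL : ∀ z ≤ 0, |L z| ≤ E * Real.exp (z / h ^ 2))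
    (hR : ∀ z, 0 < z → |R z| ≤ E * Real.exp (-(z / h ^ 3 / 2))) (z : ℝ) :
    ‖glue L R z‖ ≤ E * Real.exp (-(1 / (2 * H * h ^ 2) * |z|)) := by
  have hHpos : 0 < H := by linarith
  refine norm_glue_le (fun z hz => (hL z hz).trans ?_) (fun z hz => (hR z hz).trans ?_) z
  · refine mul_le_mul_of_nonneg_left (Real.exp_le_exp.2 ?_) hE
    have h1 : 1 / (2 * H * h ^ 2) ≤ 1 / h ^ 2 := by
      refine one_div_le_one_div_of_le (by positivity) ?_
      nlinarith [sq_nonneg h]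
    have h2 := mul_le_mul_of_nonpos_right h1 hz
    have h3 : z / h ^ 2 = 1 / h ^ 2 * z := by ring
    linarith
  · refine mul_le_mul_of_nonneg_left (Real.exp_le_exp.2 ?_) hE
    have h1 : 1 / (2 * H * h ^ 2) ≤ 1 / (2 * h ^ 3) := by
      refine one_div_le_one_div_of_le (by positivity) ?_
      nlinarith [mul_nonneg (sub_nonneg.2 hH) (sq_nonneg h)]
    have h2 := mul_le_mul_of_nonneg_right h1 hz.le
    have h3 : z / h ^ 3 / 2 = 1 / (2 * h ^ 3) * z := by
      field_simp
    linarith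

lemma eLpNorm_glue_two_scale_le {L R : ℝ → ℝ} {h H E : ℝ} (h0 : 0 < h) (hH : h ≤ H) (hH1 : 1 ≤ H)
    (hE : 0 ≤ E) (hL : ∀ z ≤ 0, |L z| ≤ E * Real.exp (z / h ^ 2))
    (hR : ∀ z, 0 < z → |R z| ≤ E * Real.exp (-(z / h ^ 3 / 2))) :
    eLpNorm (glue L R) 2 volume ≤ ENNReal.ofReal (E * Real.sqrt (2 * H) * h) := by
  have hHpos : 0 < H := by linarith
  refine (eLpNorm_le_of_exp_decay hE (by positivity)
    (norm_glue_two_scale_le h0 hH hH1 hE hL hR)).trans_eq ?_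
  congr 1
  rw [Real.sqrt_div zero_le_one, Real.sqrt_one, Real.sqrt_mul (by positivity), Real.sqrt_sq h0.le]
  field_simp

lemma memLp_glue_two_scale {L R : ℝ → ℝ} {h H E : ℝ} (h0 : 0 < h) (hH : h ≤ H) (hH1 : 1 ≤ H)
    (hE : 0 ≤ E) (hLc : Continuous L) (hRc : Continuous R)
    (hL : ∀ z ≤ 0, |L z| ≤ E * Real.exp (z / h ^ 2))
    (hR : ∀ z, 0 < z → |R z| ≤ E * Real.exp (-(z / h ^ 3 / 2))) :
    MemLp (glue L R) 2 volume := by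
  have hHpos : 0 < H := by linarith
  exact memLp_of_exp_decay (measurable_glue hLc hRc).aestronglyMeasurable (by positivity)
    (norm_glue_two_scale_le h0 hH hH1 hE hL hR)

/-! ### Quasimodes -/

/-- The truncated sum of the `k`-th derivatives of the left profiles. -/
def leftSum (c r : ℝ) (ℓ : ℂ → ℂ) (N : ℕ) (h : ℝ) (k : ℕ) (s : ℝ) : ℝ :=
  ∑ j ∈ Finset.range N, leftProfile c r ℓ k j s * h ^ j

/-- The truncated sum of the `k`-th derivatives of the right profiles. -/
def rightSum (c r : ℝ) (ℓ b : ℂ → ℂ) (N : ℕ) (h : ℝ) (k : ℕ) (s : ℝ) : ℝ :=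
  ∑ j ∈ Finset.range N, rightProfile c r ℓ b k j s * h ^ j

lemma IsBranch.hasDerivAt_leftSum (hB : IsBranch n α r ℓ b) (c : ℝ) (N : ℕ) (h : ℝ) (k : ℕ)
    (s : ℝ) : HasDerivAt (leftSum c r ℓ N h k) (leftSum c r ℓ N h (k + 1) s) s :=
  HasDerivAt.fun_sum fun j _ => (hB.hasDerivAt_leftProfile c k j s).mul_const (h ^ j)

lemma IsBranch.hasDerivAt_rightSum (hB : IsBranch n α r ℓ b) (c : ℝ) (N : ℕ) (h : ℝ) (k : ℕ)
    (s : ℝ) : HasDerivAt (rightSum c r ℓ b N h k) (rightSum c r ℓ b N h (k + 1) s) s :=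
  HasDerivAt.fun_sum fun j _ => (hB.hasDerivAt_rightProfile c k j s).mul_const (h ^ j)

lemma IsBranch.continuous_leftSum (hB : IsBranch n α r ℓ b) (c : ℝ) (N : ℕ) (h : ℝ) (k : ℕ) :
    Continuous (leftSum c r ℓ N h k) :=
  continuous_iff_continuousAt.2 fun s => (hB.hasDerivAt_leftSum c N h k s).continuousAt

lemma IsBranch.continuous_rightSum (hB : IsBranch n α r ℓ b) (c : ℝ) (N : ℕ) (h : ℝ) (k : ℕ) :
    Continuous (rightSum c r ℓ b N h k) :=
  continuous_iff_continuousAt.2 fun s => (hB.hasDerivAt_rightSum c N h k s).continuousAt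

lemma IsBranch.exists_uniform_profile_bound (hB : IsBranch n α r ℓ b) (c : ℝ) (N : ℕ) :
    ∃ M : ℝ, 0 ≤ M ∧ (∀ j < N, ∀ s, |leftProfile c r ℓ 0 j s| ≤ M * Real.exp s) ∧
    ∀ j < N, ∀ s, 0 ≤ s → |rightProfile c r ℓ b 0 j s| ≤ M * Real.exp (-(s / 2)) := by
  obtain ⟨M, hM0, h1, h2⟩ := hB.exists_profile_bound c
  have hq : ∀ j < N, r⁻¹ ^ j ≤ max 1 r⁻¹ ^ N := fun j hj =>
    (pow_le_pow_left₀ (inv_pos.2 hB.r_pos).le (le_max_right _ _) j).trans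
      (pow_le_pow_right₀ (le_max_left _ _) hj.le)
  refine ⟨M * max 1 r⁻¹ ^ N, by positivity, fun j hj s => (h1 j s).trans ?_,
    fun j hj s hs => (h2 j s hs).trans ?_⟩
  · rw [mul_right_comm M (max 1 r⁻¹ ^ N)]
    exact mul_le_mul_of_nonneg_left (hq j hj) (by positivity)
  · rw [mul_right_comm M (max 1 r⁻¹ ^ N)]
    exact mul_le_mul_of_nonneg_left (hq j hj) (by positivity)

lemma abs_truncated_sum_le {a : ℕ → ℝ} {N : ℕ} {B h H : ℝ} (hB : ∀ k < N, |a k| ≤ B)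
    (hB0 : 0 ≤ B) (h0 : 0 ≤ h) (hH : h ≤ H) (hH1 : 1 ≤ H) :
    |∑ j ∈ Finset.range N, a j * h ^ j| ≤ N * B * H ^ N := by
  have h1 : ∀ j ∈ Finset.range N, |a j * h ^ j| ≤ B * H ^ N := fun j hj => by
    have hj' := Finset.mem_range.1 hj
    rw [abs_mul, abs_of_nonneg (pow_nonneg h0 j)]
    exact mul_le_mul (hB j hj') ((pow_le_pow_left₀ h0 hH j).trans
      (pow_le_pow_right₀ hH1 hj'.le)) (by positivity) hB0
  refine (Finset.abs_sum_le_sum_abs _ _).trans ((Finset.sum_le_sum h1).trans_eq ?_)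
  rw [Finset.sum_const, Finset.card_range, nsmul_eq_mul, mul_assoc]

/-- The residual on the left, in the variable `s = z / h²` and divided by `h²`. -/
lemma IsBranch.exists_left_residual_bound (hB : IsBranch n α r ℓ b) (c : ℝ) (N : ℕ) {H : ℝ}
    (hH1 : 1 ≤ H) : ∃ C : ℝ, 0 ≤ C ∧ ∀ h, 0 ≤ h → h ≤ H → ∀ s,
      |-leftSum c r ℓ N h 2 s - s * leftSum c r ℓ N h 0 s
        - (∑ i ∈ Finset.range N, α i * h ^ i) * leftSum c r ℓ N h 0 s|
        ≤ C * h ^ N * Real.exp s := by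
  obtain ⟨M, hM0, hM, -⟩ := hB.exists_uniform_profile_bound c N
  refine ⟨(∑ i ∈ Finset.range N, |α i|) * N * M * H ^ N, by positivity, fun h h0 hH s => ?_⟩
  have key := abs_truncated_mul_sub_le (a := α) (c := fun j => leftProfile c r ℓ 0 j s)
    (fun k hk => hM k hk s) (by positivity) h0 hH hH1 le_rfl
  have h1 : -leftSum c r ℓ N h 2 s - s * leftSum c r ℓ N h 0 s
      = ∑ j ∈ Finset.range N, (∑ p ∈ Finset.HasAntidiagonal.antidiagonal j,
        α p.1 * leftProfile c r ℓ 0 p.2 s) * h ^ j := by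
    unfold leftSum
    rw [Finset.mul_sum, ← Finset.sum_neg_distrib, ← Finset.sum_sub_distrib]
    refine Finset.sum_congr rfl fun j _ => ?_
    rw [hB.leftProfile_two]
    ring
  rw [h1]
  exact key.trans_eq (by ring)

/-- The residual on the right without the cutoff term, in the variable `σ = z / h³`. -/
lemma IsBranch.exists_right_residual_bound (hB : IsBranch n α r ℓ b) (c : ℝ) (N : ℕ) {H : ℝ}
    (hH1 : 1 ≤ H) : ∃ C : ℝ, 0 ≤ C ∧ ∀ h, 0 ≤ h → h ≤ H → ∀ s, 0 ≤ s →
      |-rightSum c r ℓ b N h 2 s + rightSum c r ℓ b N h 0 s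
        - h ^ 2 * (∑ i ∈ Finset.range N, α i * h ^ i) * rightSum c r ℓ b N h 0 s|
        ≤ C * h ^ N * Real.exp (-(s / 2)) := by
  obtain ⟨M, hM0, -, hM⟩ := hB.exists_uniform_profile_bound c N
  refine ⟨(∑ i ∈ Finset.range (N + 2), |shiftCoeff 2 α i|) * N * M * H ^ (N + 2), by positivity,
    fun h h0 hH s hs => ?_⟩
  have key := abs_truncated_mul_sub_le (a := shiftCoeff 2 α)
    (c := fun j => rightProfile c r ℓ b 0 j s) (M := N + 2)
    (fun k hk => hM k hk s hs) (by positivity) h0 hH hH1 (Nat.le_add_right N 2)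
  have h1 : -rightSum c r ℓ b N h 2 s + rightSum c r ℓ b N h 0 s
      = ∑ j ∈ Finset.range N, (∑ p ∈ Finset.HasAntidiagonal.antidiagonal j,
        shiftCoeff 2 α p.1 * rightProfile c r ℓ b 0 p.2 s) * h ^ j := by
    unfold rightSum
    rw [← Finset.sum_neg_distrib, ← Finset.sum_add_distrib]
    refine Finset.sum_congr rfl fun j _ => ?_
    rw [hB.rightProfile_two]
    ring
  have h2 : h ^ 2 * (∑ i ∈ Finset.range N, α i * h ^ i)
      = ∑ i ∈ Finset.range (N + 2), shiftCoeff 2 α i * h ^ i := by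
    have h3 : ∀ i, shiftCoeff 2 α (i + 1 + 1) = α i := fun i => by simp [shiftCoeff]
    have h4 : shiftCoeff 2 α (0 + 1) = 0 := by simp [shiftCoeff]
    have h5 : shiftCoeff 2 α 0 = 0 := by simp [shiftCoeff]
    rw [Finset.sum_range_succ', Finset.sum_range_succ', Finset.mul_sum, h4, h5]
    simp_rw [h3]
    rw [zero_mul, zero_mul, add_zero, add_zero]
    exact Finset.sum_congr rfl fun i _ => by ring
  rw [h1, h2]
  exact key.trans_eq (by ring)

lemma rpow_cube_div_three {h : ℝ} (hh : 0 < h) (j : ℕ) :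
    (h ^ 3) ^ ((j : ℝ) / 3) = h ^ j := by
  rw [← Real.rpow_natCast h 3, ← Real.rpow_mul hh.le, ← Real.rpow_natCast h j]
  congr 1
  push_cast
  ring

lemma rpow_cube_two_thirds {h : ℝ} (hh : 0 < h) : (h ^ 3) ^ (2 / 3 : ℝ) = h ^ 2 := by
  exact_mod_cast rpow_cube_div_three hh 2

lemma exists_eq_cube {κ : ℝ} (hκ : 0 < κ) : ∃ h : ℝ, 0 < h ∧ κ = h ^ 3 :=
  ⟨κ ^ (1 / 3 : ℝ), by positivity, by
    rw [← Real.rpow_natCast, ← Real.rpow_mul hκ.le]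
    norm_num⟩

lemma quasiEigenvalue_cube (α : ℕ → ℝ) (J : ℕ) {h : ℝ} (hh : 0 < h) :
    quasiEigenvalue α J (h ^ 3) = h ^ 2 * ∑ j ∈ Finset.range (J + 3), α j * h ^ j := by
  unfold quasiEigenvalue
  rw [rpow_cube_two_thirds hh]
  simp_rw [rpow_cube_div_three hh]

lemma IsBranch.quasimode_cube (hB : IsBranch n α r ℓ b) (c : ℝ) (χ : ℝ → ℝ) (J : ℕ) {h : ℝ}
    (hh : 0 < h) (z : ℝ) :
    (quasimode (leftProfile c r ℓ 0) (rightProfile c r ℓ b 0) χ J (h ^ 3) z : ℂ)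
      = glue (fun z => leftSum c r ℓ (J + 3) h 0 (z / h ^ 2))
        (fun z => rightSum c r ℓ b (J + 3) h 0 (z / h ^ 3) +
          leftProfile c r ℓ 1 (J + 2) 0 * h ^ (J + 3) * (z / h ^ 3 * χ (z / h ^ 3))) z := by
  unfold quasimode glue leftSum rightSum
  rw [rpow_cube_two_thirds hh, (hB.hasDerivAt_leftProfile c 0 (J + 2) 0).deriv]
  simp_rw [rpow_cube_div_three hh]
  congr 3
  rw [zero_add]
  field_simp
  ring

lemma hasDerivAt_comp_div {f : ℝ → ℝ} {f' m z : ℝ} (hf : HasDerivAt f f' (z / m)) :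
    HasDerivAt (fun z => f (z / m)) (f' / m) z :=
  (hf.comp z ((hasDerivAt_id z).div_const m)).congr_deriv (by ring)

set_option maxHeartbeats 600000 in
/-- The quasimode estimate, in the variable `h = κ ^ (1 / 3)`. The value and the derivative at `0`
match by the relations between the profiles at `0`, so the quasimode lies in the domain; by the
profile equations the residual consists of terms of order at least `J + 3`. -/
lemma IsBranch.exists_quasimode_bound (hB : IsBranch n α r ℓ b) (c : ℝ) (J : ℕ) {χ : ℝ → ℝ}
    (hχ : IsCutoff χ) {H : ℝ} (hH1 : 1 ≤ H) : ∃ C : ℝ, ∀ h : ℝ, 0 < h → h ≤ H →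
      ∃ q : (Htoy (h ^ 3)).domain, ((q : L2) : ℝ → ℂ) =ᵐ[volume]
        (fun z => (quasimode (leftProfile c r ℓ 0) (rightProfile c r ℓ b 0) χ J (h ^ 3) z : ℂ)) ∧
        ‖Htoy (h ^ 3) q - (quasiEigenvalue α J (h ^ 3) : ℂ) • (q : L2)‖ ≤ C * h ^ (J + 3) := by
  set N := J + 3 with hN
  set d := leftProfile c r ℓ 1 (J + 2) 0 with hd
  obtain ⟨X₁, X₂, hX, hX₁, hX₂, hX0, D, hD0, hXD, hX₂D⟩ := hχ.exists_corrector
  obtain ⟨M, hM0, hMl, hMr⟩ := hB.exists_uniform_profile_bound c N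
  obtain ⟨C₁, hC₁0, hC₁⟩ := hB.exists_left_residual_bound c N hH1
  obtain ⟨C₂, hC₂0, hC₂⟩ := hB.exists_right_residual_bound c N hH1
  set A := ∑ i ∈ Finset.range N, |α i| with hA
  have hA0 : 0 ≤ A := Finset.sum_nonneg fun i _ => abs_nonneg _
  have hHpos : 0 < H := by linarith
  set E₁ := H ^ 2 * C₁ + (C₂ + |d| * (D + D + H ^ 2 * (N * A * H ^ N) * D)) with hE₁
  have hE₁0 : 0 ≤ E₁ := by positivity
  refine ⟨E₁ * Real.sqrt (2 * H) * H, fun h hh hH => ?_⟩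
  set Λ := ∑ i ∈ Finset.range N, α i * h ^ i with hΛ
  have hΛb : |Λ| ≤ N * A * H ^ N := abs_truncated_sum_le
    (fun k hk => Finset.single_le_sum (f := fun i => |α i|) (fun i _ => abs_nonneg _)
      (Finset.mem_range.2 hk)) hA0 hh.le hH hH1
  have hhN : 0 ≤ h ^ N := by positivity
  have hh2 : h ^ 2 ≤ H ^ 2 := pow_le_pow_left₀ hh.le hH 2
  set P := leftSum c r ℓ N h with hP
  set Q := rightSum c r ℓ b N h with hQ
  have hPd : ∀ k s, HasDerivAt (P k) (P (k + 1) s) s := hB.hasDerivAt_leftSum c N h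
  have hQd : ∀ k s, HasDerivAt (Q k) (Q (k + 1) s) s := hB.hasDerivAt_rightSum c N h
  have hPc : ∀ k, Continuous (P k) := hB.continuous_leftSum c N h
  have hQc : ∀ k, Continuous (Q k) := hB.continuous_rightSum c N h
  have hXc : Continuous fun s => s * χ s :=
    continuous_iff_continuousAt.2 fun s => (hX s).continuousAt
  set L : ℝ → ℝ := fun z => P 0 (z / h ^ 2) with hL
  set R : ℝ → ℝ := fun z => Q 0 (z / h ^ 3) + d * h ^ N * (z / h ^ 3 * χ (z / h ^ 3)) with hR
  have hLc : Continuous L := (hPc 0).comp (by fun_prop)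
  have hRc : Continuous R := ((hQc 0).comp (by fun_prop)).add
    ((hXc.comp (by fun_prop : Continuous fun z : ℝ => z / h ^ 3)).const_mul _)
  set resL : ℝ → ℝ := fun z => h ^ 2 * (-P 2 (z / h ^ 2) - z / h ^ 2 * P 0 (z / h ^ 2)
    - Λ * P 0 (z / h ^ 2)) with hresL
  set resR : ℝ → ℝ := fun z => (-Q 2 (z / h ^ 3) + Q 0 (z / h ^ 3) - h ^ 2 * Λ * Q 0 (z / h ^ 3))
    + d * h ^ N * (-X₂ (z / h ^ 3) + z / h ^ 3 * χ (z / h ^ 3)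
      - h ^ 2 * Λ * (z / h ^ 3 * χ (z / h ^ 3))) with hresR
  have hs2 : Continuous fun z : ℝ => z / h ^ 2 := by fun_prop
  have hs3 : Continuous fun z : ℝ => z / h ^ 3 := by fun_prop
  have hresLc : Continuous resL :=
    ((((hPc 2).comp hs2).neg.sub (hs2.mul ((hPc 0).comp hs2))).sub
      (((hPc 0).comp hs2).const_mul Λ)).const_mul (h ^ 2)
  have hresRc : Continuous resR :=
    ((((hQc 2).comp hs3).neg.add ((hQc 0).comp hs3)).sub
      (((hQc 0).comp hs3).const_mul (h ^ 2 * Λ))).add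
      ((((hX₂.comp hs3).neg.add (hXc.comp hs3)).sub
        ((hXc.comp hs3).const_mul (h ^ 2 * Λ))).const_mul (d * h ^ N))
  have hLb : ∀ z ≤ 0, |L z| ≤ (N * M * H ^ N + |d| * H ^ N * D) * Real.exp (z / h ^ 2) := by
    intro z _
    have h1 : |L z| ≤ N * (M * Real.exp (z / h ^ 2)) * H ^ N :=
      abs_truncated_sum_le (fun k hk => hMl k hk _) (by positivity) hh.le hH hH1
    have h2 : 0 ≤ |d| * H ^ N * D * Real.exp (z / h ^ 2) := by positivity
    linarith
  have hRb : ∀ z, 0 < z →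
      |R z| ≤ (N * M * H ^ N + |d| * H ^ N * D) * Real.exp (-(z / h ^ 3 / 2)) := by
    intro z hz
    have h1 : |Q 0 (z / h ^ 3)| ≤ N * (M * Real.exp (-(z / h ^ 3 / 2))) * H ^ N :=
      abs_truncated_sum_le (fun k hk => hMr k hk _ (by positivity)) (by positivity) hh.le hH hH1
    have h2 : |d * h ^ N * (z / h ^ 3 * χ (z / h ^ 3))|
        ≤ |d| * H ^ N * (D * Real.exp (-(z / h ^ 3 / 2))) := by
      rw [abs_mul, abs_mul, abs_of_nonneg hhN]
      exact mul_le_mul (mul_le_mul_of_nonneg_left (pow_le_pow_left₀ hh.le hH N) (abs_nonneg _))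
        (hXD _) (abs_nonneg _) (by positivity)
    refine (abs_add_le _ _).trans ((add_le_add h1 h2).trans_eq (by ring))
  have hresLb : ∀ z ≤ 0, |resL z| ≤ E₁ * h ^ N * Real.exp (z / h ^ 2) := by
    intro z _
    have h1 := hC₁ h hh.le hH (z / h ^ 2)
    rw [hresL]
    simp only
    rw [abs_mul, abs_of_nonneg (by positivity : (0 : ℝ) ≤ h ^ 2)]
    refine (mul_le_mul hh2 h1 (abs_nonneg _) (by positivity)).trans ?_
    rw [← mul_assoc, ← mul_assoc]
    refine mul_le_mul_of_nonneg_right (mul_le_mul_of_nonneg_right ?_ hhN) (Real.exp_pos _).le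
    rw [hE₁]
    have : 0 ≤ C₂ + |d| * (D + D + H ^ 2 * (N * A * H ^ N) * D) := by positivity
    linarith
  have hresRb : ∀ z, 0 < z → |resR z| ≤ E₁ * h ^ N * Real.exp (-(z / h ^ 3 / 2)) := by
    intro z hz
    set e := Real.exp (-(z / h ^ 3 / 2)) with he
    have he0 : 0 < e := Real.exp_pos _
    have h1 := hC₂ h hh.le hH (z / h ^ 3) (by positivity)
    have h2 : |-X₂ (z / h ^ 3) + z / h ^ 3 * χ (z / h ^ 3)
        - h ^ 2 * Λ * (z / h ^ 3 * χ (z / h ^ 3))|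
        ≤ D * e + D * e + H ^ 2 * (N * A * H ^ N) * (D * e) := by
      refine (abs_sub _ _).trans (add_le_add ((abs_add_le _ _).trans (add_le_add ?_ (hXD _))) ?_)
      · rw [abs_neg]
        exact hX₂D _
      · rw [abs_mul, abs_mul, abs_of_nonneg (by positivity : (0 : ℝ) ≤ h ^ 2)]
        exact mul_le_mul (mul_le_mul hh2 hΛb (abs_nonneg _) (by positivity)) (hXD _)
          (abs_nonneg _) (by positivity)
    have h3 : |d * h ^ N * (-X₂ (z / h ^ 3) + z / h ^ 3 * χ (z / h ^ 3)
        - h ^ 2 * Λ * (z / h ^ 3 * χ (z / h ^ 3)))|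
        ≤ |d| * h ^ N * (D * e + D * e + H ^ 2 * (N * A * H ^ N) * (D * e)) := by
      rw [abs_mul, abs_mul, abs_of_nonneg hhN]
      exact mul_le_mul_of_nonneg_left h2 (by positivity)
    have h4 : 0 ≤ H ^ 2 * C₁ * h ^ N * e := by positivity
    refine (abs_add_le _ _).trans ((add_le_add h1 h3).trans ?_)
    rw [hE₁]
    linarith
  have hqm : MemLp (glue L R) 2 volume :=
    memLp_glue_two_scale hh hH hH1 (by positivity) hLc hRc hLb hRb
  have hrm : MemLp (glue resL resR) 2 volume :=
    memLp_glue_two_scale hh hH hH1 (by positivity) hresLc hresRc hresLb hresRb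
  have hrel : ToyRel (h ^ 3) (hqm.toLp _)
      (hrm.toLp _ + ((h ^ 2 * Λ : ℝ) : ℂ) • hqm.toLp _) := by
    refine toyRel_glue (L := L) (R := R) (L' := fun z => P 1 (z / h ^ 2) / h ^ 2)
      (L'' := fun z => P 2 (z / h ^ 2) / h ^ 2 / h ^ 2)
      (R' := fun z => Q 1 (z / h ^ 3) / h ^ 3 + d * h ^ N * (X₁ (z / h ^ 3) / h ^ 3))
      (R'' := fun z => Q 2 (z / h ^ 3) / h ^ 3 / h ^ 3
        + d * h ^ N * (X₂ (z / h ^ 3) / h ^ 3 / h ^ 3))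
      (fun z => hasDerivAt_comp_div (hPd 0 _))
      (fun z => (hasDerivAt_comp_div (hPd 1 _)).div_const _)
      ((((hPc 2).comp (by fun_prop)).div_const _).div_const _)
      (fun z => (hasDerivAt_comp_div (hQd 0 _)).add
        ((hasDerivAt_comp_div (f := fun s => s * χ s) (hX _)).const_mul _))
      (fun z => ((hasDerivAt_comp_div (hQd 1 _)).div_const _).add
        (((hasDerivAt_comp_div (hX₁ _)).div_const _).const_mul _))
      (((((hQc 2).comp (by fun_prop)).div_const _).div_const _).add
        ((((hX₂.comp (by fun_prop)).div_const _).div_const _).const_mul _))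
      ?_ ?_ hqm.coeFn_toLp ?_
    · simp only [hL, hR, zero_div, zero_mul, mul_zero, add_zero]
      exact Finset.sum_congr rfl fun j _ => by rw [hB.leftProfile_at_zero]
    · simp only [zero_div, hX0]
      -- the cutoff term supplies the derivative of order `N`, which the right sum lacks
      have h1 : Q 1 0 + d * h ^ N = h * P 1 0 := by
        simp only [hQ, hP, rightSum, leftSum]
        simp_rw [hB.rightProfile_one_at_zero]
        have h2 : d = shiftCoeff 1 (fun i => leftProfile c r ℓ 1 i 0) N := by
          simp [shiftCoeff, hN, hd]
        have h4 : ∀ j, shiftCoeff 1 (fun i => leftProfile c r ℓ 1 i 0) (j + 1)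
            = leftProfile c r ℓ 1 j 0 := fun j => by simp [shiftCoeff]
        have h5 : shiftCoeff 1 (fun i => leftProfile c r ℓ 1 i 0) 0 = 0 := by simp [shiftCoeff]
        rw [h2, ← Finset.sum_range_succ (fun j => shiftCoeff 1 (fun i => leftProfile c r ℓ 1 i 0) j
          * h ^ j) N, Finset.sum_range_succ', Finset.mul_sum, h5, zero_mul, add_zero]
        simp_rw [h4]
        exact Finset.sum_congr rfl fun j _ => by ring
      have h3 : P 1 0 / h ^ 2 = (Q 1 0 + d * h ^ N) / h ^ 3 := by
        rw [h1]
        field_simp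
      rw [h3]
      ring
    · filter_upwards [Lp.coeFn_add (hrm.toLp _) (((h ^ 2 * Λ : ℝ) : ℂ) • hqm.toLp _),
        Lp.coeFn_smul ((h ^ 2 * Λ : ℝ) : ℂ) (hqm.toLp _), hqm.coeFn_toLp, hrm.coeFn_toLp]
        with z h1 h2 h3 h4
      rw [h1, Pi.add_apply, h2, Pi.smul_apply, h3, h4, smul_eq_mul]
      unfold glue
      rw [← Complex.ofReal_mul, ← Complex.ofReal_add]
      congr 1
      split_ifs
      · simp only [hresL, hL]
        field_simp
        ring
      · simp only [hresR, hR]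
        field_simp
        ring
  obtain ⟨q, hq, hHq⟩ := (toyRel_iff_mem_domain _ _ _).1 hrel
  refine ⟨q, ?_, ?_⟩
  · rw [hq]
    filter_upwards [hqm.coeFn_toLp] with z hz
    rw [hz, hB.quasimode_cube c χ J hh]
  · rw [hHq, hq, quasiEigenvalue_cube α J hh, ← hN, ← hΛ, add_sub_cancel_right, Lp.norm_toLp]
    have h1 := eLpNorm_glue_two_scale_le hh hH hH1 (by positivity) hresLb hresRb
    refine (ENNReal.toReal_le_of_le_ofReal (by positivity) h1).trans ?_
    calc E₁ * h ^ N * Real.sqrt (2 * H) * h = E₁ * Real.sqrt (2 * H) * h ^ N * h := by ring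
      _ ≤ E₁ * Real.sqrt (2 * H) * h ^ N * H := by gcongr
      _ = _ := by ring

/-! ### Expansion of the eigenfunctions -/

/-- The Taylor remainders in `h` bound the distance of the exact eigenfunction to the quasimode. The
remainder and the cutoff term are `O (h ^ (J + 3))` pointwise, and the change of scale gives one more
factor `h` in the norm. -/
lemma IsBranch.exists_eigenfunction_bound (hB : IsBranch n α r ℓ b) (c : ℝ) (J : ℕ) {χ : ℝ → ℝ}
    (hχ : IsCutoff χ) : ∃ C : ℝ, ∀ h : ℝ, 0 < h → h ≤ r / 2 →
      eLpNorm (fun z => (c : ℂ) * glue (eigLeft h (ℓ h).re) (eigRight h (ℓ h).re) z -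
        (quasimode (leftProfile c r ℓ 0) (rightProfile c r ℓ b 0) χ J (h ^ 3) z : ℂ)) 2 volume
        ≤ ENNReal.ofReal (C * h ^ (J + 4)) := by
  set N := J + 3 with hN
  set d := leftProfile c r ℓ 1 (J + 2) 0 with hd
  obtain ⟨-, -, -, -, -, -, D, hD0, hXD, -⟩ := hχ.exists_corrector
  obtain ⟨M, hM0, hMl, hMr⟩ := hB.exists_bound c
  set H := max 1 r with hHdef
  have hH1 : 1 ≤ H := le_max_left _ _
  have hr := hB.r_pos
  set E := 2 * M * r⁻¹ ^ N + |d| * D with hE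
  have hE0 : 0 ≤ E := by positivity
  refine ⟨E * Real.sqrt (2 * H), fun h hh hhr => ?_⟩
  have hH : h ≤ H := by linarith [le_max_right 1 r]
  have habs : |h| = h := abs_of_pos hh
  have hhr' : |h| ≤ r := by linarith
  set l := (ℓ h).re with hl
  have hL : ∀ z ≤ 0, |c * eigLeft h l z - leftSum c r ℓ N h 0 (z / h ^ 2)|
      ≤ E * h ^ N * Real.exp (z / h ^ 2) := by
    intro z _
    have h1 := abs_sub_taylorRe_sum_le hr ((hB.holomorphic_left c).diff 0 (z / h ^ 2))
      (fun w hw => hMl w (Metric.sphere_subset_closedBall hw) (z / h ^ 2))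
      (h := h) (by linarith) N
    rw [hB.left_re c hhr', habs] at h1
    refine h1.trans ?_
    have h2 : 0 ≤ |d| * D * h ^ N * Real.exp (z / h ^ 2) := by positivity
    have h3 : (h / r) ^ N = r⁻¹ ^ N * h ^ N := by rw [div_eq_mul_inv, mul_pow, mul_comm]
    rw [h3, hE]
    linarith
  have hR : ∀ z, 0 < z → |c * eigRight h l z - (rightSum c r ℓ b N h 0 (z / h ^ 3)
      + d * h ^ N * (z / h ^ 3 * χ (z / h ^ 3)))| ≤ E * h ^ N * Real.exp (-(z / h ^ 3 / 2)) := by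
    intro z hz
    have h1 := abs_sub_taylorRe_sum_le hr ((hB.holomorphic_right c).diff 0 (z / h ^ 3))
      (fun w hw => hMr w (Metric.sphere_subset_closedBall hw) (z / h ^ 3) (by positivity))
      (h := h) (by linarith) N
    rw [hB.right_re c 0 hhr', habs, pow_zero, one_mul] at h1
    have h3 : (h / r) ^ N = r⁻¹ ^ N * h ^ N := by rw [div_eq_mul_inv, mul_pow, mul_comm]
    have h4 : |d * h ^ N * (z / h ^ 3 * χ (z / h ^ 3))|
        ≤ |d| * h ^ N * (D * Real.exp (-(z / h ^ 3 / 2))) := by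
      rw [abs_mul, abs_mul, abs_of_nonneg (by positivity : (0 : ℝ) ≤ h ^ N)]
      exact mul_le_mul_of_nonneg_left (hXD _) (by positivity)
    rw [← sub_sub]
    refine (abs_sub _ _).trans ((add_le_add ?_ h4).trans_eq
      (b := 2 * M * r⁻¹ ^ N * h ^ N * Real.exp (-(z / h ^ 3 / 2))
        + |d| * h ^ N * (D * Real.exp (-(z / h ^ 3 / 2)))) (by rw [hE]; ring))
    unfold eigRight
    rw [← mul_assoc]
    refine h1.trans_eq ?_
    rw [h3]
    ring
  have h1 := eLpNorm_glue_two_scale_le hh hH hH1 (by positivity) hL hR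
  have h2 : (fun z => (c : ℂ) * glue (eigLeft h l) (eigRight h l) z -
        (quasimode (leftProfile c r ℓ 0) (rightProfile c r ℓ b 0) χ J (h ^ 3) z : ℂ))
      = glue (fun z => c * eigLeft h l z - leftSum c r ℓ N h 0 (z / h ^ 2))
        (fun z => c * eigRight h l z - (rightSum c r ℓ b N h 0 (z / h ^ 3)
          + d * h ^ N * (z / h ^ 3 * χ (z / h ^ 3)))) := by
    funext z
    rw [hB.quasimode_cube c χ J hh]
    unfold glue
    split_ifs <;> push_cast <;> ring
  rw [h2]
  refine h1.trans_eq ?_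
  congr 1
  rw [hN]
  ring

/-! ### Counting the eigenvalues -/

lemma IsBranch.matching' (hB : IsBranch n α r ℓ b) {h : ℝ} (hh : 0 < h) (hr : h ≤ r) :
    Matching h (ℓ h).re := hB.matching h (by rwa [abs_of_pos hh])

/-- The first `N` eigenvalues are the values of the first `N` branches: each interval between
consecutive zeros of the reverse Airy function carries exactly one matching. -/
lemma isNthSmallest_eigenvalue {N : ℕ} {α : ℕ → ℕ → ℝ} {r : ℕ → ℝ} {ℓ b : ℕ → ℂ → ℂ}
    (hB : ∀ m, 1 ≤ m → IsBranch m (α m) (r m) (ℓ m) (b m)) {h : ℝ} (hh : 0 < h)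
    (hr : ∀ m, 1 ≤ m → m ≤ N → h ≤ r m) {n : ℕ} (hn : 1 ≤ n) (hnN : n ≤ N) :
    IsNthSmallest (eigenvaluesBelowOne (h ^ 3)) n (h ^ 2 * (ℓ n h).re) := by
  have hI : ∀ m, 1 ≤ m → m ≤ N → (ℓ m h).re ∈ Set.Ioo (airyZero (m - 1)) (airyZero m) :=
    fun m h1 h2 => (hB m h1).mem_interval h hh (hr m h1 h2)
  have hM : ∀ m, 1 ≤ m → m ≤ N → Matching h (ℓ m h).re :=
    fun m h1 h2 => (hB m h1).matching' hh (hr m h1 h2)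
  have hmono : StrictMonoOn (fun m => h ^ 2 * (ℓ m h).re) (Set.Icc 1 n) := by
    intro m hm m' hm' hlt
    refine mul_lt_mul_of_pos_left ?_ (by positivity)
    have h1 := (hI m hm.1 (hm.2.trans hnN)).2
    have h2 := (hI m' hm'.1 (hm'.2.trans hnN)).1
    have h3 : airyZero m ≤ airyZero (m' - 1) := airyZero_strictMono.monotone (by omega)
    linarith
  refine isNthSmallest_of_enumeration (e := fun m => h ^ 2 * (ℓ m h).re) hn hmono ?_
  ext x
  constructor
  · rintro ⟨hx, hxn⟩
    obtain ⟨l, rfl⟩ : ∃ l, x = h ^ 2 * l := ⟨x / h ^ 2, by field_simp⟩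
    have hm := (mem_eigenvaluesBelowOne_iff hh).1 hx
    have hl : l ≤ (ℓ n h).re := le_of_mul_le_mul_left hxn (by positivity)
    obtain ⟨k, hk, h1, h2⟩ := exists_airyZero_interval (hm.pos hh)
      (hl.trans (hI n hn hnN).2.le)
    have h3 : l < airyZero (k + 1) := lt_of_le_of_ne h2 fun heq =>
      hm.airyA_ne_zero hh (by rw [heq]; exact airyA_airyZero (by omega))
    have h4 := hm.unique hh (hM (k + 1) (by omega) (by omega)) ⟨h1, h3⟩
      (hI (k + 1) (by omega) (by omega))
    exact ⟨k + 1, ⟨by omega, by omega⟩, by rw [h4]⟩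
  · rintro ⟨m, hm, rfl⟩
    exact ⟨(mem_eigenvaluesBelowOne_iff hh).2 (hM m hm.1 (hm.2.trans hnN)),
      hmono.monotoneOn hm ⟨hn, le_rfl⟩ hm.2⟩

lemma le_encard_of_isNthSmallest {S : Set ℝ} {N : ℕ} {x : ℝ} (h : IsNthSmallest S N x) :
    (N : ℕ∞) ≤ S.encard := by
  rw [← h.2]
  exact Set.encard_le_encard Set.inter_subset_left

lemma finrank_eigenspace_eq_one {h l : ℝ} (hh : 0 < h) (hl : h ^ 2 * l < 1) {c : ℝ} (hc : c ≠ 0)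
    {u : L2} (hu : u =ᵐ[volume] fun z => (c : ℂ) * glue (eigLeft h l) (eigRight h l) z)
    (hmem : u ∈ eigenspace (h ^ 3) (h ^ 2 * l)) (hu0 : u ≠ 0) :
    Module.finrank ℂ (eigenspace (h ^ 3) (h ^ 2 * l)) = 1 := by
  refine finrank_eq_one ⟨u, hmem⟩ (fun h0 => hu0 (congrArg Subtype.val h0)) fun w => ?_
  obtain ⟨a, ha, -⟩ := eigenspace_form hh hl w.2
  refine ⟨a / c, Subtype.ext (Lp.ext ?_)⟩
  filter_upwards [hu, ha, Lp.coeFn_smul (a / (c : ℂ)) u] with z h1 h2 h3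
  have hc' : (c : ℂ) ≠ 0 := Complex.ofReal_ne_zero.2 hc
  rw [h2, Submodule.coe_smul]
  simp only
  rw [h3, Pi.smul_apply, h1, smul_eq_mul]
  field_simp

/-- The eigenvector of the branch `ℓ`: the function glued from the Airy function and the decaying
exponential, multiplied by `c`. It is set to `0` where that function is not square-integrable, which
does not happen for small `κ > 0`. -/
def branchVector (c : ℝ) (ℓ : ℂ → ℂ) (κ : ℝ) : L2 :=
  open Classical in
  if hm : MemLp (fun z => (c : ℂ) * glue (eigLeft (κ ^ (1 / 3 : ℝ)) (ℓ (κ ^ (1 / 3 : ℝ) : ℝ)).re)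
      (eigRight (κ ^ (1 / 3 : ℝ)) (ℓ (κ ^ (1 / 3 : ℝ) : ℝ)).re) z) 2 volume
  then hm.toLp _ else 0

lemma branchVector_coe {c h : ℝ} (hh : 0 < h) (hl : h ^ 2 * (ℓ h).re < 1) :
    branchVector c ℓ (h ^ 3) =ᵐ[volume]
      fun z => (c : ℂ) * glue (eigLeft h (ℓ h).re) (eigRight h (ℓ h).re) z := by
  have h1 : (h ^ 3) ^ (1 / 3 : ℝ) = h := by simpa using rpow_cube_div_three hh 1
  have hm : MemLp (fun z => (c : ℂ) * glue (eigLeft h (ℓ h).re) (eigRight h (ℓ h).re) z) 2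
      volume := (memLp_eigenfunction hh hl).const_mul _
  unfold branchVector
  rw [h1, dif_pos hm]
  exact hm.coeFn_toLp

lemma exists_pos_le_of_finite (f : ℕ → ℝ) (N : ℕ) (hf : ∀ m, 1 ≤ m → 0 < f m) :
    ∃ ε : ℝ, 0 < ε ∧ ∀ m, 1 ≤ m → m ≤ N → ε ≤ f m := by
  induction N with
  | zero => exact ⟨1, one_pos, fun m h1 h2 => by omega⟩
  | succ N ih =>
    obtain ⟨ε, h0, h1⟩ := ih
    refine ⟨min ε (f (N + 1)), lt_min h0 (hf _ (by omega)), fun m h2 h3 => ?_⟩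
    rcases Nat.lt_or_ge N m with h4 | h4
    · rw [show m = N + 1 by omega]
      exact min_le_right _ _
    · exact (min_le_left _ _).trans (h1 m h2 h4)

end ToyModel

end

open ToyModel in
theorem theorem2p1 :
    ∃ (α : ℕ → ℕ → ℝ) (Ψ Φ : ℕ → ℕ → ℝ → ℝ) (u : ℕ → ℝ → ToyModel.L2),
      -- the first coefficient is the `n`-th zero of the reverse Airy function
      (∀ n, 1 ≤ n → ToyModel.IsNthSmallest ToyModel.airyZeros n (α n 0)) ∧
      -- the profiles
      (∀ n, 1 ≤ n → ToyModel.IsProfilePair (α n 0) (Ψ n) (Φ n)) ∧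
      -- the truncated expansions are in the domain and are quasimodes at every order
      (∀ n, 1 ≤ n → ∀ (J : ℕ) (χ : ℝ → ℝ), ToyModel.IsCutoff χ → ∀ κ₁ : ℝ, 0 < κ₁ →
        ∃ C : ℝ, ∀ κ : ℝ, 0 < κ → κ ≤ κ₁ →
          ∃ q : (ToyModel.Htoy κ).domain,
            ((q : ToyModel.L2) : ℝ → ℂ) =ᵐ[MeasureTheory.volume]
              (fun z => (ToyModel.quasimode (Ψ n) (Φ n) χ J κ z : ℂ)) ∧
            ‖ToyModel.Htoy κ q -
                (ToyModel.quasiEigenvalue (α n) J κ : ℂ) • (q : ToyModel.L2)‖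
              ≤ C * κ ^ (1 + (J : ℝ) / 3)) ∧
      ∀ N₀ : ℕ, ∃ κ₀ : ℝ, 0 < κ₀ ∧
        (∀ κ : ℝ, 0 < κ → κ < κ₀ →
          -- there are at least `N₀` eigenvalues below `1`
          (N₀ : ℕ∞) ≤ (ToyModel.eigenvaluesBelowOne κ).encard ∧
          -- the `n`-th one is simple, is the sum of its series, and has eigenvector `u n κ`
          ∀ n, 1 ≤ n → n ≤ N₀ → ∃ μ : ℝ,
            ToyModel.IsNthSmallest (ToyModel.eigenvaluesBelowOne κ) n μ ∧
            Module.finrank ℂ (ToyModel.eigenspace κ μ) = 1 ∧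
            HasSum (fun j : ℕ => κ ^ (2 / 3 : ℝ) * (α n j * κ ^ ((j : ℝ) / 3))) μ ∧
            u n κ ∈ ToyModel.eigenspace κ μ ∧ u n κ ≠ 0) ∧
        -- the expansion of the eigenvectors, to every order
        ∀ n, 1 ≤ n → n ≤ N₀ → ∀ (J : ℕ) (χ : ℝ → ℝ), ToyModel.IsCutoff χ →
          ∃ C : ℝ, ∀ κ : ℝ, 0 < κ → κ < κ₀ →
            MeasureTheory.eLpNorm
              (fun z => (u n κ : ℝ → ℂ) z - (ToyModel.quasimode (Ψ n) (Φ n) χ J κ z : ℂ))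
              2 MeasureTheory.volume ≤ ENNReal.ofReal (C * κ ^ (((J : ℝ) + 4) / 3)) := by
  have hex : ∀ n : ℕ, ∃ (α : ℕ → ℝ) (r : ℝ) (ℓ b : ℂ → ℂ),
      1 ≤ n → IsBranch n α r ℓ b := fun n => by
    by_cases hn : 1 ≤ n
    · obtain ⟨α, r, ℓ, b, h⟩ := exists_isBranch hn
      exact ⟨α, r, ℓ, b, fun _ => h⟩
    · exact ⟨0, 0, 0, 0, fun h => absurd h hn⟩
  choose α r ℓ b hB using hex
  set c : ℕ → ℝ := fun n => normConst (airyZero n) with hc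
  have hc0 : ∀ n, c n ≠ 0 := fun n => (normConst_pos _).ne'
  refine ⟨α, fun n => leftProfile (c n) (r n) (ℓ n) 0,
    fun n => rightProfile (c n) (r n) (ℓ n) (b n) 0,
    fun n => branchVector (c n) (ℓ n), fun n hn => ?_, fun n hn => (hB n hn).isProfilePair hn,
    fun n hn J χ hχ κ₁ _ => ?_, fun N₀ => ?_⟩
  · rw [(hB n hn).coeff_zero]
    exact isNthSmallest_airyZero hn
  · -- `max 1 (κ₁ + 1)` is a bound at least `1` for `h = κ ^ (1 / 3)`
    obtain ⟨C, hC⟩ := (hB n hn).exists_quasimode_bound (c n) J hχ (H := max 1 (κ₁ + 1))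
      (le_max_left _ _)
    refine ⟨C, fun κ hκ hκ₁ => ?_⟩
    obtain ⟨h, hh, rfl⟩ := exists_eq_cube hκ
    have hH : h ≤ max 1 (κ₁ + 1) := by
      by_contra! hc
      have h1 := (max_lt_iff.1 hc).1
      have h2 := (max_lt_iff.1 hc).2
      have h3 : h ≤ h ^ 3 := le_self_pow₀ h1.le (by norm_num)
      linarith
    obtain ⟨q, hq, hq'⟩ := hC h hh hH
    refine ⟨q, hq, hq'.trans_eq ?_⟩
    have h1 : (1 + (J : ℝ) / 3) = ((J + 3 : ℕ) : ℝ) / 3 := by push_cast; ring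
    rw [h1, rpow_cube_div_three hh]
  · -- half the radius leaves room for the geometric bound of the Taylor remainders, with constants
    -- that do not affect `κ₀`
    obtain ⟨ε, hε, hεr⟩ := exists_pos_le_of_finite (fun m => r m / 2) N₀
      fun m hm => half_pos (hB m hm).r_pos
    have hsmall : ∀ h : ℝ, 0 < h → h ^ 3 < ε ^ 3 → ∀ m, 1 ≤ m → m ≤ N₀ → h ≤ r m / 2 :=
      fun h hh hlt m h1 h2 => (lt_of_pow_lt_pow_left₀ 3 hε.le hlt).le.trans (hεr m h1 h2)
    have hle : ∀ m, 1 ≤ m → r m / 2 ≤ r m := fun m hm => half_le_self (hB m hm).r_pos.le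
    refine ⟨ε ^ 3, by positivity, fun κ hκ hκε => ?_, fun n hn hnN J χ hχ => ?_⟩
    · obtain ⟨h, hh, rfl⟩ := exists_eq_cube hκ
      have hhr : ∀ m, 1 ≤ m → m ≤ N₀ → h ≤ r m := fun m h1 h2 =>
        (hsmall h hh hκε m h1 h2).trans (hle m h1)
      have hnth : ∀ n, 1 ≤ n → n ≤ N₀ →
          IsNthSmallest (eigenvaluesBelowOne (h ^ 3)) n (h ^ 2 * (ℓ n h).re) := fun n hn hnN =>
        isNthSmallest_eigenvalue hB hh hhr hn hnN
      refine ⟨?_, fun n hn hnN => ⟨h ^ 2 * (ℓ n h).re, hnth n hn hnN, ?_⟩⟩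
      · rcases Nat.eq_zero_or_pos N₀ with h0 | h0
        · rw [h0]
          simp
        · exact le_encard_of_isNthSmallest (hnth N₀ h0 le_rfl)
      · have hm := (hB n hn).matching' hh (hhr n hn hnN)
        have hu := branchVector_coe (c := c n) hh hm.1
        have hmem := mem_eigenspace_of_matching hh hm hu
        have hu0 : branchVector (c n) (ℓ n) (h ^ 3) ≠ 0 := fun h0 => by
          refine Complex.ofReal_ne_zero.2 (hc0 n)
            (eigenfunction_not_ae_zero hh (ℓ n h).re (c := (c n : ℂ)) ?_)
          filter_upwards [hu, (Lp.eq_zero_iff_ae_eq_zero).1 h0] with z h1 h2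
          rw [← h1, h2, Pi.zero_apply]
        refine ⟨finrank_eigenspace_eq_one hh hm.1 (hc0 n) hu hmem hu0, ?_, hmem, hu0⟩
        rw [rpow_cube_two_thirds hh]
        simp_rw [rpow_cube_div_three hh]
        exact ((hB n hn).hasSum h (by rw [abs_of_pos hh]; exact hhr n hn hnN)).mul_left _
    · obtain ⟨C, hC⟩ := (hB n hn).exists_eigenfunction_bound (c n) J hχ
      refine ⟨C, fun κ hκ hκε => ?_⟩
      obtain ⟨h, hh, rfl⟩ := exists_eq_cube hκ
      have hhr := hsmall h hh hκε n hn hnN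
      have hm := (hB n hn).matching' hh (hhr.trans (hle n hn))
      have hu := branchVector_coe (c := c n) hh hm.1
      have h1 : ((J : ℝ) + 4) / 3 = ((J + 4 : ℕ) : ℝ) / 3 := by push_cast; ring
      rw [h1, rpow_cube_div_three hh]
      refine (eLpNorm_congr_ae ?_).trans_le (hC h hh hhr)
      filter_upwards [hu] with z hz
      rw [hz]
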